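/- Let $p\ge 3$ be an integer, $\lambda=\lambda_p=2\cos(\pi/p)$, and let $G_p=\langle S,T\rangle/\{\pm I\}$ be the Hecke group generated by $S=\begin{pmatrix}1&\lambda\\0&1\end{pmatrix}$ and $T=\begin{pmatrix}0&-1\\1&0\end{pmatrix}$; put $U=ST$. For $M=\begin{pmatrix}a&b\\c&d\end{pmatrix}$ write $Mz=\frac{az+b}{cz+d}$ and $(f\mid M)(z)=(cz+d)^{-2k}f(Mz)$. **Rational period functions.** An RPF of weight $2k$ on $G_p$ is a rational function $q\in\mathbb C(z)$ with $q+q\mid T=0$ and $q+q\mid U+\dots+q\mid U^{p-1}=0$. For a nonzero pole $\alpha$ of $q$, the irreducible system of poles $P(q;\alpha)$ is the minimal set of poles of $q$ which the two relations force to occur together with $\alpha$: the intersection of all sets $R\ni\alpha$ of nonzero poles of $q$ such that for each $\beta\in R$ one has $T\beta\in R$, and $U^j\beta\in R$ for some $1\le j\le p-1$. **Forms.** A $\lambda_p$-BQF is a form $Q=[A,B,C]=Ax^2+Bxy+Cy^2$ with $A,B,C\in\mathbb Z[\lambda_p]$ and $D=B^2-4AC>0$, required to be primitive (i.e. $(A)+(B)+(C)=(1)$)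 if $\mathbb Z[\lambda_p]$ is a principal ideal domain. Put $\alpha_Q=\frac{-B+\sqrt D}{2A}$. Forms are $G_p$-equivalent if $Q_2=Q_1\circ V$ for some $V\in G_p$, where $(Q\circ M)(x,y)=Q(ax+by,cx+dy)$. For a class $\mathcal A$ put $-\mathcal A=\{-Q: Q\in\mathcal A\}$. A real number $\alpha$ is a hyperbolic point if it is fixed by some $M\in G_p$ with $|a+d|>2$. If $\mathbb Z[\lambda_p]$ is a principal ideal domain, choose for each nonzero ideal $I$ a positive generator $g(I)$; otherwise put $g(I)=1$ for all $I$. The form $Q_\alpha$ associated with a hyperbolic point $\alpha$ is $Q_\alpha=\pm\frac1g[c,d-a,-b]$, where $\begin{pmatrix}a&b\\c&d\end{pmatrix}$ generates the stabilizer of $\alpha$ in $G_p$, $g=g\big((c,d-a,-b)\big)$, and the sign is such that $\alpha=\alpha_{Q_\alpha}$. If $Q_\alpha=[A,B,C]$ has discriminant $D$, the Hecke conjugate of $\alpha$ is $\alpha'=\frac{-B-\sqrt D}{2A}$. A set $R$ of hyperbolic points is Hecke-symmetric if $R=\{x': x\in R\}$. A class is hyperbolic if it contains some $Q_\alpha$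 with $\alpha$ hyperbolic. For a hyperbolic class $\mathcal A$, let $Z_{\mathcal A}$ be the set of hyperbolic points $x$ with $Q_x=[A,B,C]\in\mathcal A$ and $A>0>C$. **Theorem.** Let $k$ be a positive odd integer. For every hyperbolic class $\mathcal A$ with $-\mathcal A=\mathcal A$ the set $Z_{\mathcal A}$ is finite. A rational function $q$ is an RPF of weight $2k$ on $G_p$ all of whose irreducible systems of poles are Hecke-symmetric if and only if $$q(z)=\sum_{\ell=1}^{L}d_\ell\sum_{\alpha\in Z_{\mathcal A_\ell}}Q_\alpha(z,1)^{-k}+c_0\,q_{k,0}(z)$$ for some $L\ge 0$, hyperbolic $G_p$-equivalence classes $\mathcal A_1,\dots,\mathcal A_L$ of $\lambda_p$-BQFs with $-\mathcal A_\ell=\mathcal A_\ell$, complex constants $d_\ell$ and $c_0$, and a function $q_{k,0}$ of the form $$q_{k,0}(z)=\begin{cases}a_0(1-z^{-2k}),&2k\ne2,\\ a_0(1-z^{-2})+b_1z^{-1},&2k=2,\end{cases}\qquad a_0,b_1\in\mathbb C .$$ -/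

import Mathlib

open scoped MatrixGroups

noncomputable section

namespace HeckeRPF

/-! ### Hecke groups -/

/-- `λ_p = 2 cos(π / p)`. -/
def lam (p : ℕ) : ℝ := 2 * Real.cos (Real.pi / p)

/-- The ring `ℤ[λ_p]`, as a subring of the reals. -/
abbrev Zlam (p : ℕ) : Subalgebra ℤ ℝ := Algebra.adjoin ℤ {lam p}

/-- `λ_p` as an element of `ℤ[λ_p]`. -/
def lamZ (p : ℕ) : Zlam p := ⟨lam p, Algebra.subset_adjoin rfl⟩

/-- The translation `S = (1 λ; 0 1)`. -/
def S (p : ℕ) : SL(2, Zlam p) := ⟨!![1, lamZ p; 0, 1], by simp⟩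

/-- The inversion `T = (0 -1; 1 0)`. -/
def T (p : ℕ) : SL(2, Zlam p) := ⟨!![0, -1; 1, 0], by simp⟩

/-- `U = S T`. -/
def U (p : ℕ) : SL(2, Zlam p) := S p * T p

/-- The subgroup of `SL(2, ℤ[λ_p])` generated by `S` and `T`. It contains `-I = T²`; the Hecke
group `G_p` is its quotient by `{I, -I}`, and everything below depends on matrices only up to
sign. -/
def heckeGroup (p : ℕ) : Subgroup SL(2, Zlam p) := Subgroup.closure {S p, T p}

/-- The inclusion of `SL(2, ℤ[λ_p])` in `SL(2, ℝ)`. -/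
def toReal (p : ℕ) : SL(2, Zlam p) →* SL(2, ℝ) :=
  Matrix.SpecialLinearGroup.map (algebraMap (Zlam p) ℝ)

/-! ### Rational period functions -/

/-- The weight `2k` slash operator on rational functions:
`(f ∣ M)(z) = (c z + d)^(-2k) f ((a z + b) / (c z + d))`. The value of `RatFunc.eval` is the
composition of `f` with the rational function `(a z + b) / (c z + d)`. -/
def slash (k : ℕ) (f : RatFunc ℂ) (M : SL(2, ℝ)) : RatFunc ℂ :=
  ((RatFunc.C (M 1 0 : ℂ) * RatFunc.X + RatFunc.C (M 1 1 : ℂ)) ^ (2 * k))⁻¹ *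
    RatFunc.eval RatFunc.C
      ((RatFunc.C (M 0 0 : ℂ) * RatFunc.X + RatFunc.C (M 0 1 : ℂ)) /
        (RatFunc.C (M 1 0 : ℂ) * RatFunc.X + RatFunc.C (M 1 1 : ℂ))) f

/-- `q` is a rational period function of weight `2k` for `G_p`: `q + q ∣ T = 0` and
`q + q ∣ U + ⋯ + q ∣ U^(p-1) = 0`. -/
def IsRPF (p k : ℕ) (q : RatFunc ℂ) : Prop :=
  q + slash k q (toReal p (T p)) = 0 ∧
    q + ∑ n ∈ Finset.Icc 1 (p - 1), slash k q (toReal p (U p ^ n)) = 0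

/-- The set of nonzero (finite) poles of a rational function; `RatFunc.denom` is the denominator
in lowest terms. -/
def nonzeroPoles (q : RatFunc ℂ) : Set ℂ := {z | q.denom.IsRoot z ∧ z ≠ 0}

/-- The linear fractional transformation `z ↦ (a z + b) / (c z + d)`. -/
def moebius (M : SL(2, ℝ)) (z : ℂ) : ℂ :=
  ((M 0 0 : ℂ) * z + (M 0 1 : ℂ)) / ((M 1 0 : ℂ) * z + (M 1 1 : ℂ))

/-- A set `R` of nonzero poles of `q` that satisfies what the two relations force on poles: with
`β`, the point `T β` is also in `R` (first relation), and so is at least one of the points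
`U β, …, U^(p-1) β` (second relation). If `U^j β = ∞` then `moebius` takes the value `0`, which
is never in `R`. -/
def IsPoleSystem (p : ℕ) (q : RatFunc ℂ) (R : Set ℂ) : Prop :=
  R ⊆ nonzeroPoles q ∧
    (∀ β ∈ R, moebius (toReal p (T p)) β ∈ R) ∧
    (∀ β ∈ R, ∃ j ∈ Finset.Icc 1 (p - 1), moebius (toReal p (U p ^ j)) β ∈ R)

/-- The irreducible system of poles of `q` that contains `α`: the minimal set of poles of `q`
that are forced by the two relations to occur together with `α`. -/
def irreduciblePoleSet (p : ℕ) (q : RatFunc ℂ) (α : ℂ) : Set ℂ :=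
  ⋂₀ {R | IsPoleSystem p q R ∧ α ∈ R}

/-! ### Binary quadratic forms -/

/-- A form `A x² + B x y + C y²` with coefficients in `ℤ[λ_p]`. -/
@[ext]
structure Form (p : ℕ) where
  /-- the coefficient of `x²` -/
  A : Zlam p
  /-- the coefficient of `x y` -/
  B : Zlam p
  /-- the coefficient of `y²` -/
  C : Zlam p

namespace Form

variable {p : ℕ}

instance : Zero (Form p) := ⟨⟨0, 0, 0⟩⟩

instance : Neg (Form p) := ⟨fun Q => ⟨-Q.A, -Q.B, -Q.C⟩⟩

/-- The discriminant `D = B² - 4 A C`. -/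
def disc (Q : Form p) : Zlam p := Q.B ^ 2 - 4 * Q.A * Q.C

/-- The ideal `(A) + (B) + (C)`. -/
def content (Q : Form p) : Ideal (Zlam p) := Ideal.span {Q.A, Q.B, Q.C}

/-- `Q` is an (indefinite) `λ_p`-BQF: `D > 0`, and if `ℤ[λ_p]` is a principal ideal domain then
`Q` is primitive. -/
def IsBQF (Q : Form p) : Prop :=
  0 < (Q.disc : ℝ) ∧ (IsPrincipalIdealRing (Zlam p) → Q.content = ⊤)

/-- The number `α_Q = (-B + √D) / (2A)`. -/
def root (Q : Form p) : ℝ := (-(Q.B : ℝ) + √(Q.disc : ℝ)) / (2 * (Q.A : ℝ))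

/-- The number `(-B - √D) / (2A)`. -/
def conjRoot (Q : Form p) : ℝ := (-(Q.B : ℝ) - √(Q.disc : ℝ)) / (2 * (Q.A : ℝ))

/-- The action `(Q ∘ M)(x, y) = Q(a x + b y, c x + d y)`. -/
def comp (Q : Form p) (M : SL(2, Zlam p)) : Form p where
  A := Q.A * M 0 0 ^ 2 + Q.B * (M 0 0 * M 1 0) + Q.C * M 1 0 ^ 2
  B := 2 * Q.A * (M 0 0 * M 0 1) + Q.B * (M 0 0 * M 1 1 + M 0 1 * M 1 0) +
    2 * Q.C * (M 1 0 * M 1 1)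
  C := Q.A * M 0 1 ^ 2 + Q.B * (M 0 1 * M 1 1) + Q.C * M 1 1 ^ 2

/-- `G_p`-equivalence of forms. -/
def Equivalent (Q₁ Q₂ : Form p) : Prop := ∃ V ∈ heckeGroup p, Q₂ = Q₁.comp V

/-- `Q` is simple: `A > 0 > C`. -/
def IsSimple (Q : Form p) : Prop := 0 < (Q.A : ℝ) ∧ (Q.C : ℝ) < 0

/-- The polynomial `Q(z, 1)` as a rational function of `z`. -/
def ratFunc (Q : Form p) : RatFunc ℂ :=
  RatFunc.C ((Q.A : ℝ) : ℂ) * RatFunc.X ^ 2 + RatFunc.C ((Q.B : ℝ) : ℂ) * RatFunc.X +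
    RatFunc.C ((Q.C : ℝ) : ℂ)

end Form

/-! ### Hyperbolic points and their forms -/

/-- The linear fractional transformation `M` fixes the real number `α`. -/
def Fixes {p : ℕ} (M : SL(2, Zlam p)) (α : ℝ) : Prop :=
  (M 0 0 : ℝ) * α + (M 0 1 : ℝ) = α * ((M 1 0 : ℝ) * α + (M 1 1 : ℝ))

/-- `α` is a hyperbolic fixed point of `G_p`: it is fixed by some `M ∈ G_p` with
`|a + d| > 2`. -/
def IsHyperbolicPoint (p : ℕ) (α : ℝ) : Prop :=
  ∃ M ∈ heckeGroup p, 2 < |(M 0 0 : ℝ) + (M 1 1 : ℝ)| ∧ Fixes M α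

/-- `M` generates, modulo `{I, -I}`, the group of all elements of `G_p` that fix `α`. -/
def IsStabilizerGenerator (p : ℕ) (α : ℝ) (M : SL(2, Zlam p)) : Prop :=
  M ∈ heckeGroup p ∧ Fixes M α ∧
    ∀ N ∈ heckeGroup p, Fixes N α → ∃ n : ℤ, N = M ^ n ∨ N = -(M ^ n)

/-- The form `[c, d - a, -b]` of a matrix `(a b; c d)`. -/
def fixedForm {p : ℕ} (M : SL(2, Zlam p)) : Form p := ⟨M 1 0, M 1 1 - M 0 0, -(M 0 1)⟩

/-- A choice of the normalizing factor of forms with a given content ideal: if `ℤ[λ_p]` is a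
principal ideal domain, a positive generator of each nonzero ideal, and otherwise the
number `1`. -/
def IsNormalization (p : ℕ) (g : Ideal (Zlam p) → Zlam p) : Prop :=
  (IsPrincipalIdealRing (Zlam p) →
    ∀ I : Ideal (Zlam p), I ≠ ⊥ → 0 < (g I : ℝ) ∧ Ideal.span {g I} = I) ∧
  (¬ IsPrincipalIdealRing (Zlam p) → ∀ I : Ideal (Zlam p), g I = 1)

/-- `Q` is the form `± (1/g) [c, d - a, -b]` associated with `α`, where `(a b; c d)` generates the
stabilizer of `α`, `g` is the normalizing factor, and the sign is the one for which
`α = α_Q`. (With `M` also `-M` is a generator, which accounts for both signs.) -/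
def IsAssociatedForm (p : ℕ) (g : Ideal (Zlam p) → Zlam p) (α : ℝ) (Q : Form p) : Prop :=
  ∃ M, IsStabilizerGenerator p α M ∧
    g (fixedForm M).content * Q.A = (fixedForm M).A ∧
    g (fixedForm M).content * Q.B = (fixedForm M).B ∧
    g (fixedForm M).content * Q.C = (fixedForm M).C ∧
    α = Q.root

open Classical in
/-- The form `Q_α` associated with a hyperbolic fixed point `α` of `G_p` (and `0` if there is no
such form). -/
def formOf (p : ℕ) (g : Ideal (Zlam p) → Zlam p) (α : ℝ) : Form p :=
  if h : ∃ Q, IsAssociatedForm p g α Q then h.choose else 0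

/-- The Hecke conjugate `α'` of a hyperbolic fixed point `α`. -/
def heckeConj (p : ℕ) (g : Ideal (Zlam p) → Zlam p) (α : ℝ) : ℝ := (formOf p g α).conjRoot

/-- `R` is a set of hyperbolic fixed points of `G_p` with `R = R'`. -/
def IsHeckeSymmetric (p : ℕ) (g : Ideal (Zlam p) → Zlam p) (R : Set ℂ) : Prop :=
  (∀ z ∈ R, ∃ x : ℝ, IsHyperbolicPoint p x ∧ z = (x : ℂ)) ∧
    R = {w | ∃ x : ℝ, (x : ℂ) ∈ R ∧ w = ((heckeConj p g x : ℝ) : ℂ)}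

/-- All irreducible systems of (nonzero) poles of `q` are Hecke-symmetric. -/
def HasSymmetricPoleSystems (p : ℕ) (g : Ideal (Zlam p) → Zlam p) (q : RatFunc ℂ) : Prop :=
  ∀ α ∈ nonzeroPoles q, IsHeckeSymmetric p g (irreduciblePoleSet p q α)

/-! ### Equivalence classes and their cycles -/

/-- `𝒜` is a hyperbolic `G_p`-equivalence class of `λ_p`-BQFs: the class of the form associated
with some hyperbolic point. -/
def IsHyperbolicClass (p : ℕ) (g : Ideal (Zlam p) → Zlam p) (𝒜 : Set (Form p)) : Prop :=
  ∃ α, IsHyperbolicPoint p α ∧ 𝒜 = {Q | Q.IsBQF ∧ (formOf p g α).Equivalent Q}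

/-- `-𝒜 = {-Q ∣ Q ∈ 𝒜}`. -/
def negClass {p : ℕ} (𝒜 : Set (Form p)) : Set (Form p) := {Q | ∃ Q₀ ∈ 𝒜, Q = -Q₀}

/-- `Z_𝒜 = {x ∣ Q_x ∈ 𝒜, Q_x simple}`, with `x` ranging over the hyperbolic points. -/
def cycleOf (p : ℕ) (g : Ideal (Zlam p) → Zlam p) (𝒜 : Set (Form p)) : Set ℝ :=
  {x | IsHyperbolicPoint p x ∧ formOf p g x ∈ 𝒜 ∧ (formOf p g x).IsSimple}

/-- The functions `q_{k,0}` with constants `a₀` and `b₁`: `a₀ (1 - z^(-2k))` if `2k ≠ 2`, and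
`a₀ (1 - z^(-2)) + b₁ z^(-1)` if `2k = 2`. -/
def qZero (k : ℕ) (a₀ b₁ : ℂ) : RatFunc ℂ :=
  if 2 * k ≠ 2 then RatFunc.C a₀ * (1 - (RatFunc.X ^ (2 * k))⁻¹)
  else RatFunc.C a₀ * (1 - (RatFunc.X ^ 2)⁻¹) + RatFunc.C b₁ * RatFunc.X⁻¹

end HeckeRPF

end

/-!
The proof describes the poles of a rational period function `q` by a continued fraction algorithm for
the Hecke group, and then removes them one class at a time.

**Continued fractions.** Of the points `x, U x, …, U^(p-1) x` in the `U`-orbit of a point that is not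
a cusp, exactly one is negative (`act_U_neg_unique`). The map `cfMap` sends `x` to `T Uᵗ x > 0`, where
`Uᵗ x` is this point. Equivalent points have the same tails under `cfMap`, and the group element that
relates them is the quotient of two words of the algorithm (`exists_cfWord_eq`). Hence hyperbolic
points are eventually periodic, and the stabilizer of a periodic point is generated by the word of its
period; in particular stabilizers are cyclic modulo `±I`, which is what makes `Q_α` and the Hecke
conjugate well defined. That hyperbolic points are not cusps follows from a normal form: up to factors
`T` on either side and a sign, group elements are products of the nonnegative matrices `-Uʲ T`, whose
entries are `0` or at least `1` (`normal_form`, `entries_of_mem`). A hyperbolic point is purely periodic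
if and only if it is positive with negative conjugate, that is if `Q_α` is simple
(`IsSimplePoint.periodic`, `isSimplePoint_of_periodic`). So `Z_𝒜` is a single cycle of `cfMap`, and it is
finite (`finite_cycleOf_formClass`). The class of `Q_α` satisfies `-𝒜 = 𝒜` if and only if `α` is
equivalent to `α'` (`negClass_formClass`).

**The functions of the classes.** If `-𝒜 = 𝒜` and `k` is odd, then `∑ Q_α(z, 1)^(-k)` over `Z_𝒜` is a
rational period function (`isRPF_sum_cycle`): `α ↦ T α'` permutes `Z_𝒜` and gives the first relation,
and in the second relation the translates of the forms `Q_α` cancel in pairs `N`, `-N`.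

**Poles.** In a system of poles, `T` exchanges positive and negative points, and every negative point
requires a positive one in its `U`-orbit. As `U`-orbits contain one negative point each, counting shows
that positive and negative poles correspond one-to-one (`IsRealSystem.count`). So `cfMap` permutes
the positive poles, which are therefore purely periodic, and an irreducible system is a cycle together
with its image under `T` (`IsRPF.irreduciblePoleSet_eq`). It is Hecke-symmetric if and only if its
points are equivalent to their conjugates. The two directions of this equivalence are
`HasSymmetricPoleSystems.polesSelfConjugate` and `IsRPF.hasSymmetricPoleSystems`.

**Removing the poles.** At a positive pole `w`, the counting argument leaves only two singular terms in
the second relation, so that `q - q ∣ M` is regular at `w` for the words `M` of the algorithm and thus for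
the whole stabilizer of `w` (`IsRPF.regAt_sub_slashZ_of_fixes`). Comparing leading coefficients for a
hyperbolic `M` shows that a pole with this property has order `k`. This applies to `q` and to
`q - c Q_w^(-k)`, and with `c` chosen to cancel the leading term the latter must be regular at `w`
(`exists_regAt_sub`). Subtracting `c` times the function of the class of `w` therefore leaves fewer
poles. At the end there are no nonzero poles, and the degree at infinity is bounded with the help of
the translation `S`, which leaves the functions `q_{k,0}` (`eq_qZero_of_no_poles`).
-/

namespace HeckeRPF

variable {p : ℕ}

/-! ### Powers of `U` -/

/-- The Chebyshev sequence `s₀ = 0`, `s₁ = 1`, `sₙ₊₂ = λ sₙ₊₁ - sₙ`, that is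
`sₙ = sin (n π / p) / sin (π / p)`, which gives the entries of the powers of `U`. -/
noncomputable def chebS (p : ℕ) : ℕ → Zlam p
  | 0 => 0
  | 1 => 1
  | n + 2 => lamZ p * chebS p (n + 1) - chebS p n

@[simp] lemma chebS_zero : chebS p 0 = 0 := rfl
@[simp] lemma chebS_one : chebS p 1 = 1 := rfl
lemma chebS_add_two (n : ℕ) : chebS p (n + 2) = lamZ p * chebS p (n + 1) - chebS p n := rfl

lemma coe_lamZ : ((lamZ p : Zlam p) : ℝ) = lam p := rfl

lemma T_apply : (T p 0 0 = 0 ∧ T p 0 1 = -1) ∧ (T p 1 0 = 1 ∧ T p 1 1 = 0) := by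
  simp [T]

lemma S_apply : (S p 0 0 = 1 ∧ S p 0 1 = lamZ p) ∧ (S p 1 0 = 0 ∧ S p 1 1 = 1) := by
  simp [S]

lemma mul_apply_two (M N : SL(2, Zlam p)) (i j : Fin 2) :
    (M * N) i j = M i 0 * N 0 j + M i 1 * N 1 j := by
  simp [Matrix.mul_apply, Fin.sum_univ_two]

lemma det_eq (M : SL(2, Zlam p)) : M 0 0 * M 1 1 - M 0 1 * M 1 0 = 1 := by
  have := M.det_coe
  rwa [Matrix.det_fin_two] at this

lemma det_eq_real (M : SL(2, Zlam p)) :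
    (M 0 0 : ℝ) * (M 1 1 : ℝ) - (M 0 1 : ℝ) * (M 1 0 : ℝ) = 1 := by
  exact_mod_cast congrArg (Subtype.val) (det_eq M)

lemma inv_apply_two (M : SL(2, Zlam p)) :
    (M⁻¹ 0 0 = M 1 1 ∧ M⁻¹ 0 1 = -M 0 1) ∧ (M⁻¹ 1 0 = -M 1 0 ∧ M⁻¹ 1 1 = M 0 0) := by
  simp [Matrix.SpecialLinearGroup.coe_inv, Matrix.adjugate_fin_two]

lemma neg_apply_two (M : SL(2, Zlam p)) (i j : Fin 2) : (-M) i j = -(M i j) := by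
  simp

lemma ext_two {M N : SL(2, Zlam p)} (h00 : M 0 0 = N 0 0) (h01 : M 0 1 = N 0 1)
    (h10 : M 1 0 = N 1 0) (h11 : M 1 1 = N 1 1) : M = N := by
  ext i j
  fin_cases i <;> fin_cases j <;> simp_all

lemma T_mul_T : T p * T p = -1 := by
  obtain ⟨⟨t1, t2⟩, t3, t4⟩ := T_apply (p := p)
  apply ext_two <;> rw [mul_apply_two] <;> simp [t1, t2, t3, t4]

lemma T_inv : (T p)⁻¹ = -T p := by
  rw [inv_eq_iff_mul_eq_one, mul_neg, T_mul_T, neg_neg]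

lemma T_mem : T p ∈ heckeGroup p := Subgroup.subset_closure (by simp)
lemma S_mem : S p ∈ heckeGroup p := Subgroup.subset_closure (by simp)
lemma U_mem : U p ∈ heckeGroup p := mul_mem S_mem T_mem
lemma U_pow_mem (n : ℕ) : U p ^ n ∈ heckeGroup p := pow_mem U_mem n
lemma neg_one_mem : (-1 : SL(2, Zlam p)) ∈ heckeGroup p := T_mul_T (p := p) ▸ mul_mem T_mem T_mem
lemma neg_mem_hecke {M : SL(2, Zlam p)} (h : M ∈ heckeGroup p) : -M ∈ heckeGroup p := by
  have := mul_mem neg_one_mem h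
  rwa [neg_one_mul] at this

lemma U_apply : (U p 0 0 = lamZ p ∧ U p 0 1 = -1) ∧ (U p 1 0 = 1 ∧ U p 1 1 = 0) := by
  obtain ⟨⟨t1, t2⟩, t3, t4⟩ := T_apply (p := p)
  obtain ⟨⟨s1, s2⟩, s3, s4⟩ := S_apply (p := p)
  simp only [U, mul_apply_two, t1, t2, t3, t4, s1, s2, s3, s4]
  simp

lemma U_pow_apply (n : ℕ) :
    ((U p ^ n) 0 0 = chebS p (n + 1) ∧ (U p ^ n) 0 1 = -chebS p n) ∧
      ((U p ^ n) 1 0 = chebS p n ∧ (U p ^ n) 1 1 = chebS p (n + 1) - lamZ p * chebS p n) := by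
  induction n with
  | zero => simp
  | succ n ih =>
    obtain ⟨⟨h1, h2⟩, h3, h4⟩ := ih
    obtain ⟨⟨u1, u2⟩, u3, u4⟩ := U_apply (p := p)
    simp only [pow_succ, mul_apply_two, h1, h2, h3, h4, u1, u2, u3, u4, chebS_add_two]
    refine ⟨⟨?_, ?_⟩, ?_, ?_⟩ <;> ring

lemma chebS_identity (n : ℕ) :
    chebS p (n + 1) ^ 2 - chebS p n * chebS p (n + 2) = 1 := by
  obtain ⟨⟨h1, h2⟩, h3, h4⟩ := U_pow_apply (p := p) n
  have := det_eq (U p ^ n)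
  rw [h1, h2, h3, h4] at this
  rw [chebS_add_two]
  linear_combination this

lemma angle_pos (hp : 3 ≤ p) : 0 < Real.pi / p := by
  have : (0 : ℝ) < p := by positivity
  have := Real.pi_pos
  positivity

lemma sin_angle_pos (hp : 3 ≤ p) : 0 < Real.sin (Real.pi / p) := by
  have h3 : (3 : ℝ) ≤ p := by exact_mod_cast hp
  apply Real.sin_pos_of_pos_of_lt_pi (angle_pos hp)
  rw [div_lt_iff₀ (by linarith)]
  nlinarith [Real.pi_pos]

lemma chebS_mul_sin (n : ℕ) :
    (chebS p n : ℝ) * Real.sin (Real.pi / p) = Real.sin (n * (Real.pi / p)) := by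
  induction n using Nat.strong_induction_on with
  | _ n ih =>
    match n with
    | 0 => simp
    | 1 => simp
    | n + 2 =>
      have h1 := ih (n + 1) (by omega)
      have h0 := ih n (by omega)
      rw [chebS_add_two]
      push_cast at h1 h0 ⊢
      rw [coe_lamZ, sub_mul, mul_assoc, h1, h0, lam]
      set θ := Real.pi / p
      rw [show ((n : ℝ) + 2) * θ = (n + 1) * θ + θ by ring, Real.sin_add,
        show (n : ℝ) * θ = (n + 1) * θ - θ by ring, Real.sin_sub]
      ring

lemma chebS_p (hp : 3 ≤ p) : chebS p p = 0 := by
  have h := chebS_mul_sin (p := p) p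
  have hp0 : (p : ℝ) ≠ 0 := by positivity
  rw [mul_div_cancel₀ _ hp0, Real.sin_pi] at h
  have := (mul_eq_zero.1 h).resolve_right (sin_angle_pos hp).ne'
  exact_mod_cast this

lemma chebS_p_add_one (hp : 3 ≤ p) : chebS p (p + 1) = -1 := by
  have h := chebS_mul_sin (p := p) (p + 1)
  have hp0 : (p : ℝ) ≠ 0 := by positivity
  push_cast at h
  rw [add_mul, mul_div_cancel₀ _ hp0, one_mul, add_comm Real.pi, Real.sin_add_pi] at h
  have : (chebS p (p + 1) : ℝ) = -1 := by
    apply mul_right_cancel₀ (sin_angle_pos hp).ne'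
    rw [h]; ring
  exact_mod_cast this

lemma U_pow_p (hp : 3 ≤ p) : U p ^ p = -1 := by
  obtain ⟨⟨h1, h2⟩, h3, h4⟩ := U_pow_apply (p := p) p
  apply ext_two <;> simp [-Matrix.SpecialLinearGroup.coe_pow, h1, h2, h3, h4, chebS_p hp,
    chebS_p_add_one hp]

lemma one_le_chebS (hp : 3 ≤ p) {n : ℕ} (h1 : 1 ≤ n) (h2 : n + 1 ≤ p) :
    1 ≤ (chebS p n : ℝ) := by
  have hs := sin_angle_pos hp
  have hθ := angle_pos hp
  rw [← mul_le_mul_iff_left₀ hs, chebS_mul_sin, one_mul]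
  have hp0 : (0 : ℝ) < p := by positivity
  have hpθ : (p : ℝ) * (Real.pi / p) = Real.pi := mul_div_cancel₀ _ hp0.ne'
  set θ := Real.pi / p
  have h1' : (1 : ℝ) ≤ n := by exact_mod_cast h1
  have h2' : (n : ℝ) + 1 ≤ p := by exact_mod_cast h2
  -- beyond `π / 2`, reflect the angle
  rcases le_total ((n : ℝ) * θ) (Real.pi / 2) with h | h
  · apply Real.sin_le_sin_of_le_of_le_pi_div_two <;> nlinarith
  · rw [← Real.sin_pi_sub (n * θ)]
    apply Real.sin_le_sin_of_le_of_le_pi_div_two <;> nlinarith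

lemma chebS_nonneg (hp : 3 ≤ p) {n : ℕ} (h2 : n ≤ p) : 0 ≤ (chebS p n : ℝ) := by
  rcases Nat.eq_zero_or_pos n with rfl | h
  · simp
  · rcases h2.eq_or_lt with rfl | h'
    · simp [chebS_p hp]
    · linarith [one_le_chebS hp h h']

lemma chebS_eq_zero_or (hp : 3 ≤ p) {n : ℕ} (h2 : n ≤ p) :
    (chebS p n : ℝ) = 0 ∨ 1 ≤ (chebS p n : ℝ) := by
  rcases Nat.eq_zero_or_pos n with rfl | h
  · simp
  · rcases h2.eq_or_lt with rfl | h'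
    · simp [chebS_p hp]
    · exact Or.inr (one_le_chebS hp h h')

/-! ### Entries of the elements of the Hecke group -/

/-- The matrix `-Uʲ T = (sⱼ, sⱼ₊₁; sⱼ₋₁, sⱼ)`; for `1 ≤ j < p` its entries are nonnegative. -/
noncomputable def posMat (p j : ℕ) : SL(2, Zlam p) := -(U p ^ j * T p)

lemma posMat_apply (j : ℕ) :
    (posMat p (j + 1) 0 0 = chebS p (j + 1) ∧ posMat p (j + 1) 0 1 = chebS p (j + 2)) ∧
      (posMat p (j + 1) 1 0 = chebS p j ∧ posMat p (j + 1) 1 1 = chebS p (j + 1)) := by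
  obtain ⟨⟨h1, h2⟩, h3, h4⟩ := U_pow_apply (p := p) (j + 1)
  obtain ⟨⟨t1, t2⟩, t3, t4⟩ := T_apply (p := p)
  simp only [posMat, neg_apply_two, mul_apply_two, h1, h2, h3, h4, t1, t2, t3, t4, chebS_add_two]
  refine ⟨⟨?_, ?_⟩, ?_, ?_⟩ <;> ring

/-- The monoid generated by the nonnegative matrices `-Uʲ T`, `1 ≤ j < p`. -/
noncomputable def posMonoid (p : ℕ) : Submonoid SL(2, Zlam p) :=
  Submonoid.closure {M | ∃ j, 1 ≤ j ∧ j < p ∧ M = posMat p j}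

lemma posMat_mem {j : ℕ} (h1 : 1 ≤ j) (h2 : j < p) : posMat p j ∈ posMonoid p :=
  Submonoid.subset_closure ⟨j, h1, h2, rfl⟩

lemma posMat_entries (hp : 3 ≤ p) {j : ℕ} (h1 : 1 ≤ j) (h2 : j < p) (a b : Fin 2) :
    (posMat p j a b : ℝ) = 0 ∨ 1 ≤ (posMat p j a b : ℝ) := by
  obtain ⟨j, rfl⟩ := Nat.exists_eq_add_of_le' h1
  obtain ⟨⟨h1, h2⟩, h3, h4⟩ := posMat_apply (p := p) j
  fin_cases a <;> fin_cases b
  · simpa [h1] using chebS_eq_zero_or hp (n := j + 1) (by omega)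
  · simpa [h2] using chebS_eq_zero_or hp (n := j + 2) (by omega)
  · simpa [h3] using chebS_eq_zero_or hp (n := j) (by omega)
  · simpa [h4] using chebS_eq_zero_or hp (n := j + 1) (by omega)

/-- The set `{0} ∪ [1, ∞)` is a semiring, so the elements of `posMonoid` inherit from its
generators that their entries lie in it. -/
lemma posMonoid_entries (hp : 3 ≤ p) {M : SL(2, Zlam p)} (hM : M ∈ posMonoid p) (a b : Fin 2) :
    (M a b : ℝ) = 0 ∨ 1 ≤ (M a b : ℝ) := by
  have hmul : ∀ x y : ℝ, (x = 0 ∨ 1 ≤ x) → (y = 0 ∨ 1 ≤ y) → (x * y = 0 ∨ 1 ≤ x * y) := by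
    rintro x y (rfl | hx) (rfl | hy)
    · simp
    · simp
    · simp
    · right; nlinarith
  have hadd : ∀ x y : ℝ, (x = 0 ∨ 1 ≤ x) → (y = 0 ∨ 1 ≤ y) → (x + y = 0 ∨ 1 ≤ x + y) := by
    rintro x y (rfl | hx) (rfl | hy)
    · simp
    · simpa using Or.inr hy
    · simpa using Or.inr hx
    · right; linarith
  induction hM using Submonoid.closure_induction generalizing a b with
  | mem M h =>
    obtain ⟨j, h1, h2, rfl⟩ := h
    exact posMat_entries hp h1 h2 a b
  | one => fin_cases a <;> fin_cases b <;> simp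
  | mul M N _ _ ihM ihN =>
    rw [mul_apply_two]
    push_cast
    exact hadd _ _ (hmul _ _ (ihM _ _) (ihN _ _)) (hmul _ _ (ihM _ _) (ihN _ _))

/-- Equality up to sign, that is equality in the quotient by `{I, -I}`. -/
def SignEq (M N : SL(2, Zlam p)) : Prop := M = N ∨ M = -N

lemma SignEq.refl (M : SL(2, Zlam p)) : SignEq M M := Or.inl rfl
lemma SignEq.symm {M N : SL(2, Zlam p)} (h : SignEq M N) : SignEq N M := by
  rcases h with rfl | rfl
  · exact Or.inl rfl
  · exact Or.inr (neg_neg _).symm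
lemma SignEq.trans {M N K : SL(2, Zlam p)} (h : SignEq M N) (h' : SignEq N K) : SignEq M K := by
  rcases h with rfl | rfl <;> rcases h' with rfl | rfl <;> simp [SignEq]
lemma SignEq.mul {M N M' N' : SL(2, Zlam p)} (h : SignEq M N) (h' : SignEq M' N') :
    SignEq (M * M') (N * N') := by
  rcases h with rfl | rfl <;> rcases h' with rfl | rfl <;> simp [SignEq]
lemma SignEq.neg_left (M : SL(2, Zlam p)) : SignEq (-M) M := Or.inr rfl
lemma SignEq.mul_left_cancel {K M N : SL(2, Zlam p)} (h : SignEq (K * M) (K * N)) :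
    SignEq M N := by
  have := (SignEq.refl K⁻¹).mul h
  simpa using this
lemma SignEq.T_mul_T : SignEq (T p * T p) 1 := Or.inr HeckeRPF.T_mul_T
lemma SignEq.U_pow_p (hp : 3 ≤ p) : SignEq (U p ^ p) 1 := Or.inr (HeckeRPF.U_pow_p hp)
lemma SignEq.posMat (j : ℕ) : SignEq (posMat p j) (U p ^ j * T p) := Or.inr rfl

lemma S_eq_posMat : S p = posMat p 1 := by
  rw [posMat, U, pow_one, mul_assoc, HeckeRPF.T_mul_T, mul_neg, mul_one, neg_neg]

/-- Normal form: up to sign, every element of the Hecke group is `Tᵉ V Tᶠ` with `V` a product of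
nonnegative matrices `-Uʲ T`. -/
lemma normal_form (hp : 3 ≤ p) {M : SL(2, Zlam p)} (hM : M ∈ heckeGroup p) :
    ∃ e f : ℕ, ∃ V ∈ posMonoid p, e ≤ 1 ∧ f ≤ 1 ∧ SignEq M (T p ^ e * V * T p ^ f) := by
  have one_ok : ∃ e f : ℕ, ∃ V ∈ posMonoid p, e ≤ 1 ∧ f ≤ 1 ∧
      SignEq (1 : SL(2, Zlam p)) (T p ^ e * V * T p ^ f) :=
    ⟨0, 0, 1, one_mem _, by simp, by simp, by simp [SignEq]⟩
  have mulT : ∀ M : SL(2, Zlam p), (∃ e f : ℕ, ∃ V ∈ posMonoid p, e ≤ 1 ∧ f ≤ 1 ∧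
      SignEq M (T p ^ e * V * T p ^ f)) → ∃ e f : ℕ, ∃ V ∈ posMonoid p, e ≤ 1 ∧ f ≤ 1 ∧
      SignEq (M * T p) (T p ^ e * V * T p ^ f) := by
    rintro M ⟨e, f, V, hV, he, hf, h⟩
    interval_cases f
    · exact ⟨e, 1, V, hV, he, le_rfl, by simpa using h.mul (SignEq.refl (T p))⟩
    · refine ⟨e, 0, V, hV, he, zero_le_one, (h.mul (SignEq.refl (T p))).trans ?_⟩
      rw [pow_one, mul_assoc, pow_zero]
      exact (SignEq.refl _).mul SignEq.T_mul_T
  have mulS : ∀ M : SL(2, Zlam p), (∃ e f : ℕ, ∃ V ∈ posMonoid p, e ≤ 1 ∧ f ≤ 1 ∧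
      SignEq M (T p ^ e * V * T p ^ f)) → ∃ e f : ℕ, ∃ V ∈ posMonoid p, e ≤ 1 ∧ f ≤ 1 ∧
      SignEq (M * S p) (T p ^ e * V * T p ^ f) := by
    rintro M ⟨e, f, V, hV, he, hf, h⟩
    have hS : S p ∈ posMonoid p := S_eq_posMat (p := p) ▸ posMat_mem le_rfl (by omega)
    have h' := h.mul (SignEq.refl (S p))
    interval_cases f
    · exact ⟨e, 0, V * S p, mul_mem hV hS, he, zero_le_one, by simpa [mul_assoc] using h'⟩
    · rw [pow_one] at h'
      -- the last factor of `V` absorbs `T S`, since `(-Uʲ T) T S = ± Uʲ⁺¹ T`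
      induction hV using Submonoid.closure_induction_right with
      | one =>
        interval_cases e
        · exact ⟨1, 0, S p, hS, le_rfl, zero_le_one, by simpa using h'⟩
        · refine ⟨0, 0, S p, hS, zero_le_one, zero_le_one, h'.trans ?_⟩
          simpa using SignEq.T_mul_T.mul (SignEq.refl (S p))
      | mul_right V' hV' A hA _ =>
        obtain ⟨j, h1, h2, rfl⟩ := hA
        have key : SignEq (posMat p j * (T p * S p)) (U p ^ (j + 1) * T p) := by
          have e1 : SignEq (T p * T p * S p * T p * T p) (S p) := by
            have := (SignEq.T_mul_T.mul (SignEq.refl (S p))).mul (SignEq.T_mul_T (p := p))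
            simpa [mul_assoc] using this
          have e2 : SignEq (posMat p j * (T p * S p)) (U p ^ j * T p * (T p * S p)) :=
            (SignEq.posMat j).mul (SignEq.refl _)
          refine e2.trans ?_
          have e3 : U p ^ j * T p * (T p * S p) = U p ^ j * (T p * T p * S p) := by
            simp only [mul_assoc]
          have e4 : U p ^ (j + 1) * T p = U p ^ j * (S p * (T p * T p)) := by
            rw [pow_succ, U]; simp only [mul_assoc]
          rw [e3, e4]
          apply (SignEq.refl _).mul
          rw [HeckeRPF.T_mul_T]; simp [SignEq]
        have h'' : SignEq (M * S p) (T p ^ e * V' * (U p ^ (j + 1) * T p)) := by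
          refine h'.trans ?_
          have := (SignEq.refl (T p ^ e * V')).mul key
          simpa only [mul_assoc] using this
        by_cases hj : j + 1 < p
        · refine ⟨e, 0, V' * posMat p (j + 1), mul_mem hV' (posMat_mem (by omega) hj), he,
            zero_le_one, h''.trans ?_⟩
          rw [pow_zero, mul_one, mul_assoc]
          exact (SignEq.refl _).mul ((SignEq.refl _).mul (SignEq.posMat _).symm)
        · have hj' : j + 1 = p := by omega
          refine ⟨e, 1, V', hV', he, le_rfl, h''.trans ?_⟩
          rw [hj', pow_one]
          apply (SignEq.refl _).mul
          simpa using (SignEq.U_pow_p hp).mul (SignEq.refl (T p))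
  have mulU : ∀ n : ℕ, ∀ M : SL(2, Zlam p), (∃ e f : ℕ, ∃ V ∈ posMonoid p, e ≤ 1 ∧ f ≤ 1 ∧
      SignEq M (T p ^ e * V * T p ^ f)) → ∃ e f : ℕ, ∃ V ∈ posMonoid p, e ≤ 1 ∧ f ≤ 1 ∧
      SignEq (M * U p ^ n) (T p ^ e * V * T p ^ f) := by
    intro n
    induction n with
    | zero => intro M h; simpa using h
    | succ n ih =>
      intro M h
      have := mulT _ (mulS _ (ih _ h))
      rwa [mul_assoc, mul_assoc, ← U, ← pow_succ] at this
  have congr : ∀ M N : SL(2, Zlam p), SignEq M N → (∃ e f : ℕ, ∃ V ∈ posMonoid p, e ≤ 1 ∧ f ≤ 1 ∧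
      SignEq M (T p ^ e * V * T p ^ f)) → ∃ e f : ℕ, ∃ V ∈ posMonoid p, e ≤ 1 ∧ f ≤ 1 ∧
      SignEq N (T p ^ e * V * T p ^ f) := by
    rintro M N hMN ⟨e, f, V, hV, he, hf, h⟩
    exact ⟨e, f, V, hV, he, hf, hMN.symm.trans h⟩
  induction hM using Subgroup.closure_induction_right with
  | one => exact one_ok
  | mul_right M hM A hA ih =>
    rcases hA with rfl | rfl
    · exact mulS _ ih
    · exact mulT _ ih
  | mul_inv_cancel M hM A hA ih =>
    rcases hA with rfl | rfl
    · -- `S⁻¹ = ± T Uᵖ⁻¹`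
      have h1 : SignEq (T p * U p ^ (p - 1)) (S p)⁻¹ := by
        apply SignEq.mul_left_cancel (K := S p)
        rw [mul_inv_cancel, ← mul_assoc, ← U, ← pow_succ', Nat.sub_add_cancel (by omega)]
        exact SignEq.U_pow_p hp
      refine congr _ _ ((SignEq.refl M).mul h1) ?_
      rw [← mul_assoc]
      exact mulU _ _ (mulT _ ih)
    · rw [T_inv]
      exact congr _ _ ((SignEq.refl M).mul (SignEq.neg_left _).symm) (mulT _ ih)

/-- The entries of an element of the Hecke group are `0` or at least `1` in absolute value. This
is the form in which the discreteness of the group is used. -/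
lemma entries_of_mem (hp : 3 ≤ p) {M : SL(2, Zlam p)} (hM : M ∈ heckeGroup p) (a b : Fin 2) :
    (M a b : ℝ) = 0 ∨ 1 ≤ |(M a b : ℝ)| := by
  obtain ⟨e, f, V, hV, he, hf, h⟩ := normal_form hp hM
  have hVe := posMonoid_entries hp hV
  have habs : ∀ x : ℝ, x = 0 ∨ 1 ≤ x → x = 0 ∨ 1 ≤ |x| := fun x hx =>
    hx.imp id fun h => h.trans (le_abs_self x)
  obtain ⟨⟨t1, t2⟩, t3, t4⟩ := T_apply (p := p)
  have key : ∀ a b, ((T p ^ e * V * T p ^ f) a b : ℝ) = 0 ∨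
      1 ≤ |((T p ^ e * V * T p ^ f) a b : ℝ)| := by
    intro a b
    interval_cases e <;> interval_cases f <;> fin_cases a <;> fin_cases b <;>
      simp only [pow_zero, pow_one, one_mul, mul_one, mul_apply_two, t1, t2, t3, t4,
        Fin.zero_eta, Fin.mk_one, Fin.isValue, zero_mul, mul_zero, zero_add, add_zero, mul_neg,
        neg_mul, NegMemClass.coe_neg, abs_neg, neg_eq_zero, neg_neg] <;>
      exact habs _ (hVe _ _)
  rcases h with rfl | rfl
  · exact key a b
  · simpa only [neg_apply_two, NegMemClass.coe_neg, abs_neg, neg_eq_zero] using key a b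

/-! ### The action on real points -/

/-- The denominator `c x + d` of the linear fractional transformation `M` at `x`. -/
def den (M : SL(2, Zlam p)) (x : ℝ) : ℝ := (M 1 0 : ℝ) * x + (M 1 1 : ℝ)

/-- The linear fractional action on real numbers, with value `0` in place of `∞`. -/
noncomputable def act (M : SL(2, Zlam p)) (x : ℝ) : ℝ :=
  ((M 0 0 : ℝ) * x + (M 0 1 : ℝ)) / den M x

/-- A real number is ordinary if it is not a cusp, i.e. no element of the Hecke group maps it
to `∞`. -/
def Ordinary (p : ℕ) (x : ℝ) : Prop := ∀ M ∈ heckeGroup p, den M x ≠ 0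

lemma act_num (M : SL(2, Zlam p)) {x : ℝ} (h : den M x ≠ 0) :
    (M 0 0 : ℝ) * x + (M 0 1 : ℝ) = act M x * den M x := by
  rw [act, div_mul_cancel₀ _ h]

lemma den_mul (M N : SL(2, Zlam p)) {x : ℝ} (h : den N x ≠ 0) :
    den (M * N) x = den M (act N x) * den N x := by
  have e : den M (act N x) * den N x =
      (M 1 0 : ℝ) * (act N x * den N x) + (M 1 1 : ℝ) * den N x := by rw [den]; ring
  rw [e, ← act_num N h]
  simp only [den, mul_apply_two]
  push_cast
  ring

lemma act_mul (M N : SL(2, Zlam p)) {x : ℝ} (h : den N x ≠ 0) :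
    act (M * N) x = act M (act N x) := by
  have e : ((M * N) 0 0 : ℝ) * x + ((M * N) 0 1 : ℝ) =
      ((M 0 0 : ℝ) * act N x + (M 0 1 : ℝ)) * den N x := by
    have e : ((M 0 0 : ℝ) * act N x + (M 0 1 : ℝ)) * den N x =
        (M 0 0 : ℝ) * (act N x * den N x) + (M 0 1 : ℝ) * den N x := by ring
    rw [e, ← act_num N h]
    simp only [den, mul_apply_two]
    push_cast
    ring
  rw [act, e, den_mul M N h, mul_div_mul_right _ _ h]
  rfl

@[simp] lemma den_one (x : ℝ) : den (1 : SL(2, Zlam p)) x = 1 := by simp [den]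
@[simp] lemma act_one (x : ℝ) : act (1 : SL(2, Zlam p)) x = x := by simp [act]

lemma den_neg (M : SL(2, Zlam p)) (x : ℝ) : den (-M) x = -den M x := by
  simp only [den, neg_apply_two]; push_cast; ring

lemma act_neg (M : SL(2, Zlam p)) (x : ℝ) : act (-M) x = act M x := by
  rw [act, act, den_neg, ← neg_div_neg_eq ((M 0 0 : ℝ) * x + _)]
  simp only [neg_apply_two]; push_cast; ring

lemma SignEq.act {M N : SL(2, Zlam p)} (h : SignEq M N) (x : ℝ) :
    HeckeRPF.act M x = HeckeRPF.act N x := by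
  rcases h with rfl | rfl
  · rfl
  · exact act_neg _ _

lemma SignEq.mem {M N : SL(2, Zlam p)} (h : SignEq M N) (hN : N ∈ heckeGroup p) :
    M ∈ heckeGroup p := by
  rcases h with rfl | rfl
  · exact hN
  · exact neg_mem_hecke hN

lemma Ordinary.act {x : ℝ} (hx : Ordinary p x) {N : SL(2, Zlam p)} (hN : N ∈ heckeGroup p) :
    Ordinary p (act N x) := by
  intro M hM h
  have := den_mul M N (hx N hN)
  rw [h, zero_mul] at this
  exact hx _ (mul_mem hM hN) this

lemma Ordinary.act_inv_act {x : ℝ} (hx : Ordinary p x) {N : SL(2, Zlam p)}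
    (hN : N ∈ heckeGroup p) : HeckeRPF.act N⁻¹ (HeckeRPF.act N x) = x := by
  rw [← act_mul _ _ (hx N hN), inv_mul_cancel, act_one]

lemma Ordinary.act_act_inv {x : ℝ} (hx : Ordinary p x) {N : SL(2, Zlam p)}
    (hN : N ∈ heckeGroup p) : HeckeRPF.act N (HeckeRPF.act N⁻¹ x) = x := by
  rw [← act_mul _ _ (hx _ (inv_mem hN)), mul_inv_cancel, act_one]

lemma Ordinary.ne_zero {x : ℝ} (hx : Ordinary p x) : x ≠ 0 := by
  have := hx _ T_mem
  obtain ⟨_, t3, t4⟩ := T_apply (p := p)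
  simpa [den, t3, t4] using this

lemma act_T (x : ℝ) : act (T p) x = -1 / x := by
  obtain ⟨⟨t1, t2⟩, t3, t4⟩ := T_apply (p := p)
  simp [act, den, t1, t2, t3, t4]

lemma act_T_act_T {x : ℝ} (hx : Ordinary p x) : act (T p) (act (T p) x) = x := by
  rw [← act_mul _ _ (hx _ T_mem), T_mul_T, act_neg, act_one]

lemma act_T_neg {x : ℝ} (hx : 0 < x) : act (T p) x < 0 := by
  rw [act_T]; exact div_neg_of_neg_of_pos (by norm_num) hx

lemma act_T_pos {x : ℝ} (hx : x < 0) : 0 < act (T p) x := by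
  rw [act_T]; exact div_pos_of_neg_of_neg (by norm_num) hx

lemma fixes_iff {M : SL(2, Zlam p)} {x : ℝ} (h : den M x ≠ 0) : Fixes M x ↔ act M x = x := by
  rw [Fixes, act, div_eq_iff h]; rfl

lemma trace_conj (M N : SL(2, Zlam p)) :
    ((N * M * N⁻¹) 0 0 : ℝ) + ((N * M * N⁻¹) 1 1 : ℝ) = (M 0 0 : ℝ) + (M 1 1 : ℝ) := by
  obtain ⟨⟨i1, i2⟩, i3, i4⟩ := inv_apply_two N
  have := det_eq_real N
  simp only [mul_apply_two, i1, i2, i3, i4]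
  push_cast
  linear_combination ((M 0 0 : ℝ) + (M 1 1 : ℝ)) * this

/-- A triangular element of the Hecke group has diagonal entries `±1`, so it is not hyperbolic. -/
lemma abs_trace_le_of_lower_zero (hp : 3 ≤ p) {K : SL(2, Zlam p)} (hK : K ∈ heckeGroup p)
    (h : (K 1 0 : ℝ) = 0) : |(K 0 0 : ℝ) + (K 1 1 : ℝ)| ≤ 2 := by
  have hdet := det_eq_real K
  rw [h, mul_zero, sub_zero] at hdet
  have h0 := entries_of_mem hp hK 0 0
  have h1 := entries_of_mem hp hK 1 1
  have h0' : (K 0 0 : ℝ) ≠ 0 := by rintro h; simp [h] at hdet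
  have h1' : (K 1 1 : ℝ) ≠ 0 := by rintro h; simp [h] at hdet
  have a0 := h0.resolve_left h0'
  have a1 := h1.resolve_left h1'
  have hm : |(K 0 0 : ℝ)| * |(K 1 1 : ℝ)| = 1 := by rw [← abs_mul, hdet, abs_one]
  refine (abs_add_le _ _).trans ?_
  nlinarith

/-- Hyperbolic fixed points are not cusps. -/
lemma IsHyperbolicPoint.ordinary (hp : 3 ≤ p) {x : ℝ} (hx : IsHyperbolicPoint p x) :
    Ordinary p x := by
  obtain ⟨M, hM, htr, hfix⟩ := hx
  intro N hN hden
  have hK : N * M * N⁻¹ ∈ heckeGroup p := mul_mem (mul_mem hN hM) (inv_mem hN)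
  have h10 : ((N * M * N⁻¹) 1 0 : ℝ) = 0 := by
    obtain ⟨⟨i1, -⟩, i3, -⟩ := inv_apply_two N
    simp only [mul_apply_two, i1, i3]
    push_cast
    rw [Fixes] at hfix
    have hd : (N 1 1 : ℝ) = -(N 1 0 : ℝ) * x := by rw [den] at hden; linarith
    rw [hd]
    linear_combination (-(N 1 0 : ℝ) ^ 2) * hfix
  have := abs_trace_le_of_lower_zero hp hK h10
  rw [trace_conj] at this
  linarith

lemma fixes_conj {x : ℝ} (hx : Ordinary p x) {M N : SL(2, Zlam p)}
    (hM : M ∈ heckeGroup p) (hN : N ∈ heckeGroup p) (h : Fixes M x) :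
    Fixes (N * M * N⁻¹) (act N x) := by
  have hK : N * M * N⁻¹ ∈ heckeGroup p := mul_mem (mul_mem hN hM) (inv_mem hN)
  rw [fixes_iff (hx.act hN _ hK), ← act_mul _ _ (hx N hN), inv_mul_cancel_right,
    act_mul _ _ (hx M hM), (fixes_iff (hx M hM)).1 h]

lemma IsHyperbolicPoint.act (hp : 3 ≤ p) {x : ℝ} (hx : IsHyperbolicPoint p x)
    {N : SL(2, Zlam p)} (hN : N ∈ heckeGroup p) : IsHyperbolicPoint p (act N x) := by
  have ho := hx.ordinary hp
  obtain ⟨M, hM, htr, hfix⟩ := hx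
  refine ⟨N * M * N⁻¹, mul_mem (mul_mem hN hM) (inv_mem hN), ?_, fixes_conj ho hM hN hfix⟩
  rwa [trace_conj]

/-! ### The continued fraction map -/

lemma den_U_pow_succ (n : ℕ) (x : ℝ) :
    den (U p ^ (n + 1)) x = (chebS p (n + 1) : ℝ) * x - (chebS p n : ℝ) := by
  obtain ⟨_, h3, h4⟩ := U_pow_apply (p := p) (n + 1)
  rw [den, h3, h4, chebS_add_two]
  push_cast
  ring

/-- The denominators of the powers of `U` at `x` are at once the successive numerators, so the signs of
the points `Uⁿ x` are read off from the sign changes of a single sequence. -/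
lemma act_U_pow (n : ℕ) (x : ℝ) :
    act (U p ^ n) x = den (U p ^ (n + 1)) x / den (U p ^ n) x := by
  obtain ⟨⟨h1, h2⟩, _⟩ := U_pow_apply (p := p) n
  rw [act, den_U_pow_succ, h1, h2]
  push_cast
  ring

lemma den_U_pow_identity (n : ℕ) (x : ℝ) :
    (chebS p n : ℝ) * den (U p ^ (n + 1)) x = (chebS p (n + 1) : ℝ) * den (U p ^ n) x - 1 := by
  obtain ⟨_, h3, h4⟩ := U_pow_apply (p := p) n
  have h := congrArg (Subtype.val) (chebS_identity (p := p) n)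
  rw [chebS_add_two] at h
  rw [den_U_pow_succ, den, h3, h4]
  push_cast at h ⊢
  linear_combination -h

lemma SignEq.U_pow_mod (hp : 3 ≤ p) (n : ℕ) : SignEq (U p ^ n) (U p ^ (n % p)) := by
  have hk : ∀ k : ℕ, SignEq ((U p ^ p) ^ k) 1 := by
    intro k
    induction k with
    | zero => simp [SignEq]
    | succ k ih => simpa [pow_succ] using ih.mul (SignEq.U_pow_p hp)
  conv_lhs => rw [← Nat.mod_add_div n p, pow_add, pow_mul]
  simpa using (SignEq.refl (U p ^ (n % p))).mul (hk (n / p))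

/-- The denominators of `U⁰ = I` and `Uᵖ = -I` have opposite signs; the negative point occurs where the
sign changes. -/
lemma exists_act_U_neg (hp : 3 ≤ p) {x : ℝ} (hx : Ordinary p x) :
    ∃ j < p, act (U p ^ j) x < 0 := by
  classical
  have hP : ∃ n, den (U p ^ n) x < 0 := ⟨p, by rw [U_pow_p hp, den_neg, den_one]; norm_num⟩
  have hle : Nat.find hP ≤ p := Nat.find_min' hP (by rw [U_pow_p hp, den_neg, den_one]; norm_num)
  have h0 : Nat.find hP ≠ 0 := by
    intro h
    have := Nat.find_spec hP
    rw [h, pow_zero, den_one] at this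
    linarith
  obtain ⟨j, hj⟩ := Nat.exists_eq_succ_of_ne_zero h0
  refine ⟨j, by omega, ?_⟩
  have h1 : ¬ den (U p ^ j) x < 0 := Nat.find_min hP (by omega)
  have h2 := Nat.find_spec hP
  rw [hj] at h2
  rw [act_U_pow]
  exact div_neg_of_neg_of_pos h2 (lt_of_le_of_ne (not_lt.1 h1) (hx _ (U_pow_mem j)).symm)

/-- The denominators change sign only once. -/
lemma den_U_neg_succ (hp : 3 ≤ p) {x : ℝ} {j : ℕ} (hj : j < p) (h : den (U p ^ j) x < 0) :
    den (U p ^ (j + 1)) x < 0 := by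
  have h0 : 1 ≤ j := by
    by_contra h0
    rw [show j = 0 by omega, pow_zero, den_one] at h
    linarith
  have h1 := one_le_chebS hp h0 hj
  have h2 := chebS_nonneg hp (n := j + 1) hj
  have := den_U_pow_identity (p := p) j x
  nlinarith

/-- The `U`-orbit of an ordinary point contains exactly one negative point. -/
lemma act_U_neg_unique (hp : 3 ≤ p) {x : ℝ} {i j : ℕ} (hi : i < p) (hj : j < p)
    (hi' : act (U p ^ i) x < 0) (hj' : act (U p ^ j) x < 0) : i = j := by
  have pos : ∀ i < p, act (U p ^ i) x < 0 → 0 < den (U p ^ i) x ∧ den (U p ^ (i + 1)) x < 0 := by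
    intro i hi h
    rw [act_U_pow] at h
    rcases div_neg_iff.1 h with ⟨h1, h2⟩ | ⟨h1, h2⟩
    · exact absurd (den_U_neg_succ hp hi h2) (not_lt.2 h1.le)
    · exact ⟨h2, h1⟩
  have lt_false : ∀ i j, i < p → j < p → act (U p ^ i) x < 0 → act (U p ^ j) x < 0 →
      ¬ i < j := by
    intro i j hi hj hi' hj' hij
    have key : ∀ n, i + 1 ≤ n → n ≤ p → den (U p ^ n) x < 0 := by
      intro n hn
      induction n, hn using Nat.le_induction with
      | base => intro _; exact (pos i hi hi').2
      | succ n hn ih => intro h; exact den_U_neg_succ hp (by omega) (ih (by omega))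
    exact absurd (pos j hj hj').1 (not_lt.2 (key j hij hj.le).le)
  have h1 := lt_false i j hi hj hi' hj'
  have h2 := lt_false j i hj hi hj' hi'
  omega

open Classical in
/-- The exponent `j < p` for which `Uʲ x` is negative. -/
noncomputable def turn (p : ℕ) (x : ℝ) : ℕ :=
  if h : ∃ j < p, act (U p ^ j) x < 0 then h.choose else 0

lemma turn_lt (hp : 3 ≤ p) {x : ℝ} (hx : Ordinary p x) : turn p x < p := by
  rw [turn, dif_pos (exists_act_U_neg hp hx)]
  exact (exists_act_U_neg hp hx).choose_spec.1

lemma act_turn_neg (hp : 3 ≤ p) {x : ℝ} (hx : Ordinary p x) :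
    act (U p ^ turn p x) x < 0 := by
  rw [turn, dif_pos (exists_act_U_neg hp hx)]
  exact (exists_act_U_neg hp hx).choose_spec.2

lemma turn_eq_mod (hp : 3 ≤ p) {x : ℝ} (hx : Ordinary p x) {n : ℕ}
    (h : act (U p ^ n) x < 0) : n % p = turn p x := by
  refine act_U_neg_unique hp (Nat.mod_lt _ (by omega)) (turn_lt hp hx) ?_ (act_turn_neg hp hx)
  rwa [← (SignEq.U_pow_mod hp n).act]

lemma turn_of_neg (hp : 3 ≤ p) {x : ℝ} (hx : Ordinary p x) (h : x < 0) : turn p x = 0 := by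
  have : act (U p ^ 0) x < 0 := by simpa using h
  simpa using (turn_eq_mod hp hx this).symm

lemma turn_pos (hp : 3 ≤ p) {x : ℝ} (hx : Ordinary p x) (h : 0 < x) : 1 ≤ turn p x := by
  by_contra h0
  have := act_turn_neg hp hx
  rw [show turn p x = 0 by omega, pow_zero, act_one] at this
  linarith

/-- The matrix `T Uʲ`, with `Uʲ x` negative, which performs one step of the continued fraction
algorithm at `x`. -/
noncomputable def cfStep (p : ℕ) (x : ℝ) : SL(2, Zlam p) := T p * U p ^ turn p x

/-- One step of the continued fraction algorithm: it maps ordinary points to positive ones. -/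
noncomputable def cfMap (p : ℕ) (x : ℝ) : ℝ := act (cfStep p x) x

/-- The product of the matrices of the first `n` steps of the continued fraction algorithm
at `x`. -/
noncomputable def cfWord (p : ℕ) : ℕ → ℝ → SL(2, Zlam p)
  | 0, _ => 1
  | n + 1, x => cfWord p n (cfMap p x) * cfStep p x

lemma cfStep_mem (x : ℝ) : cfStep p x ∈ heckeGroup p := mul_mem T_mem (U_pow_mem _)

lemma cfWord_mem (n : ℕ) (x : ℝ) : cfWord p n x ∈ heckeGroup p := by
  induction n generalizing x with
  | zero => exact one_mem _
  | succ n ih => exact mul_mem (ih _) (cfStep_mem x)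

lemma Ordinary.cfMap {x : ℝ} (hx : Ordinary p x) : Ordinary p (cfMap p x) :=
  hx.act (cfStep_mem x)

lemma Ordinary.iterate {x : ℝ} (hx : Ordinary p x) (n : ℕ) :
    Ordinary p ((HeckeRPF.cfMap p)^[n] x) := by
  induction n generalizing x with
  | zero => exact hx
  | succ n ih => exact ih hx.cfMap

lemma act_cfWord {x : ℝ} (hx : Ordinary p x) (n : ℕ) :
    act (cfWord p n x) x = (cfMap p)^[n] x := by
  induction n generalizing x with
  | zero => simp [cfWord]
  | succ n ih =>
    rw [cfWord, act_mul _ _ (hx _ (cfStep_mem x)), Function.iterate_succ_apply]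
    exact ih hx.cfMap

lemma cfWord_add (m n : ℕ) (x : ℝ) :
    cfWord p (m + n) x = cfWord p m ((cfMap p)^[n] x) * cfWord p n x := by
  induction n generalizing x with
  | zero => simp [cfWord]
  | succ n ih =>
    rw [← add_assoc, cfWord, ih, Function.iterate_succ_apply, cfWord, mul_assoc]

lemma cfWord_mul_period {z : ℝ} {r : ℕ} (hr : (cfMap p)^[r] z = z) (n t : ℕ) :
    cfWord p (n + r * t) z = cfWord p n z * cfWord p r z ^ t := by
  induction t with
  | zero => simp
  | succ t ih => rw [mul_add, mul_one, ← add_assoc, cfWord_add, hr, ih, pow_succ, mul_assoc]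

lemma cfMap_eq {x : ℝ} (hx : Ordinary p x) :
    cfMap p x = act (T p) (act (U p ^ turn p x) x) :=
  act_mul _ _ (hx _ (U_pow_mem _))

lemma cfMap_pos (hp : 3 ≤ p) {x : ℝ} (hx : Ordinary p x) : 0 < cfMap p x := by
  rw [cfMap_eq hx]
  exact act_T_pos (act_turn_neg hp hx)

/-- Equivalent points have the same tails of continued fractions, and the equivalence is read off
from the expansions. The assertion is compatible with products and inverses, so only the generators
`T` and `U` have to be considered, for which one step of the algorithm is enough. -/
lemma exists_cfWord_eq (hp : 3 ≤ p) {V : SL(2, Zlam p)} (hV : V ∈ heckeGroup p) {x : ℝ}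
    (hx : Ordinary p x) :
    ∃ m n, SignEq (cfWord p m x) (cfWord p n (act V x) * V) := by
  have comp : ∀ {V V' : SL(2, Zlam p)} {x : ℝ}, V ∈ heckeGroup p → V' ∈ heckeGroup p →
      Ordinary p x → (∃ m n, SignEq (cfWord p m x) (cfWord p n (act V x) * V)) →
      (∃ m n, SignEq (cfWord p m (act V x)) (cfWord p n (act V' (act V x)) * V')) →
      ∃ m n, SignEq (cfWord p m x) (cfWord p n (act (V' * V) x) * (V' * V)) := by
    rintro V V' x hV hV' hx ⟨m, n, h⟩ ⟨m', n', h'⟩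
    rw [act_mul _ _ (hx V hV)]
    set y := act V x with hy
    have hyo : Ordinary p y := hx.act hV
    have e1 : (cfMap p)^[m] x = (cfMap p)^[n] y := by
      rw [← act_cfWord hx, h.act, act_mul _ _ (hx V hV), act_cfWord hyo]
    have e2 : (cfMap p)^[m'] y = (cfMap p)^[n'] (act V' y) := by
      rw [← act_cfWord hyo, h'.act, act_mul _ _ (hyo V' hV'), act_cfWord (hyo.act hV')]
    rcases le_total n m' with hle | hle
    · obtain ⟨a, rfl⟩ := Nat.exists_eq_add_of_le' hle
      refine ⟨a + m, n', ?_⟩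
      rw [cfWord_add, e1]
      refine ((SignEq.refl _).mul h).trans ?_
      rw [← mul_assoc, ← cfWord_add, ← mul_assoc]
      exact h'.mul (SignEq.refl V)
    · obtain ⟨a, rfl⟩ := Nat.exists_eq_add_of_le' hle
      refine ⟨m, a + n', h.trans ?_⟩
      rw [cfWord_add, e2, cfWord_add, mul_assoc, mul_assoc]
      refine (SignEq.refl _).mul ?_
      rw [← mul_assoc]
      exact h'.mul (SignEq.refl V)
  have inv : ∀ {V : SL(2, Zlam p)} {x : ℝ},
      (∃ m n, SignEq (cfWord p m x) (cfWord p n (act V x) * V)) →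
      ∃ m n, SignEq (cfWord p m (act V x)) (cfWord p n x * V⁻¹) := by
    rintro V x ⟨m, n, h⟩
    refine ⟨n, m, ?_⟩
    have := h.symm.mul (SignEq.refl V⁻¹)
    simpa using this
  have hT : ∀ x, Ordinary p x →
      ∃ m n, SignEq (cfWord p m x) (cfWord p n (act (T p) x) * T p) := by
    intro x hx
    rcases lt_or_gt_of_ne hx.ne_zero with h | h
    · exact ⟨1, 0, by simp [cfWord, cfStep, turn_of_neg hp hx h, SignEq]⟩
    · refine ⟨0, 1, ?_⟩
      simpa [cfWord, cfStep, turn_of_neg hp (hx.act T_mem) (act_T_neg h)]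
        using SignEq.T_mul_T.symm
  have hU : ∀ x, Ordinary p x →
      ∃ m n, SignEq (cfWord p m x) (cfWord p n (act (U p) x) * U p) := by
    intro x hx
    refine ⟨1, 1, ?_⟩
    have h := act_turn_neg hp (hx.act U_mem)
    rw [← act_mul _ _ (hx _ U_mem), ← pow_succ] at h
    have h2 := turn_eq_mod hp hx h
    have h3 := SignEq.U_pow_mod hp (turn p (act (U p) x) + 1)
    rw [h2] at h3
    simp only [cfWord, one_mul, cfStep, mul_assoc, ← pow_succ]
    exact (SignEq.refl _).mul h3.symm
  have hS : ∀ x, Ordinary p x →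
      ∃ m n, SignEq (cfWord p m x) (cfWord p n (act (S p) x) * S p) := by
    intro x hx
    -- `S = ± U T`
    have hUT : U p * T p = -S p := by rw [U, mul_assoc, T_mul_T, mul_neg, mul_one]
    obtain ⟨m, n, h⟩ := comp T_mem U_mem hx (hT x hx) (hU _ (hx.act T_mem))
    rw [hUT, act_neg] at h
    exact ⟨m, n, h.trans ((SignEq.refl _).mul (SignEq.neg_left _))⟩
  induction hV using Subgroup.closure_induction generalizing x with
  | mem V h =>
    rcases h with rfl | rfl
    · exact hS x hx
    · exact hT x hx
  | one => exact ⟨0, 0, by simp [cfWord, SignEq]⟩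
  | mul V' V hV' hV ihV' ihV => exact comp hV hV' hx (ihV hx) (ihV' (hx.act hV))
  | inv V hV ih =>
    have h := inv (ih (hx.act (inv_mem hV)))
    rwa [hx.act_act_inv hV] at h

lemma iterate_eq_of_signEq {V : SL(2, Zlam p)} (hV : V ∈ heckeGroup p) {x : ℝ}
    (hx : Ordinary p x) {m n : ℕ} (h : SignEq (cfWord p m x) (cfWord p n (act V x) * V)) :
    (cfMap p)^[m] x = (cfMap p)^[n] (act V x) := by
  rw [← act_cfWord hx, h.act, act_mul _ _ (hx V hV), act_cfWord (hx.act hV)]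

/-! ### Stabilizers of hyperbolic points -/

lemma not_signEq_one_of_trace {M : SL(2, Zlam p)} (h : 2 < |(M 0 0 : ℝ) + (M 1 1 : ℝ)|) :
    ¬ SignEq M 1 := by
  rintro (rfl | rfl)
  · norm_num at h
  · norm_num [neg_apply_two] at h

/-- The continued fraction of a hyperbolic point is eventually periodic. -/
lemma IsHyperbolicPoint.exists_periodic (hp : 3 ≤ p) {x : ℝ} (hx : IsHyperbolicPoint p x) :
    ∃ n r, 0 < r ∧ (cfMap p)^[r] ((cfMap p)^[n] x) = (cfMap p)^[n] x := by
  have ho := hx.ordinary hp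
  obtain ⟨M, hM, htr, hfix⟩ := hx
  obtain ⟨m, n, h⟩ := exists_cfWord_eq hp hM ho
  have e := iterate_eq_of_signEq hM ho h
  have hfix' := (fixes_iff (ho M hM)).1 hfix
  rw [hfix'] at h e
  have hmn : m ≠ n := by
    rintro rfl
    apply not_signEq_one_of_trace htr
    apply SignEq.mul_left_cancel (K := cfWord p m x)
    rw [mul_one]
    exact h.symm
  rcases lt_or_gt_of_ne hmn with hlt | hlt
  · refine ⟨m, n - m, by omega, ?_⟩
    rw [← Function.iterate_add_apply, Nat.sub_add_cancel hlt.le, e]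
  · refine ⟨n, m - n, by omega, ?_⟩
    rw [← Function.iterate_add_apply, Nat.sub_add_cancel hlt.le, e]

lemma IsStabilizerGenerator.conj {x : ℝ} (hx : Ordinary p x) {M N : SL(2, Zlam p)}
    (hM : IsStabilizerGenerator p x M) (hN : N ∈ heckeGroup p) :
    IsStabilizerGenerator p (act N x) (N * M * N⁻¹) := by
  obtain ⟨h1, h2, h3⟩ := hM
  refine ⟨mul_mem (mul_mem hN h1) (inv_mem hN), fixes_conj hx h1 hN h2, ?_⟩
  intro K hK hfix
  have h4 := fixes_conj (hx.act hN) hK (inv_mem hN) hfix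
  rw [hx.act_inv_act hN, inv_inv] at h4
  obtain ⟨n, hn⟩ := h3 _ (mul_mem (mul_mem (inv_mem hN) hK) hN) h4
  refine ⟨n, ?_⟩
  have h5 : SignEq (N⁻¹ * K * N) (M ^ n) := hn
  rw [conj_zpow]
  have h6 := ((SignEq.refl N).mul h5).mul (SignEq.refl N⁻¹)
  simpa [mul_assoc, SignEq] using h6

/-- At a purely periodic point, the word of the minimal period generates the stabilizer. -/
lemma isStabilizerGenerator_cfWord (hp : 3 ≤ p) {z : ℝ} (hz : Ordinary p z)
    (hzp : z ∈ Function.periodicPts (cfMap p)) :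
    IsStabilizerGenerator p z (cfWord p (Function.minimalPeriod (cfMap p) z) z) := by
  set r := Function.minimalPeriod (cfMap p) z with hr
  have hper : (cfMap p)^[r] z = z := Function.isPeriodicPt_minimalPeriod _ _
  refine ⟨cfWord_mem _ _, ?_, ?_⟩
  · rw [fixes_iff (hz _ (cfWord_mem _ _)), act_cfWord hz, hper]
  intro N hN hfix
  obtain ⟨m, n, h⟩ := exists_cfWord_eq hp hN hz
  have e := iterate_eq_of_signEq hN hz h
  rw [(fixes_iff (hz N hN)).1 hfix] at h e
  have key : ∀ m n : ℕ, n ≤ m → (cfMap p)^[m] z = (cfMap p)^[n] z → ∃ t, m = n + r * t := by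
    intro m n hle e
    have hmod : m ≡ n [MOD r] := by
      have hr0 : 0 < r := Function.minimalPeriod_pos_of_mem_periodicPts hzp
      rw [← Function.iterate_mod_minimalPeriod_eq (n := m),
        ← Function.iterate_mod_minimalPeriod_eq (n := n)] at e
      exact (Function.iterate_eq_iterate_iff_of_lt_minimalPeriod (Nat.mod_lt _ hr0)
        (Nat.mod_lt _ hr0)).1 e
    obtain ⟨t, ht⟩ := (Nat.modEq_iff_dvd' hle).1 hmod.symm
    exact ⟨t, by omega⟩
  rcases le_total n m with hle | hle
  · obtain ⟨t, rfl⟩ := key m n hle e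
    rw [cfWord_mul_period hper] at h
    exact ⟨t, by simpa [SignEq] using h.mul_left_cancel.symm⟩
  · obtain ⟨t, rfl⟩ := key n m hle e.symm
    rw [cfWord_mul_period hper, mul_assoc] at h
    refine ⟨-t, ?_⟩
    have h' : SignEq (1 : SL(2, Zlam p)) (cfWord p r z ^ t * N) :=
      SignEq.mul_left_cancel (K := cfWord p m z) (by simpa using h)
    have := (SignEq.refl ((cfWord p r z ^ t)⁻¹)).mul h'
    rw [mul_one, inv_mul_cancel_left] at this
    simpa [SignEq] using this.symm

lemma IsHyperbolicPoint.exists_stabilizerGenerator (hp : 3 ≤ p) {x : ℝ}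
    (hx : IsHyperbolicPoint p x) : ∃ M, IsStabilizerGenerator p x M := by
  have ho := hx.ordinary hp
  obtain ⟨n, r, hr, hper⟩ := hx.exists_periodic hp
  rw [← act_cfWord ho] at hper
  have h := isStabilizerGenerator_cfWord hp (ho.act (cfWord_mem n x)) ⟨r, hr, hper⟩
  have h' := h.conj (ho.act (cfWord_mem n x)) (inv_mem (cfWord_mem n x))
  rw [ho.act_inv_act (cfWord_mem n x)] at h'
  exact ⟨_, h'⟩

/-! ### Forms and their roots -/

lemma coe_two : ((2 : Zlam p) : ℝ) = 2 := rfl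

namespace Form

/-- The value `Q(x, 1)`. -/
def val (Q : Form p) (x : ℝ) : ℝ := (Q.A : ℝ) * x ^ 2 + (Q.B : ℝ) * x + (Q.C : ℝ)

/-- The derivative of `Q(x, 1)`. Among the two roots of `Q`, its sign singles out `Q.root`. -/
def slope (Q : Form p) (x : ℝ) : ℝ := 2 * (Q.A : ℝ) * x + (Q.B : ℝ)

@[simp] lemma neg_A (Q : Form p) : (-Q).A = -Q.A := rfl
@[simp] lemma neg_B (Q : Form p) : (-Q).B = -Q.B := rfl
@[simp] lemma neg_C (Q : Form p) : (-Q).C = -Q.C := rfl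

lemma neg_neg' (Q : Form p) : -(-Q) = Q := by ext1 <;> simp

lemma disc_neg (Q : Form p) : (-Q).disc = Q.disc := by simp [disc]

lemma coe_disc (Q : Form p) :
    (Q.disc : ℝ) = (Q.B : ℝ) ^ 2 - 4 * (Q.A : ℝ) * (Q.C : ℝ) := by
  simp only [disc]; push_cast; rfl

lemma eq_root_iff {Q : Form p} (hA : (Q.A : ℝ) ≠ 0) (x : ℝ) :
    x = Q.root ↔ Q.slope x = √(Q.disc : ℝ) := by
  rw [root, eq_div_iff (by simpa using hA), slope]
  constructor <;> intro h <;> linarith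

lemma eq_conjRoot_iff {Q : Form p} (hA : (Q.A : ℝ) ≠ 0) (x : ℝ) :
    x = Q.conjRoot ↔ Q.slope x = -√(Q.disc : ℝ) := by
  rw [conjRoot, eq_div_iff (by simpa using hA), slope]
  constructor <;> intro h <;> linarith

lemma slope_sq (Q : Form p) (x : ℝ) :
    Q.slope x ^ 2 = (Q.disc : ℝ) + 4 * (Q.A : ℝ) * Q.val x := by
  rw [coe_disc, slope, val]; ring

lemma val_eq_zero_iff {Q : Form p} (hA : (Q.A : ℝ) ≠ 0) (x : ℝ) :
    Q.val x = 0 ↔ Q.slope x ^ 2 = (Q.disc : ℝ) := by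
  rw [slope_sq]; simp [hA]

lemma comp_mul (Q : Form p) (M N : SL(2, Zlam p)) : Q.comp (M * N) = (Q.comp M).comp N := by
  ext1 <;> simp only [comp, mul_apply_two] <;> ring

lemma comp_one (Q : Form p) : Q.comp 1 = Q := by
  ext1 <;> simp [comp]

lemma neg_comp (Q : Form p) (M : SL(2, Zlam p)) : (-Q).comp M = -(Q.comp M) := by
  ext1 <;> simp only [comp, neg_A, neg_B, neg_C] <;> ring

lemma disc_comp (Q : Form p) (M : SL(2, Zlam p)) : (Q.comp M).disc = Q.disc := by
  have h := det_eq M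
  have e : (Q.comp M).disc = Q.disc * (M 0 0 * M 1 1 - M 0 1 * M 1 0) ^ 2 := by
    simp only [disc, comp]; ring
  rw [e, h, one_pow, mul_one]

/-- At a root, the derivative is invariant under the action: this is why `Q ↦ Q.root` is
equivariant, with no exchange of the two roots. -/
lemma slope_comp (Q : Form p) (M : SL(2, Zlam p)) {x : ℝ} (h : den M x ≠ 0)
    (h0 : Q.val (act M x) = 0) : (Q.comp M).slope x = Q.slope (act M x) := by
  have hdet := det_eq_real M
  have hn := act_num M h
  set y := act M x
  -- the inverse of the denominator at `x`
  have hinv : den M x * ((M 0 0 : ℝ) - (M 1 0 : ℝ) * y) = 1 := by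
    have : den M x * ((M 0 0 : ℝ) - (M 1 0 : ℝ) * y) =
        den M x * (M 0 0 : ℝ) - (M 1 0 : ℝ) * (y * den M x) := by ring
    rw [this, ← hn, den]
    linear_combination hdet
  have e1 : (Q.comp M).slope x = 2 * (Q.A : ℝ) * (M 0 0 : ℝ) * ((M 0 0 : ℝ) * x + (M 0 1 : ℝ)) +
      (Q.B : ℝ) * ((M 0 0 : ℝ) * den M x + (M 1 0 : ℝ) * ((M 0 0 : ℝ) * x + (M 0 1 : ℝ))) +
      2 * (Q.C : ℝ) * (M 1 0 : ℝ) * den M x := by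
    rw [slope, den]; simp only [comp]; push_cast [coe_two]; ring
  rw [e1, hn, slope]
  rw [val] at h0
  linear_combination (2 * (M 1 0 : ℝ) * den M x) * h0 + (2 * (Q.A : ℝ) * y + (Q.B : ℝ)) * hinv

lemma content_neg (Q : Form p) : (-Q).content = Q.content := by
  have key : ∀ Q : Form p, (-Q).content ≤ Q.content := by
    intro Q
    rw [content, Ideal.span_le]
    rintro x (rfl | rfl | rfl) <;> simp only [neg_A, neg_B, neg_C, SetLike.mem_coe, neg_mem_iff] <;>
      exact Ideal.subset_span (by simp)
  refine le_antisymm (key Q) ?_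
  simpa only [neg_neg'] using key (-Q)

lemma content_comp (Q : Form p) (M : SL(2, Zlam p)) : (Q.comp M).content = Q.content := by
  have key : ∀ (Q : Form p) (M : SL(2, Zlam p)), (Q.comp M).content ≤ Q.content := by
    intro Q M
    have hA : Q.A ∈ Q.content := Ideal.subset_span (by simp)
    have hB : Q.B ∈ Q.content := Ideal.subset_span (by simp)
    have hC : Q.C ∈ Q.content := Ideal.subset_span (by simp)
    rw [content, Ideal.span_le]
    rintro x (rfl | rfl | rfl)
    · exact add_mem (add_mem (Ideal.mul_mem_right _ _ hA) (Ideal.mul_mem_right _ _ hB))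
        (Ideal.mul_mem_right _ _ hC)
    · exact add_mem (add_mem (Ideal.mul_mem_right _ _ (Ideal.mul_mem_left _ _ hA))
        (Ideal.mul_mem_right _ _ hB)) (Ideal.mul_mem_right _ _ (Ideal.mul_mem_left _ _ hC))
    · exact add_mem (add_mem (Ideal.mul_mem_right _ _ hA) (Ideal.mul_mem_right _ _ hB))
        (Ideal.mul_mem_right _ _ hC)
  refine le_antisymm (key Q M) ?_
  have := key (Q.comp M) M⁻¹
  rwa [← comp_mul, mul_inv_cancel, comp_one] at this

end Form

lemma val_fixedForm (M : SL(2, Zlam p)) (x : ℝ) : (fixedForm M).val x = 0 ↔ Fixes M x := by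
  rw [Fixes, Form.val]
  simp only [fixedForm]
  push_cast
  constructor <;> intro h <;> linear_combination -h

lemma fixedForm_neg (M : SL(2, Zlam p)) : fixedForm (-M) = -fixedForm M := by
  ext1 <;> simp only [fixedForm, neg_apply_two, Form.neg_A, Form.neg_B, Form.neg_C]
  ring

lemma fixedForm_inv (M : SL(2, Zlam p)) : fixedForm M⁻¹ = -fixedForm M := by
  obtain ⟨⟨i1, i2⟩, i3, i4⟩ := inv_apply_two M
  ext1 <;> simp only [fixedForm, i1, i2, i3, i4, Form.neg_A, Form.neg_B, Form.neg_C]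
  ring

lemma fixedForm_conj (M N : SL(2, Zlam p)) :
    fixedForm (N⁻¹ * M * N) = (fixedForm M).comp N := by
  obtain ⟨⟨i1, i2⟩, i3, i4⟩ := inv_apply_two N
  ext1 <;> simp only [fixedForm, Form.comp, mul_apply_two, i1, i2, i3, i4] <;> ring

lemma disc_fixedForm (M : SL(2, Zlam p)) :
    ((fixedForm M).disc : ℝ) = ((M 0 0 : ℝ) + (M 1 1 : ℝ)) ^ 2 - 4 := by
  rw [Form.coe_disc]
  simp only [fixedForm]
  push_cast
  linear_combination (-4) * det_eq_real M

/-- The form `Q` is `t` times the form `F`. -/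
def IsMultiple (t : Zlam p) (F Q : Form p) : Prop := Q.A = t * F.A ∧ Q.B = t * F.B ∧ Q.C = t * F.C

lemma IsMultiple.disc {t : Zlam p} {F Q : Form p} (h : IsMultiple t F Q) :
    Q.disc = t ^ 2 * F.disc := by
  simp only [Form.disc, h.1, h.2.1, h.2.2]; ring

lemma IsMultiple.val {t : Zlam p} {F Q : Form p} (h : IsMultiple t F Q) (x : ℝ) :
    Q.val x = (t : ℝ) * F.val x := by
  simp only [Form.val, h.1, h.2.1, h.2.2]; push_cast; ring

lemma IsMultiple.slope {t : Zlam p} {F Q : Form p} (h : IsMultiple t F Q) (x : ℝ) :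
    Q.slope x = (t : ℝ) * F.slope x := by
  simp only [Form.slope, h.1, h.2.1]; push_cast; ring

lemma IsMultiple.neg {t : Zlam p} {F Q : Form p} (h : IsMultiple t F Q) :
    IsMultiple (-t) F (-Q) := by
  simp [IsMultiple, h.1, h.2.1, h.2.2]

/-- By the Cayley-Hamilton theorem, a power of `M` is a combination of `I` and `M`. -/
lemma exists_isMultiple_pow (M : SL(2, Zlam p)) (n : ℕ) :
    ∃ t, IsMultiple t (fixedForm M) (fixedForm (M ^ n)) := by
  have key : ∀ n : ℕ, ∃ x y : Zlam p, ((M ^ n) 0 0 = x + y * M 0 0 ∧ (M ^ n) 0 1 = y * M 0 1) ∧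
      ((M ^ n) 1 0 = y * M 1 0 ∧ (M ^ n) 1 1 = x + y * M 1 1) := by
    intro n
    induction n with
    | zero => exact ⟨1, 0, by simp⟩
    | succ n ih =>
      obtain ⟨x, y, ⟨h1, h2⟩, h3, h4⟩ := ih
      have hdet := det_eq M
      refine ⟨-y, x + y * (M 0 0 + M 1 1), ⟨?_, ?_⟩, ?_, ?_⟩ <;>
        rw [pow_succ, mul_apply_two] <;> simp only [h1, h2, h3, h4] <;>
        first | ring1 | linear_combination (-y) * hdet
  obtain ⟨x, y, ⟨h1, h2⟩, h3, h4⟩ := key n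
  refine ⟨y, h3, ?_, ?_⟩ <;> simp only [fixedForm, h1, h2, h3, h4] <;> ring

lemma exists_isMultiple_of_signEq_zpow {M N : SL(2, Zlam p)} {n : ℤ} (h : SignEq N (M ^ n)) :
    ∃ t, IsMultiple t (fixedForm M) (fixedForm N) := by
  have hz : ∃ t, IsMultiple t (fixedForm M) (fixedForm (M ^ n)) := by
    rcases Int.eq_nat_or_neg n with ⟨k, rfl | rfl⟩
    · simpa using exists_isMultiple_pow M k
    · obtain ⟨t, ht⟩ := exists_isMultiple_pow M k
      rw [zpow_neg, zpow_natCast, fixedForm_inv]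
      exact ⟨-t, ht.neg⟩
  obtain ⟨t, ht⟩ := hz
  rcases h with rfl | rfl
  · exact ⟨t, ht⟩
  · rw [fixedForm_neg]
    exact ⟨-t, ht.neg⟩

/-! ### The form associated with a hyperbolic point -/

lemma IsStabilizerGenerator.neg {x : ℝ} {M : SL(2, Zlam p)} (h : IsStabilizerGenerator p x M) :
    IsStabilizerGenerator p x (-M) := by
  obtain ⟨h1, h2, h3⟩ := h
  refine ⟨neg_mem_hecke h1, ?_, ?_⟩
  · rw [← val_fixedForm] at h2 ⊢
    rw [fixedForm_neg]
    simp only [Form.val, Form.neg_A, Form.neg_B, Form.neg_C] at h2 ⊢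
    push_cast
    linarith
  · intro N hN hfix
    obtain ⟨n, hn⟩ := h3 N hN hfix
    refine ⟨n, ?_⟩
    rcases Int.even_or_odd n with he | ho
    · rwa [he.neg_zpow]
    · rw [ho.neg_zpow, neg_neg]
      exact hn.symm

lemma IsHyperbolicPoint.fixedForm_A_ne (hp : 3 ≤ p) {x : ℝ} (hx : IsHyperbolicPoint p x)
    {M : SL(2, Zlam p)} (hM : IsStabilizerGenerator p x M) :
    ((fixedForm M).A : ℝ) ≠ 0 := by
  obtain ⟨N, hN, htr, hfix⟩ := hx
  obtain ⟨n, hn⟩ := hM.2.2 N hN hfix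
  obtain ⟨t, ht⟩ := exists_isMultiple_of_signEq_zpow hn
  intro h
  have h0 : (N 1 0 : ℝ) = 0 := by
    have := congrArg (Subtype.val) ht.1
    simp only [fixedForm] at this h
    push_cast at this
    rw [this, h, mul_zero]
  have := abs_trace_le_of_lower_zero hp hN h0
  linarith

lemma IsHyperbolicPoint.fixedForm_disc_pos {x : ℝ} (hx : IsHyperbolicPoint p x) {M : SL(2, Zlam p)}
    (hM : IsStabilizerGenerator p x M) : 0 < ((fixedForm M).disc : ℝ) := by
  obtain ⟨N, hN, htr, hfix⟩ := hx
  obtain ⟨n, hn⟩ := hM.2.2 N hN hfix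
  obtain ⟨t, ht⟩ := exists_isMultiple_of_signEq_zpow hn
  have h1 := congrArg (Subtype.val) ht.disc
  have h2 := disc_fixedForm N
  push_cast at h1
  have h3 : 4 < ((N 0 0 : ℝ) + (N 1 1 : ℝ)) ^ 2 := by
    rw [← sq_abs]; nlinarith
  rw [h1] at h2
  by_contra h
  nlinarith [mul_nonneg (sq_nonneg (t : ℝ)) (sub_nonneg.2 (not_lt.1 h))]

lemma den_pow_of_fixed {M : SL(2, Zlam p)} {x : ℝ} (h : den M x ≠ 0) (hfix : act M x = x) (n : ℕ) :
    den (M ^ n) x = den M x ^ n := by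
  induction n with
  | zero => simp
  | succ n ih => rw [pow_succ, den_mul _ _ h, hfix, ih, pow_succ]

lemma Ordinary.den_inv {M : SL(2, Zlam p)} {x : ℝ} (hx : Ordinary p x) (hM : M ∈ heckeGroup p) :
    den M⁻¹ (HeckeRPF.act M x) * den M x = 1 := by
  rw [← den_mul _ _ (hx M hM), inv_mul_cancel, den_one]

lemma abs_den_zpow {M : SL(2, Zlam p)} {x : ℝ} (hx : Ordinary p x) (hM : M ∈ heckeGroup p)
    (hfix : act M x = x) (n : ℤ) : |den (M ^ n) x| = |den M x| ^ n := by
  rcases Int.eq_nat_or_neg n with ⟨k, rfl | rfl⟩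
  · rw [zpow_natCast, zpow_natCast, den_pow_of_fixed (hx M hM) hfix, abs_pow]
  · rw [zpow_neg, zpow_natCast, zpow_neg, zpow_natCast, ← abs_pow,
      ← den_pow_of_fixed (hx M hM) hfix, ← abs_inv]
    have hk : act (M ^ k) x = x := by
      induction k with
      | zero => simp
      | succ k ih => rw [pow_succ, act_mul _ _ (hx M hM), hfix, ih]
    have := hx.den_inv (pow_mem hM k)
    rw [hk] at this
    rw [eq_inv_of_mul_eq_one_left this]

/-- The denominator of a hyperbolic matrix at a fixed point is an eigenvalue. -/
lemma abs_den_ne_one {M : SL(2, Zlam p)} {x : ℝ} (hx : Ordinary p x) (hM : M ∈ heckeGroup p)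
    (htr : 2 < |(M 0 0 : ℝ) + (M 1 1 : ℝ)|) (hfix : Fixes M x) : |den M x| ≠ 1 := by
  intro h
  have h0 := hx M hM
  have hchar : den M x ^ 2 - ((M 0 0 : ℝ) + (M 1 1 : ℝ)) * den M x + 1 = 0 := by
    rw [Fixes] at hfix
    rw [den]
    linear_combination -det_eq_real M + (-(M 1 0 : ℝ)) * hfix
  rcases (abs_eq zero_le_one).1 h with h | h <;> rw [h] at hchar
  · rw [show (M 0 0 : ℝ) + (M 1 1 : ℝ) = 2 by linarith] at htr
    norm_num at htr
  · rw [show (M 0 0 : ℝ) + (M 1 1 : ℝ) = -2 by linarith] at htr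
    norm_num at htr

/-- Generators of the stabilizer of a hyperbolic point are unique up to sign and inversion. -/
lemma IsStabilizerGenerator.fixedForm_eq_or (hp : 3 ≤ p) {x : ℝ} (hx : IsHyperbolicPoint p x)
    {M N : SL(2, Zlam p)} (hM : IsStabilizerGenerator p x M) (hN : IsStabilizerGenerator p x N) :
    fixedForm N = fixedForm M ∨ fixedForm N = -fixedForm M := by
  have ho := hx.ordinary hp
  have hMfix := (fixes_iff (ho M hM.1)).1 hM.2.1
  have hNfix := (fixes_iff (ho N hN.1)).1 hN.2.1
  have abs_den_signEq : ∀ {K L : SL(2, Zlam p)}, SignEq K L → |den K x| = |den L x| := by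
    rintro K L (rfl | rfl)
    · rfl
    · rw [den_neg, abs_neg]
  have hne : |den M x| ≠ 1 := by
    obtain ⟨K, hK, htr, hfix⟩ := hx
    obtain ⟨n, hn⟩ := hM.2.2 K hK hfix
    intro h
    apply abs_den_ne_one ho hK htr hfix
    rw [abs_den_signEq hn, abs_den_zpow ho hM.1 hMfix, h, one_zpow]
  have hpos : 0 < |den M x| := abs_pos.2 (ho M hM.1)
  obtain ⟨n, hn⟩ := hM.2.2 N hN.1 hN.2.1
  obtain ⟨m, hm⟩ := hN.2.2 M hM.1 hM.2.1
  have e1 := abs_den_signEq hn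
  have e2 := abs_den_signEq hm
  rw [abs_den_zpow ho hM.1 hMfix] at e1
  rw [abs_den_zpow ho hN.1 hNfix, e1, ← zpow_mul] at e2
  have hnm : n * m = 1 := by
    apply zpow_right_injective₀ hpos hne
    simpa using e2.symm
  rcases Int.eq_one_or_neg_one_of_mul_eq_one hnm with rfl | rfl
  · rw [zpow_one] at hn
    rcases hn with rfl | rfl
    · exact Or.inl rfl
    · exact Or.inr (fixedForm_neg _)
  · rw [zpow_neg, zpow_one] at hn
    rcases hn with rfl | rfl
    · exact Or.inr (fixedForm_inv _)
    · rw [fixedForm_neg, fixedForm_inv, Form.neg_neg']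
      exact Or.inl rfl

lemma IsNormalization.pos {g : Ideal (Zlam p) → Zlam p} (hg : IsNormalization p g) {F : Form p}
    (hA : (F.A : ℝ) ≠ 0) : 0 < (g F.content : ℝ) := by
  by_cases hP : IsPrincipalIdealRing (Zlam p)
  · refine (hg.1 hP _ ?_).1
    intro h
    have : F.A ∈ F.content := Ideal.subset_span (by simp)
    rw [h, Ideal.mem_bot] at this
    simp [this] at hA
  · rw [hg.2 hP]; simp

lemma IsNormalization.span_eq {g : Ideal (Zlam p) → Zlam p} (hg : IsNormalization p g) {F : Form p}
    (hA : (F.A : ℝ) ≠ 0) (hP : IsPrincipalIdealRing (Zlam p)) :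
    Ideal.span {g F.content} = F.content := by
  refine (hg.1 hP _ ?_).2
  intro h
  have : F.A ∈ F.content := Ideal.subset_span (by simp)
  rw [h, Ideal.mem_bot] at this
  simp [this] at hA

section Associated

variable {g : Ideal (Zlam p) → Zlam p} (hp : 3 ≤ p) (hg : IsNormalization p g)

/-- What is used of an associated form: it is a positive rescaling, by the normalizing factor, of
the fixed point form of a generator, and its derivative at the point is positive. -/
lemma isAssociatedForm_iff (hp : 3 ≤ p) (hg : IsNormalization p g) {x : ℝ}
    (hx : IsHyperbolicPoint p x) (Q : Form p) :
    IsAssociatedForm p g x Q ↔ ∃ M, IsStabilizerGenerator p x M ∧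
      IsMultiple (g (fixedForm M).content) Q (fixedForm M) ∧
      (fixedForm M).slope x = √((fixedForm M).disc : ℝ) := by
  constructor
  · rintro ⟨M, hM, hA, hB, hC, hr⟩
    have hm : IsMultiple (g (fixedForm M).content) Q (fixedForm M) := ⟨hA.symm, hB.symm, hC.symm⟩
    have hFA := hx.fixedForm_A_ne hp hM
    have hgp := hg.pos hFA
    refine ⟨M, hM, hm, ?_⟩
    have hQA : (Q.A : ℝ) ≠ 0 := by
      intro h
      apply hFA
      rw [← hA]; push_cast; rw [h, mul_zero]
    rw [Form.eq_root_iff hQA] at hr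
    rw [hm.slope, hm.disc, hr]
    push_cast
    rw [Real.sqrt_mul (sq_nonneg _), Real.sqrt_sq hgp.le]
  · rintro ⟨M, hM, hm, hs⟩
    have hFA := hx.fixedForm_A_ne hp hM
    have hgp := hg.pos hFA
    refine ⟨M, hM, hm.1.symm, hm.2.1.symm, hm.2.2.symm, ?_⟩
    have hQA : (Q.A : ℝ) ≠ 0 := by
      intro h
      apply hFA
      rw [hm.1]; push_cast; rw [h, mul_zero]
    rw [Form.eq_root_iff hQA]
    rw [hm.slope, hm.disc] at hs
    push_cast at hs
    rw [Real.sqrt_mul (sq_nonneg _), Real.sqrt_sq hgp.le] at hs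
    exact mul_left_cancel₀ hgp.ne' hs

include hp hg

/-- The sign is adjusted by passing from a generator `M` to `-M`; the normalizing factor divides the
coefficients, as it generates their ideal or is `1`. -/
lemma IsHyperbolicPoint.exists_associated {x : ℝ} (hx : IsHyperbolicPoint p x) :
    ∃ Q, IsAssociatedForm p g x Q := by
  obtain ⟨M, hM⟩ := hx.exists_stabilizerGenerator hp
  have sign : ∃ M, IsStabilizerGenerator p x M ∧
      (fixedForm M).slope x = √((fixedForm M).disc : ℝ) := by
    have h1 := (Form.val_eq_zero_iff (hx.fixedForm_A_ne hp hM) x).1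
      ((val_fixedForm M x).2 hM.2.1)
    have h2 := Real.sq_sqrt (hx.fixedForm_disc_pos hM).le
    rw [← h1] at h2
    rcases sq_eq_sq_iff_eq_or_eq_neg.1 h2 with h | h
    · exact ⟨M, hM, by rw [← h, ← h1]⟩
    · refine ⟨-M, hM.neg, ?_⟩
      rw [fixedForm_neg, Form.disc_neg, ← h1, h]
      simp only [Form.slope, Form.neg_A, Form.neg_B]
      push_cast
      ring
  obtain ⟨M, hM, hs⟩ := sign
  have hFA := hx.fixedForm_A_ne hp hM
  have hdvd : ∀ a ∈ (fixedForm M).content, g (fixedForm M).content ∣ a := by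
    intro a ha
    by_cases hP : IsPrincipalIdealRing (Zlam p)
    · rwa [← hg.span_eq hFA hP, Ideal.mem_span_singleton] at ha
    · rw [hg.2 hP]; exact one_dvd _
  obtain ⟨a, ha⟩ := hdvd (fixedForm M).A (Ideal.subset_span (by simp))
  obtain ⟨b, hb⟩ := hdvd (fixedForm M).B (Ideal.subset_span (by simp))
  obtain ⟨c, hc⟩ := hdvd (fixedForm M).C (Ideal.subset_span (by simp))
  exact ⟨⟨a, b, c⟩, (isAssociatedForm_iff hp hg hx _).2 ⟨M, hM, ⟨ha, hb, hc⟩, hs⟩⟩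

lemma IsAssociatedForm.unique {x : ℝ} (hx : IsHyperbolicPoint p x) {Q Q' : Form p}
    (h : IsAssociatedForm p g x Q) (h' : IsAssociatedForm p g x Q') : Q = Q' := by
  rw [isAssociatedForm_iff hp hg hx] at h h'
  obtain ⟨M, hM, hm, hs⟩ := h
  obtain ⟨N, hN, hn, ht⟩ := h'
  have hFA := hx.fixedForm_A_ne hp hM
  have hgp := hg.pos hFA
  have hD := Real.sqrt_pos.2 (hx.fixedForm_disc_pos hM)
  have hMN : fixedForm N = fixedForm M := by
    refine (hM.fixedForm_eq_or hp hx hN).resolve_right fun h => ?_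
    rw [h, Form.disc_neg, ← hs] at ht
    rw [← hs] at hD
    simp only [Form.slope, Form.neg_A, Form.neg_B] at ht hD
    push_cast at ht
    linarith
  rw [hMN] at hn
  have hg0 : g (fixedForm M).content ≠ 0 := by
    intro h
    rw [h] at hgp
    simp at hgp
  ext1
  · exact mul_left_cancel₀ hg0 (hm.1.symm.trans hn.1)
  · exact mul_left_cancel₀ hg0 (hm.2.1.symm.trans hn.2.1)
  · exact mul_left_cancel₀ hg0 (hm.2.2.symm.trans hn.2.2)

lemma isAssociatedForm_formOf {x : ℝ} (hx : IsHyperbolicPoint p x) :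
    IsAssociatedForm p g x (formOf p g x) := by
  have h := hx.exists_associated hp hg
  rw [formOf, dif_pos h]
  exact h.choose_spec

lemma formOf_eq {x : ℝ} (hx : IsHyperbolicPoint p x) {Q : Form p}
    (h : IsAssociatedForm p g x Q) : formOf p g x = Q :=
  (isAssociatedForm_formOf hp hg hx).unique hp hg hx h

lemma formOf_A_ne {x : ℝ} (hx : IsHyperbolicPoint p x) : ((formOf p g x).A : ℝ) ≠ 0 := by
  obtain ⟨M, hM, hm, -⟩ := (isAssociatedForm_iff hp hg hx _).1 (isAssociatedForm_formOf hp hg hx)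
  intro h
  apply hx.fixedForm_A_ne hp hM
  rw [hm.1]; push_cast; rw [h, mul_zero]

lemma formOf_disc_pos {x : ℝ} (hx : IsHyperbolicPoint p x) :
    0 < ((formOf p g x).disc : ℝ) := by
  obtain ⟨M, hM, hm, -⟩ := (isAssociatedForm_iff hp hg hx _).1 (isAssociatedForm_formOf hp hg hx)
  have h := hx.fixedForm_disc_pos hM
  rw [hm.disc] at h
  push_cast at h
  exact pos_of_mul_pos_right h (sq_nonneg _)

lemma formOf_root {x : ℝ} (hx : IsHyperbolicPoint p x) : (formOf p g x).root = x := by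
  obtain ⟨M, -, -, -, -, h⟩ := isAssociatedForm_formOf hp hg hx
  exact h.symm

lemma formOf_slope {x : ℝ} (hx : IsHyperbolicPoint p x) :
    (formOf p g x).slope x = √((formOf p g x).disc : ℝ) :=
  (Form.eq_root_iff (formOf_A_ne hp hg hx) x).1 (formOf_root hp hg hx).symm

lemma formOf_val {x : ℝ} (hx : IsHyperbolicPoint p x) : (formOf p g x).val x = 0 := by
  rw [Form.val_eq_zero_iff (formOf_A_ne hp hg hx), formOf_slope hp hg hx,
    Real.sq_sqrt (formOf_disc_pos hp hg hx).le]

lemma heckeConj_slope {x : ℝ} (hx : IsHyperbolicPoint p x) :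
    (formOf p g x).slope (heckeConj p g x) = -√((formOf p g x).disc : ℝ) :=
  (Form.eq_conjRoot_iff (formOf_A_ne hp hg hx) _).1 rfl

lemma heckeConj_ne {x : ℝ} (hx : IsHyperbolicPoint p x) : heckeConj p g x ≠ x := by
  intro h
  have e1 := formOf_slope hp hg hx
  have e2 := heckeConj_slope hp hg hx
  have := Real.sqrt_pos.2 (formOf_disc_pos hp hg hx)
  rw [h, e1] at e2
  linarith

lemma formOf_val_heckeConj {x : ℝ} (hx : IsHyperbolicPoint p x) :
    (formOf p g x).val (heckeConj p g x) = 0 := by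
  rw [Form.val_eq_zero_iff (formOf_A_ne hp hg hx), heckeConj_slope hp hg hx, neg_sq,
    Real.sq_sqrt (formOf_disc_pos hp hg hx).le]

/-- Over a principal ideal domain, dividing by a generator of the content makes a form primitive. -/
lemma formOf_isBQF {x : ℝ} (hx : IsHyperbolicPoint p x) : (formOf p g x).IsBQF := by
  refine ⟨formOf_disc_pos hp hg hx, fun hP => ?_⟩
  obtain ⟨M, hM, hm, -⟩ := (isAssociatedForm_iff hp hg hx _).1 (isAssociatedForm_formOf hp hg hx)
  have hFA := hx.fixedForm_A_ne hp hM
  have hgp := hg.pos hFA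
  have hg0 : g (fixedForm M).content ≠ 0 := by
    intro h
    rw [h] at hgp
    simp at hgp
  have h1 := hg.span_eq hFA hP
  have h2 : ∀ t : Zlam p, Ideal.span {t} = (fixedForm M).content → t ∈ (fixedForm M).content :=
    fun t ht => ht ▸ Ideal.mem_span_singleton_self t
  -- divide an expression of the generator through the coefficients by the generator
  have h3 : ∀ a ∈ (fixedForm M).content, ∃ b ∈ (formOf p g x).content,
      a = g (fixedForm M).content * b := by
    intro a ha
    rw [Form.content] at ha
    induction ha using Submodule.span_induction with
    | mem a h =>
      rcases h with rfl | rfl | rfl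
      · exact ⟨_, Ideal.subset_span (by simp), hm.1⟩
      · exact ⟨_, Ideal.subset_span (by simp), hm.2.1⟩
      · exact ⟨_, Ideal.subset_span (by simp), hm.2.2⟩
    | zero => exact ⟨0, zero_mem _, by simp⟩
    | add a b _ _ iha ihb =>
      obtain ⟨c, hc, rfl⟩ := iha
      obtain ⟨d, hd, rfl⟩ := ihb
      exact ⟨c + d, add_mem hc hd, by ring⟩
    | smul t a _ ih =>
      obtain ⟨c, hc, rfl⟩ := ih
      exact ⟨t * c, Ideal.mul_mem_left _ _ hc, by simp only [smul_eq_mul]; ring⟩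
  obtain ⟨b, hb, hb'⟩ := h3 _ (h2 _ h1)
  have : b = 1 := mul_left_cancel₀ hg0 (by rw [← hb', mul_one])
  rwa [this, ← Ideal.eq_top_iff_one] at hb

/-- Equivariance of `x ↦ Q_x`. -/
lemma formOf_act_inv {x : ℝ} (hx : IsHyperbolicPoint p x) {N : SL(2, Zlam p)}
    (hN : N ∈ heckeGroup p) : formOf p g (act N⁻¹ x) = (formOf p g x).comp N := by
  have ho := hx.ordinary hp
  have hy := hx.act hp (inv_mem hN)
  have hyo := hy.ordinary hp
  apply formOf_eq hp hg hy
  obtain ⟨M, hM, hm, hs⟩ := (isAssociatedForm_iff hp hg hx _).1 (isAssociatedForm_formOf hp hg hx)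
  rw [isAssociatedForm_iff hp hg hy]
  refine ⟨N⁻¹ * M * N, ?_, ?_, ?_⟩
  · simpa using hM.conj ho (inv_mem hN)
  · rw [fixedForm_conj, Form.content_comp]
    simp only [IsMultiple, Form.comp, hm.1, hm.2.1, hm.2.2]
    refine ⟨?_, ?_, ?_⟩ <;> ring
  · have h1 : act N (act N⁻¹ x) = x := ho.act_act_inv hN
    rw [fixedForm_conj, Form.disc_comp, Form.slope_comp _ _ (hyo N hN), h1, hs]
    rw [h1, val_fixedForm]
    exact hM.2.1

lemma formOf_act {x : ℝ} (hx : IsHyperbolicPoint p x) {N : SL(2, Zlam p)}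
    (hN : N ∈ heckeGroup p) : formOf p g (act N x) = (formOf p g x).comp N⁻¹ := by
  rw [← formOf_act_inv hp hg hx (inv_mem hN), inv_inv]

/-- The fixed point form of any element of the stabilizer is a multiple of the associated form, so
the stabilizer fixes the second root as well. -/
lemma exists_isMultiple_fixedForm {x : ℝ} (hx : IsHyperbolicPoint p x) {N : SL(2, Zlam p)}
    (hN : N ∈ heckeGroup p) (hfix : Fixes N x) :
    ∃ t, IsMultiple t (formOf p g x) (fixedForm N) := by
  obtain ⟨M, hM, hm, -⟩ := (isAssociatedForm_iff hp hg hx _).1 (isAssociatedForm_formOf hp hg hx)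
  obtain ⟨n, hn⟩ := hM.2.2 N hN hfix
  obtain ⟨t, ht⟩ := exists_isMultiple_of_signEq_zpow hn
  refine ⟨t * g (fixedForm M).content, ?_, ?_, ?_⟩
  · rw [ht.1, hm.1]; ring
  · rw [ht.2.1, hm.2.1]; ring
  · rw [ht.2.2, hm.2.2]; ring

lemma Fixes.heckeConj {x : ℝ} (hx : IsHyperbolicPoint p x) {N : SL(2, Zlam p)}
    (hN : N ∈ heckeGroup p) (hfix : Fixes N x) : Fixes N (heckeConj p g x) := by
  obtain ⟨t, ht⟩ := exists_isMultiple_fixedForm hp hg hx hN hfix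
  rw [← val_fixedForm, ht.val, formOf_val_heckeConj hp hg hx, mul_zero]

lemma IsHyperbolicPoint.heckeConj {x : ℝ} (hx : IsHyperbolicPoint p x) :
    IsHyperbolicPoint p (heckeConj p g x) := by
  obtain ⟨M, hM, htr, hfix⟩ := id hx
  exact ⟨M, hM, htr, hfix.heckeConj hp hg hx hM⟩

/-- A hyperbolic point and its conjugate have the same stabilizer. -/
lemma IsStabilizerGenerator.heckeConj {x : ℝ} (hx : IsHyperbolicPoint p x) {M : SL(2, Zlam p)}
    (hM : IsStabilizerGenerator p x M) : IsStabilizerGenerator p (heckeConj p g x) M := by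
  refine ⟨hM.1, hM.2.1.heckeConj hp hg hx hM.1, ?_⟩
  intro N hN hfix
  apply hM.2.2 N hN
  obtain ⟨M', hM'⟩ := (hx.heckeConj hp hg).exists_stabilizerGenerator hp
  -- `M'` fixes `x`, because its form is proportional to that of `M`
  obtain ⟨n, hn⟩ := hM'.2.2 M hM.1 (hM.2.1.heckeConj hp hg hx hM.1)
  obtain ⟨t, ht⟩ := exists_isMultiple_of_signEq_zpow hn
  have hFA := hx.fixedForm_A_ne hp hM
  have ht0 : (t : ℝ) ≠ 0 := by
    intro h
    apply hFA
    rw [ht.1]; push_cast; rw [h, zero_mul]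
  have hv := (val_fixedForm M x).2 hM.2.1
  rw [ht.val] at hv
  have hv' := (mul_eq_zero.1 hv).resolve_left ht0
  obtain ⟨k, hk⟩ := hM'.2.2 N hN hfix
  obtain ⟨s, hs⟩ := exists_isMultiple_of_signEq_zpow hk
  rw [← val_fixedForm, hs.val, hv', mul_zero]

/-- The conjugate point is the first root of `-Q`, since a change of sign exchanges the two roots. -/
lemma formOf_heckeConj {x : ℝ} (hx : IsHyperbolicPoint p x) :
    formOf p g (heckeConj p g x) = -formOf p g x := by
  have hy := hx.heckeConj hp hg
  apply formOf_eq hp hg hy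
  obtain ⟨M, hM, hm, hs⟩ := (isAssociatedForm_iff hp hg hx _).1 (isAssociatedForm_formOf hp hg hx)
  rw [isAssociatedForm_iff hp hg hy]
  have hg0 := hg.pos (hx.fixedForm_A_ne hp hM)
  refine ⟨-M, (hM.heckeConj hp hg hx).neg, ?_, ?_⟩
  · rw [fixedForm_neg, Form.content_neg]
    simp [IsMultiple, hm.1, hm.2.1, hm.2.2]
  · have h1 : (fixedForm (-M)).slope (heckeConj p g x) =
        -(fixedForm M).slope (heckeConj p g x) := by
      rw [fixedForm_neg]; simp only [Form.slope, Form.neg_A, Form.neg_B]; push_cast; ring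
    rw [h1, fixedForm_neg, Form.disc_neg, hm.slope, heckeConj_slope hp hg hx, hm.disc]
    push_cast
    rw [Real.sqrt_mul (sq_nonneg _), Real.sqrt_sq hg0.le]
    ring

lemma formOf_injective {x y : ℝ} (hx : IsHyperbolicPoint p x) (hy : IsHyperbolicPoint p y)
    (h : formOf p g x = formOf p g y) : x = y := by
  rw [← formOf_root hp hg hx, h, formOf_root hp hg hy]

lemma heckeConj_heckeConj {x : ℝ} (hx : IsHyperbolicPoint p x) :
    heckeConj p g (heckeConj p g x) = x := by
  have hy := hx.heckeConj hp hg
  apply formOf_injective hp hg (hy.heckeConj hp hg) hx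
  rw [formOf_heckeConj hp hg hy, formOf_heckeConj hp hg hx, Form.neg_neg']

lemma heckeConj_act {x : ℝ} (hx : IsHyperbolicPoint p x) {N : SL(2, Zlam p)}
    (hN : N ∈ heckeGroup p) : heckeConj p g (act N x) = act N (heckeConj p g x) := by
  have hx' := hx.heckeConj hp hg
  apply formOf_injective hp hg ((hx.act hp hN).heckeConj hp hg) (hx'.act hp hN)
  rw [formOf_heckeConj hp hg (hx.act hp hN), formOf_act hp hg hx hN, formOf_act hp hg hx' hN,
    formOf_heckeConj hp hg hx, Form.neg_comp]

/-- The form of a hyperbolic point is simple if and only if the point is positive and its conjugate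
is negative. -/
lemma formOf_isSimple_iff {x : ℝ} (hx : IsHyperbolicPoint p x) :
    (formOf p g x).IsSimple ↔ 0 < x ∧ heckeConj p g x < 0 := by
  have h1 := formOf_slope hp hg hx
  have h2 := heckeConj_slope hp hg hx
  have hD := Real.sqrt_pos.2 (formOf_disc_pos hp hg hx)
  have h3 := formOf_val hp hg hx
  set Q := formOf p g x
  set y := heckeConj p g x
  set s := √(Q.disc : ℝ)
  rw [Form.slope] at h1 h2
  rw [Form.val] at h3
  -- Vieta
  have hdiff : (Q.A : ℝ) * (x - y) = s := by linarith
  have hsum : (Q.A : ℝ) * (x + y) = -(Q.B : ℝ) := by linarith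
  have hprod : (Q.C : ℝ) = (Q.A : ℝ) * (x * y) := by
    linear_combination h3 - x * hsum
  rw [Form.IsSimple, hprod]
  constructor
  · rintro ⟨hA, hC⟩
    have hxy : x * y < 0 := by
      by_contra h
      nlinarith [mul_nonneg hA.le (not_lt.1 h)]
    have hlt : y < x := by
      by_contra h
      nlinarith [mul_nonneg hA.le (sub_nonneg.2 (not_lt.1 h))]
    rcases mul_neg_iff.1 hxy with h | h
    · exact h
    · exact absurd hlt (by linarith)
  · rintro ⟨hx0, hy0⟩
    have hA : 0 < (Q.A : ℝ) := by
      by_contra h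
      nlinarith [mul_nonneg (neg_nonneg.2 (not_lt.1 h)) (sub_pos.2 (hy0.trans hx0)).le]
    exact ⟨hA, mul_neg_of_pos_of_neg hA (mul_neg_of_pos_of_neg hx0 hy0)⟩

end Associated

/-! ### Simple points and their cycles -/

/-- A hyperbolic point is simple if it is positive and its Hecke conjugate is negative. -/
def IsSimplePoint (p : ℕ) (g : Ideal (Zlam p) → Zlam p) (x : ℝ) : Prop :=
  IsHyperbolicPoint p x ∧ 0 < x ∧ heckeConj p g x < 0

/-- `x` and `y` are equivalent under the Hecke group. -/
def PointEquiv (p : ℕ) (x y : ℝ) : Prop := ∃ V ∈ heckeGroup p, y = act V x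

lemma PointEquiv.refl (x : ℝ) : PointEquiv p x x := ⟨1, one_mem _, (act_one x).symm⟩

lemma PointEquiv.act {x y : ℝ} (hx : Ordinary p x) (h : PointEquiv p x y) {V : SL(2, Zlam p)}
    (hV : V ∈ heckeGroup p) : PointEquiv p x (act V y) := by
  obtain ⟨N, hN, rfl⟩ := h
  exact ⟨V * N, mul_mem hV hN, (act_mul _ _ (hx N hN)).symm⟩

lemma PointEquiv.symm {x y : ℝ} (hx : Ordinary p x) (h : PointEquiv p x y) : PointEquiv p y x := by
  obtain ⟨N, hN, rfl⟩ := h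
  exact ⟨N⁻¹, inv_mem hN, (hx.act_inv_act hN).symm⟩

lemma PointEquiv.trans {x y z : ℝ} (hx : Ordinary p x) (h : PointEquiv p x y)
    (h' : PointEquiv p y z) : PointEquiv p x z := by
  obtain ⟨N, hN, rfl⟩ := h'
  exact h.act hx hN

lemma PointEquiv.iterate {x : ℝ} (hx : Ordinary p x) (n : ℕ) :
    PointEquiv p x ((cfMap p)^[n] x) :=
  ⟨cfWord p n x, cfWord_mem n x, (act_cfWord hx n).symm⟩

section

variable {g : Ideal (Zlam p) → Zlam p} (hp : 3 ≤ p) (hg : IsNormalization p g)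

lemma SignEq.U_pow_inv (hp : 3 ≤ p) {t : ℕ} (ht : t ≤ p) :
    SignEq (U p ^ t)⁻¹ (U p ^ (p - t)) := by
  apply SignEq.mul_left_cancel (K := U p ^ t)
  rw [mul_inv_cancel, ← pow_add, Nat.add_sub_cancel' ht]
  exact (SignEq.U_pow_p hp).symm

include hp

/-- At a positive point each step is `T Uᵗ` with `1 ≤ t < p`, whose inverse is up to sign the
nonnegative matrix `-Uᵖ⁻ᵗ T`. -/
lemma cfWord_inv_mem {x : ℝ} (hx : Ordinary p x) (h0 : 0 < x) (n : ℕ) :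
    ∃ V ∈ posMonoid p, SignEq (cfWord p n x)⁻¹ V := by
  induction n generalizing x with
  | zero => exact ⟨1, one_mem _, by simp [cfWord, SignEq]⟩
  | succ n ih =>
    obtain ⟨V, hV, h⟩ := ih hx.cfMap (cfMap_pos hp hx)
    have ht := turn_pos hp hx h0
    have ht' := turn_lt hp hx
    refine ⟨posMat p (p - turn p x) * V, mul_mem (posMat_mem (by omega) (by omega)) hV, ?_⟩
    rw [cfWord, mul_inv_rev]
    refine SignEq.mul ?_ h
    rw [cfStep, mul_inv_rev]
    refine SignEq.trans ?_ (SignEq.posMat _).symm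
    refine (SignEq.U_pow_inv hp ht'.le).mul ?_
    rw [T_inv]
    exact SignEq.neg_left _

include hg

/-- A simple point and its conjugate have their negative points at different exponents. -/
lemma IsSimplePoint.act_turn {x : ℝ} (hx : IsSimplePoint p g x) :
    0 < act (U p ^ turn p x) (heckeConj p g x) := by
  obtain ⟨h, h0, h1⟩ := hx
  have ho := h.ordinary hp
  have ho' := (h.heckeConj hp hg).ordinary hp
  by_contra hneg
  have hlt := lt_of_le_of_ne (not_lt.1 hneg) (ho'.act (U_pow_mem _)).ne_zero
  have h2 := turn_eq_mod hp ho' hlt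
  rw [turn_of_neg hp ho' h1, Nat.mod_eq_of_lt (turn_lt hp ho)] at h2
  have := turn_pos hp ho h0
  omega

lemma heckeConj_cfMap {x : ℝ} (hx : IsHyperbolicPoint p x) :
    heckeConj p g (cfMap p x) =
      act (T p) (act (U p ^ turn p x) (heckeConj p g x)) := by
  rw [cfMap, heckeConj_act hp hg hx (cfStep_mem x), cfStep,
    act_mul _ _ ((hx.heckeConj hp hg).ordinary hp _ (U_pow_mem _))]

lemma IsSimplePoint.cfMap {x : ℝ} (hx : IsSimplePoint p g x) : IsSimplePoint p g (cfMap p x) := by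
  refine ⟨hx.1.act hp (cfStep_mem x), cfMap_pos hp (hx.1.ordinary hp), ?_⟩
  rw [heckeConj_cfMap hp hg hx.1]
  exact act_T_neg (hx.act_turn hp hg)

lemma IsSimplePoint.iterate {x : ℝ} (hx : IsSimplePoint p g x) (n : ℕ) :
    IsSimplePoint p g ((HeckeRPF.cfMap p)^[n] x) := by
  induction n generalizing x with
  | zero => exact hx
  | succ n ih => exact ih (hx.cfMap hp hg)

/-- On simple points the continued fraction map is injective: the sign of the conjugate determines
which branch has to be inverted. -/
lemma cfMap_injective {x y : ℝ} (hx : IsSimplePoint p g x) (hy : IsSimplePoint p g y)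
    (h : cfMap p x = cfMap p y) : x = y := by
  have hxo := hx.1.ordinary hp
  have hyo := hy.1.ordinary hp
  have key : ∀ {x w : ℝ}, IsSimplePoint p g x → act (U p ^ turn p x) x = w →
      x = act (U p ^ (p - turn p x)) w ∧ p - turn p x = turn p (heckeConj p g w) := by
    intro x w hx hw
    have hxo := hx.1.ordinary hp
    have hw' : act (U p ^ turn p x) (heckeConj p g x) = heckeConj p g w := by
      rw [← hw, heckeConj_act hp hg hx.1 (U_pow_mem _)]
    have ht := turn_lt hp hxo
    have ht1 := turn_pos hp hxo hx.2.1
    have back : ∀ {z : ℝ}, Ordinary p z →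
        act (U p ^ (p - turn p x)) (act (U p ^ turn p x) z) = z := by
      intro z hz
      rw [← (SignEq.U_pow_inv hp ht.le).act, hz.act_inv_act (U_pow_mem _)]
    refine ⟨by rw [← hw, back hxo], ?_⟩
    have hc := back ((hx.1.heckeConj hp hg).ordinary hp)
    rw [hw'] at hc
    have hwo : Ordinary p (heckeConj p g w) :=
      hw' ▸ ((hx.1.heckeConj hp hg).ordinary hp).act (U_pow_mem _)
    rw [← turn_eq_mod hp hwo (n := p - turn p x) (hc ▸ hx.2.2), Nat.mod_eq_of_lt (by omega)]
  rw [cfMap_eq hxo, cfMap_eq hyo] at h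
  have h' : act (U p ^ turn p x) x = act (U p ^ turn p y) y := by
    rw [← act_T_act_T (hxo.act (U_pow_mem _)), h, act_T_act_T (hyo.act (U_pow_mem _))]
  obtain ⟨e1, e2⟩ := key hx rfl
  obtain ⟨e3, e4⟩ := key hy h'.symm
  rw [e1, e3, e2, e4]

lemma iterate_injective {x y : ℝ} (hx : IsSimplePoint p g x) (hy : IsSimplePoint p g y) {n : ℕ}
    (h : (cfMap p)^[n] x = (cfMap p)^[n] y) : x = y := by
  induction n generalizing x y with
  | zero => exact h
  | succ n ih => exact cfMap_injective hp hg hx hy (ih (hx.cfMap hp hg) (hy.cfMap hp hg) h)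

/-- Simple points have purely periodic continued fractions. -/
lemma IsSimplePoint.periodic {x : ℝ} (hx : IsSimplePoint p g x) :
    ∃ r, 0 < r ∧ (HeckeRPF.cfMap p)^[r] x = x := by
  obtain ⟨n, r, hr, h⟩ := hx.1.exists_periodic hp
  refine ⟨r, hr, ?_⟩
  rw [← Function.iterate_add_apply, add_comm, Function.iterate_add_apply] at h
  exact iterate_injective hp hg (hx.iterate hp hg r) hx h

/-- Equivalent simple points belong to one cycle of the continued fraction map. -/
lemma IsSimplePoint.exists_iterate_eq {x y : ℝ} (hx : IsSimplePoint p g x)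
    (hy : IsSimplePoint p g y) (h : PointEquiv p x y) : ∃ n, y = (HeckeRPF.cfMap p)^[n] x := by
  obtain ⟨V, hV, rfl⟩ := h
  have ho := hx.1.ordinary hp
  obtain ⟨m, n, h⟩ := exists_cfWord_eq hp hV ho
  have e := iterate_eq_of_signEq hV ho h
  obtain ⟨r, hr, hper⟩ := hy.periodic hp hg
  have hle : n ≤ r * n := Nat.le_mul_of_pos_left n hr
  refine ⟨r * n - n + m, ?_⟩
  rw [Function.iterate_add_apply, e, ← Function.iterate_add_apply, Nat.sub_add_cancel hle]
  exact (Function.IsPeriodicPt.mul_const hper n).symm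

omit hp hg in
lemma finite_of_periodic {x : ℝ} {r : ℕ} (hr : 0 < r) (hper : (cfMap p)^[r] x = x) :
    {y | ∃ n, y = (cfMap p)^[n] x}.Finite := by
  refine ((Finset.range r).finite_toSet.image fun n => (cfMap p)^[n] x).subset ?_
  rintro y ⟨n, rfl⟩
  refine ⟨n % r, by simpa using Nat.mod_lt _ hr, ?_⟩
  exact Function.IsPeriodicPt.iterate_mod_apply hper n

/-- Conversely, a hyperbolic point with purely periodic continued fraction is simple. The inverse
of a generator of its stabilizer is up to sign a matrix with nonnegative entries `a, b, c, d`, so the product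
`-b / c` of the two fixed points is not positive. -/
lemma isSimplePoint_of_periodic {x : ℝ} (hx : IsHyperbolicPoint p x) {r : ℕ} (hr : 0 < r)
    (hper : (cfMap p)^[r] x = x) : IsSimplePoint p g x := by
  have ho := hx.ordinary hp
  have hpos : 0 < x := by
    obtain ⟨s, rfl⟩ := Nat.exists_eq_succ_of_ne_zero hr.ne'
    rw [← hper, Function.iterate_succ_apply']
    exact cfMap_pos hp (ho.iterate s)
  refine ⟨hx, hpos, ?_⟩
  have hM := isStabilizerGenerator_cfWord hp ho ⟨r, hr, hper⟩
  set M := cfWord p (Function.minimalPeriod (cfMap p) x) x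
  obtain ⟨V, hV, hMV⟩ := cfWord_inv_mem hp ho hpos (Function.minimalPeriod (cfMap p) x)
  have hVG : V ∈ heckeGroup p := hMV.symm.mem (inv_mem hM.1)
  have hf : fixedForm V = -fixedForm M ∨ fixedForm V = fixedForm M := by
    rcases hMV.symm with rfl | rfl
    · exact Or.inl (fixedForm_inv M)
    · rw [fixedForm_neg, fixedForm_inv, Form.neg_neg']
      exact Or.inr rfl
  have hA : ((fixedForm V).A : ℝ) ≠ 0 := by
    have := hx.fixedForm_A_ne hp hM
    rcases hf with h | h <;> rw [h]
    · simpa using this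
    · exact this
  have hVfix : Fixes V x := by
    have h := (val_fixedForm M x).2 hM.2.1
    rw [← val_fixedForm]
    rcases hf with h' | h' <;> rw [h']
    · simp only [Form.val, Form.neg_A, Form.neg_B, Form.neg_C] at h ⊢
      push_cast
      linarith
    · exact h
  have h1 := (val_fixedForm V x).2 hVfix
  have h2 := (val_fixedForm V _).2 (hVfix.heckeConj hp hg hx hVG)
  have hne := heckeConj_ne hp hg hx
  have hnonneg : ∀ a b, 0 ≤ (V a b : ℝ) := by
    intro a b
    rcases posMonoid_entries hp hV a b with h | h
    · exact h.ge
    · linarith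
  have hc := hnonneg 1 0
  have hb := hnonneg 0 1
  simp only [Form.val, fixedForm] at h1 h2 hA
  push_cast at h1 h2 hA
  have hc' : 0 < (V 1 0 : ℝ) := lt_of_le_of_ne hc (Ne.symm hA)
  set y := heckeConj p g x with hy
  have hprod : (x - y) * ((V 1 0 : ℝ) * (x * y) + (V 0 1 : ℝ)) = 0 := by
    linear_combination y * h1 - x * h2
  have hprod' := (mul_eq_zero.1 hprod).resolve_left (sub_ne_zero.2 (Ne.symm hne))
  have hy0 : y ≠ 0 := ((hx.heckeConj hp hg).ordinary hp).ne_zero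
  refine lt_of_le_of_ne ?_ hy0
  by_contra h
  have : 0 < (V 1 0 : ℝ) * (x * y) := mul_pos hc' (mul_pos hpos (not_le.1 h))
  linarith

/-! ### Hyperbolic classes -/

omit hp hg in
/-- The equivalence class of the form associated with `x`. -/
def formClass (p : ℕ) (g : Ideal (Zlam p) → Zlam p) (x : ℝ) : Set (Form p) :=
  {Q | Q.IsBQF ∧ (formOf p g x).Equivalent Q}

lemma formOf_mem_formClass {x y : ℝ} (hx : IsHyperbolicPoint p x) (hy : IsHyperbolicPoint p y) :
    formOf p g y ∈ formClass p g x ↔ PointEquiv p x y := by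
  constructor
  · rintro ⟨-, V, hV, h⟩
    refine ⟨V⁻¹, inv_mem hV, ?_⟩
    rw [← formOf_act_inv hp hg hx hV] at h
    exact formOf_injective hp hg hy (hx.act hp (inv_mem hV)) h
  · rintro ⟨V, hV, rfl⟩
    exact ⟨formOf_isBQF hp hg hy, V⁻¹, inv_mem hV, formOf_act hp hg hx hV⟩

lemma mem_cycleOf_formClass {x y : ℝ} (hx : IsHyperbolicPoint p x) :
    y ∈ cycleOf p g (formClass p g x) ↔ IsSimplePoint p g y ∧ PointEquiv p x y := by
  constructor
  · rintro ⟨h1, h2, h3⟩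
    exact ⟨⟨h1, (formOf_isSimple_iff hp hg h1).1 h3⟩, (formOf_mem_formClass hp hg hx h1).1 h2⟩
  · rintro ⟨⟨h1, h2⟩, h3⟩
    exact ⟨h1, (formOf_mem_formClass hp hg hx h1).2 h3, (formOf_isSimple_iff hp hg h1).2 h2⟩

/-- A class satisfies `-𝒜 = 𝒜` if and only if its points are equivalent to their conjugates. -/
lemma negClass_formClass {x : ℝ} (hx : IsHyperbolicPoint p x) :
    negClass (formClass p g x) = formClass p g x ↔ PointEquiv p x (heckeConj p g x) := by
  have hx' := hx.heckeConj hp hg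
  constructor
  · intro h
    rw [← formOf_mem_formClass hp hg hx hx', ← h]
    exact ⟨formOf p g x, (formOf_mem_formClass hp hg hx hx).2 (PointEquiv.refl x),
      formOf_heckeConj hp hg hx⟩
  · rintro ⟨N, hN, h⟩
    have key : ∀ Q ∈ formClass p g x, -Q ∈ formClass p g x := by
      rintro Q ⟨⟨h1, h2⟩, V, hV, rfl⟩
      refine ⟨⟨by rwa [Form.disc_neg], fun hP => by rw [Form.content_neg]; exact h2 hP⟩,
        N⁻¹ * V, mul_mem (inv_mem hN) hV, ?_⟩
      rw [Form.comp_mul, ← formOf_act hp hg hx hN, ← h, formOf_heckeConj hp hg hx, Form.neg_comp]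
    ext Q
    constructor
    · rintro ⟨Q, hQ, rfl⟩
      exact key Q hQ
    · intro hQ
      exact ⟨-Q, key Q hQ, (Form.neg_neg' Q).symm⟩

lemma finite_cycleOf_formClass {x : ℝ} (hx : IsHyperbolicPoint p x) :
    (cycleOf p g (formClass p g x)).Finite := by
  rcases (cycleOf p g (formClass p g x)).eq_empty_or_nonempty with h | ⟨y, hy⟩
  · rw [h]; exact Set.finite_empty
  · rw [mem_cycleOf_formClass hp hg hx] at hy
    obtain ⟨r, hr, hper⟩ := hy.1.periodic hp hg
    refine (finite_of_periodic hr hper).subset ?_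
    intro z hz
    rw [mem_cycleOf_formClass hp hg hx] at hz
    have ho := hx.ordinary hp
    exact hy.1.exists_iterate_eq hp hg hz.1
      ((hy.2.symm ho).trans (hy.1.1.ordinary hp) hz.2)

end

/-! ### The slash operator -/

/-- A nonconstant rational function is transcendental over `ℂ`. -/
lemma eval₂_ne_zero_of_ne_C {r : RatFunc ℂ} (hr : ∀ c, r ≠ RatFunc.C c) {a : Polynomial ℂ}
    (ha : a ≠ 0) : a.eval₂ RatFunc.C r ≠ 0 := by
  intro h
  rw [(IsAlgClosed.splits a).eq_prod_roots, Polynomial.eval₂_mul, Polynomial.eval₂_C,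
    ← Polynomial.coe_eval₂RingHom, map_multiset_prod, mul_eq_zero] at h
  rcases h with h | h
  · rw [map_eq_zero, Polynomial.leadingCoeff_eq_zero] at h
    exact ha h
  · rw [Multiset.prod_eq_zero_iff, Multiset.map_map, Multiset.mem_map] at h
    obtain ⟨c, -, hc⟩ := h
    simp only [Function.comp_apply, Polynomial.coe_eval₂RingHom, Polynomial.eval₂_sub,
      Polynomial.eval₂_X, Polynomial.eval₂_C, sub_eq_zero] at hc
    exact hr c hc

/-- Substitution of a nonconstant rational function, as an endomorphism of the field of rational
functions. -/
noncomputable def substHom (r : RatFunc ℂ) (hr : ∀ c, r ≠ RatFunc.C c) :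
    RatFunc ℂ →+* RatFunc ℂ where
  toFun := RatFunc.eval RatFunc.C r
  map_one' := RatFunc.eval_one ..
  map_zero' := RatFunc.eval_zero ..
  map_add' f g := RatFunc.eval_add _ _ (eval₂_ne_zero_of_ne_C hr f.denom_ne_zero)
    (eval₂_ne_zero_of_ne_C hr g.denom_ne_zero)
  map_mul' f g := RatFunc.eval_mul _ _ (eval₂_ne_zero_of_ne_C hr f.denom_ne_zero)
    (eval₂_ne_zero_of_ne_C hr g.denom_ne_zero)

lemma substHom_C (r : RatFunc ℂ) (hr : ∀ c, r ≠ RatFunc.C c) (c : ℂ) :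
    substHom r hr (RatFunc.C c) = RatFunc.C c := RatFunc.eval_C ..

lemma substHom_X (r : RatFunc ℂ) (hr : ∀ c, r ≠ RatFunc.C c) :
    substHom r hr RatFunc.X = r := RatFunc.eval_X ..

lemma substHom_algebraMap (r : RatFunc ℂ) (hr : ∀ c, r ≠ RatFunc.C c) (a : Polynomial ℂ) :
    substHom r hr (algebraMap _ _ a) = a.eval₂ RatFunc.C r := RatFunc.eval_algebraMap ..

lemma ringHom_ext_C_X {φ ψ : RatFunc ℂ →+* RatFunc ℂ}
    (hC : ∀ c, φ (RatFunc.C c) = ψ (RatFunc.C c)) (hX : φ RatFunc.X = ψ RatFunc.X) : φ = ψ := by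
  refine IsFractionRing.ringHom_ext (A := Polynomial ℂ) fun a => ?_
  induction a using Polynomial.induction_on' with
  | add a b ha hb => simp only [map_add, ha, hb]
  | monomial n c => simp only [RatFunc.algebraMap_monomial, map_mul, map_pow, hC, hX]

/-- The denominator `c X + d` of a linear fractional transformation. -/
noncomputable def denX (M : SL(2, ℝ)) : RatFunc ℂ :=
  RatFunc.C (M 1 0 : ℂ) * RatFunc.X + RatFunc.C (M 1 1 : ℂ)

/-- The numerator `a X + b` of a linear fractional transformation. -/
noncomputable def numX (M : SL(2, ℝ)) : RatFunc ℂ :=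
  RatFunc.C (M 0 0 : ℂ) * RatFunc.X + RatFunc.C (M 0 1 : ℂ)

lemma linear_eq_zero {a b : ℂ} (h : RatFunc.C a * RatFunc.X + RatFunc.C b = 0) :
    a = 0 ∧ b = 0 := by
  have h' : algebraMap (Polynomial ℂ) (RatFunc ℂ)
      (Polynomial.C a * Polynomial.X + Polynomial.C b) = 0 := by
    simpa [RatFunc.algebraMap_C, RatFunc.algebraMap_X] using h
  have h'' := (map_eq_zero_iff _ (RatFunc.algebraMap_injective ℂ)).1 h'
  constructor
  · simpa using congrArg (fun q => Polynomial.coeff q 1) h''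
  · simpa using congrArg (fun q => Polynomial.coeff q 0) h''

lemma det_eq_complex (M : SL(2, ℝ)) :
    (M 0 0 : ℂ) * (M 1 1 : ℂ) - (M 0 1 : ℂ) * (M 1 0 : ℂ) = 1 := by
  have := M.det_coe
  rw [Matrix.det_fin_two] at this
  exact_mod_cast this

lemma denX_ne_zero (M : SL(2, ℝ)) : denX M ≠ 0 := by
  intro h
  obtain ⟨h1, h2⟩ := linear_eq_zero h
  have := det_eq_complex M
  rw [h1, h2] at this
  simp at this

lemma numX_div_denX_ne_C (M : SL(2, ℝ)) (c : ℂ) : numX M / denX M ≠ RatFunc.C c := by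
  intro h
  rw [div_eq_iff (denX_ne_zero M)] at h
  have h' : RatFunc.C ((M 0 0 : ℂ) - c * (M 1 0 : ℂ)) * RatFunc.X +
      RatFunc.C ((M 0 1 : ℂ) - c * (M 1 1 : ℂ)) = 0 := by
    rw [numX, denX] at h
    simp only [map_sub, map_mul]
    linear_combination h
  obtain ⟨h1, h2⟩ := linear_eq_zero h'
  have := det_eq_complex M
  have h3 : (0 : ℂ) = 1 := by linear_combination this - (M 1 1 : ℂ) * h1 + (M 1 0 : ℂ) * h2
  exact zero_ne_one h3

/-- The substitution `f(X) ↦ f((a X + b) / (c X + d))`. -/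
noncomputable def moebHom (M : SL(2, ℝ)) : RatFunc ℂ →+* RatFunc ℂ :=
  substHom (numX M / denX M) (numX_div_denX_ne_C M)

lemma slash_eq (k : ℕ) (f : RatFunc ℂ) (M : SL(2, ℝ)) :
    slash k f M = (denX M ^ (2 * k))⁻¹ * moebHom M f := rfl

lemma slash_add (k : ℕ) (f g : RatFunc ℂ) (M : SL(2, ℝ)) :
    slash k (f + g) M = slash k f M + slash k g M := by
  simp only [slash_eq, map_add, mul_add]

lemma slash_sub (k : ℕ) (f g : RatFunc ℂ) (M : SL(2, ℝ)) :
    slash k (f - g) M = slash k f M - slash k g M := by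
  simp only [slash_eq, map_sub, mul_sub]

lemma slash_C_mul (k : ℕ) (c : ℂ) (f : RatFunc ℂ) (M : SL(2, ℝ)) :
    slash k (RatFunc.C c * f) M = RatFunc.C c * slash k f M := by
  simp only [slash_eq, map_mul, moebHom, substHom_C]
  ring

lemma slash_sum {ι : Type*} (k : ℕ) (s : Finset ι) (f : ι → RatFunc ℂ) (M : SL(2, ℝ)) :
    slash k (∑ i ∈ s, f i) M = ∑ i ∈ s, slash k (f i) M := by
  simp only [slash_eq, map_sum, Finset.mul_sum]

lemma moebHom_linear (M : SL(2, ℝ)) (a b : ℂ) :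
    moebHom M (RatFunc.C a * RatFunc.X + RatFunc.C b) =
      (RatFunc.C a * numX M + RatFunc.C b * denX M) / denX M := by
  have := denX_ne_zero M
  simp only [map_add, map_mul, moebHom, substHom_C, substHom_X]
  field_simp

lemma mul_apply_real (M N : SL(2, ℝ)) (i j : Fin 2) :
    (((M * N) i j : ℝ) : ℂ) = (M i 0 : ℂ) * (N 0 j : ℂ) + (M i 1 : ℂ) * (N 1 j : ℂ) := by
  simp [Matrix.mul_apply, Fin.sum_univ_two]

lemma moebHom_denX (M N : SL(2, ℝ)) : moebHom N (denX M) = denX (M * N) / denX N := by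
  rw [denX, moebHom_linear]
  congr 1
  simp only [denX, numX, mul_apply_real, map_add, map_mul]
  ring

lemma moebHom_numX (M N : SL(2, ℝ)) : moebHom N (numX M) = numX (M * N) / denX N := by
  rw [numX, moebHom_linear]
  congr 1
  simp only [denX, numX, mul_apply_real, map_add, map_mul]
  ring

lemma moebHom_comp (M N : SL(2, ℝ)) : (moebHom N).comp (moebHom M) = moebHom (M * N) := by
  apply ringHom_ext_C_X
  · intro c
    simp only [RingHom.comp_apply, moebHom, substHom_C]
  · have h1 : moebHom M RatFunc.X = numX M / denX M := substHom_X ..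
    have h2 : moebHom (M * N) RatFunc.X = numX (M * N) / denX (M * N) := substHom_X ..
    rw [RingHom.comp_apply, h1, h2, map_div₀, moebHom_denX, moebHom_numX,
      div_div_div_cancel_right₀ (denX_ne_zero N)]

lemma slash_mul (k : ℕ) (f : RatFunc ℂ) (M N : SL(2, ℝ)) :
    slash k f (M * N) = slash k (slash k f M) N := by
  have hN := denX_ne_zero N
  have hMN := denX_ne_zero (M * N)
  rw [slash_eq, slash_eq, slash_eq, map_mul, map_inv₀, map_pow, moebHom_denX, ← moebHom_comp,
    RingHom.comp_apply, div_pow]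
  field_simp

lemma slash_one (k : ℕ) (f : RatFunc ℂ) : slash k f 1 = f := by
  have h1 : denX 1 = 1 := by simp [denX]
  have h2 : moebHom 1 = RingHom.id _ := by
    apply ringHom_ext_C_X
    · intro c; simp [moebHom, substHom_C]
    · have : moebHom 1 RatFunc.X = numX 1 / denX 1 := substHom_X ..
      rw [this, h1]; simp [numX]
  rw [slash_eq, h1, h2]
  simp

lemma slash_neg_matrix (k : ℕ) (f : RatFunc ℂ) (M : SL(2, ℝ)) : slash k f (-M) = slash k f M := by
  have h1 : denX (-M) = -denX M := by simp [denX]; ring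
  have h2 : moebHom (-M) = moebHom M := by
    apply ringHom_ext_C_X
    · intro c; simp [moebHom, substHom_C]
    · have e1 : moebHom (-M) RatFunc.X = numX (-M) / denX (-M) := substHom_X ..
      have e2 : moebHom M RatFunc.X = numX M / denX M := substHom_X ..
      have h3 : numX (-M) = -numX M := by simp [numX]; ring
      rw [e1, e2, h1, h3]
      exact neg_div_neg_eq _ _
  rw [slash_eq, slash_eq, h1, h2, (even_two_mul k).neg_pow]

/-- The slash operator of an element of `SL(2, ℤ[λ_p])`. -/
noncomputable def slashZ (k : ℕ) (f : RatFunc ℂ) (M : SL(2, Zlam p)) : RatFunc ℂ :=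
  slash k f (toReal p M)

lemma toReal_apply (M : SL(2, Zlam p)) (i j : Fin 2) : toReal p M i j = (M i j : ℝ) := rfl

lemma slashZ_mul (k : ℕ) (f : RatFunc ℂ) (M N : SL(2, Zlam p)) :
    slashZ k f (M * N) = slashZ k (slashZ k f M) N := by
  rw [slashZ, map_mul, slash_mul]; rfl

lemma slashZ_one (k : ℕ) (f : RatFunc ℂ) : slashZ k f (1 : SL(2, Zlam p)) = f := by
  rw [slashZ, map_one, slash_one]

lemma toReal_neg (M : SL(2, Zlam p)) : toReal p (-M) = -toReal p M := by
  ext i j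
  simp [toReal_apply]

lemma SignEq.slashZ {M N : SL(2, Zlam p)} (h : SignEq M N) (k : ℕ) (f : RatFunc ℂ) :
    HeckeRPF.slashZ k f M = HeckeRPF.slashZ k f N := by
  rcases h with rfl | rfl
  · rfl
  · rw [HeckeRPF.slashZ, toReal_neg, slash_neg_matrix]; rfl

lemma isRPF_iff (hp : 3 ≤ p) (k : ℕ) (q : RatFunc ℂ) :
    IsRPF p k q ↔ slashZ k q (T p) = -q ∧ ∑ n ∈ Finset.range p, slashZ k q (U p ^ n) = 0 := by
  rw [IsRPF]
  refine and_congr ⟨fun h => eq_neg_of_add_eq_zero_right h, fun h => ?_⟩ ?_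
  · rw [slashZ] at h
    rw [h, add_neg_cancel]
  · have : ∑ n ∈ Finset.range p, slashZ k q (U p ^ n) =
        q + ∑ n ∈ Finset.Icc 1 (p - 1), slash k q (toReal p (U p ^ n)) := by
      rw [Finset.range_eq_Ico, Finset.sum_eq_sum_Ico_succ_bot (by omega), pow_zero, slashZ_one]
      refine congrArg (q + ·) (Finset.sum_congr ?_ fun _ _ => rfl)
      ext n
      simp only [Finset.mem_Ico, Finset.mem_Icc]
      omega
    rw [this]

lemma IsRPF.add (hp : 3 ≤ p) {k : ℕ} {q q' : RatFunc ℂ} (h : IsRPF p k q) (h' : IsRPF p k q') :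
    IsRPF p k (q + q') := by
  rw [isRPF_iff hp] at *
  simp only [slashZ, slash_add, Finset.sum_add_distrib] at *
  rw [h.1, h.2, h'.1, h'.2]
  exact ⟨by ring, by ring⟩

lemma IsRPF.C_mul (hp : 3 ≤ p) {k : ℕ} {q : RatFunc ℂ} (h : IsRPF p k q) (c : ℂ) :
    IsRPF p k (RatFunc.C c * q) := by
  rw [isRPF_iff hp] at *
  simp only [slashZ, slash_C_mul, ← Finset.mul_sum] at *
  rw [h.1, h.2]
  exact ⟨by ring, by ring⟩

lemma IsRPF.zero (hp : 3 ≤ p) (k : ℕ) : IsRPF p k 0 := by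
  rw [isRPF_iff hp]
  simp [slashZ, slash_eq]

lemma IsRPF.sum (hp : 3 ≤ p) {k : ℕ} {ι : Type*} (s : Finset ι) {f : ι → RatFunc ℂ}
    (h : ∀ i ∈ s, IsRPF p k (f i)) : IsRPF p k (∑ i ∈ s, f i) := by
  classical
  induction s using Finset.induction_on with
  | empty => simpa using IsRPF.zero hp k
  | insert a s ha ih =>
    rw [Finset.sum_insert ha]
    exact (h a (by simp)).add hp (ih fun i hi => h i (by simp [hi]))

lemma moebHom_ratFunc (Q : Form p) (M : SL(2, Zlam p)) :
    moebHom (toReal p M) Q.ratFunc = (Q.comp M).ratFunc / denX (toReal p M) ^ 2 := by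
  have h := denX_ne_zero (toReal p M)
  have h1 : moebHom (toReal p M) RatFunc.X = numX (toReal p M) / denX (toReal p M) :=
    substHom_X ..
  have hC : ∀ c, moebHom (toReal p M) (RatFunc.C c) = RatFunc.C c := fun c => substHom_C ..
  rw [Form.ratFunc, map_add, map_add, map_mul, map_mul, map_pow, h1, hC, hC, hC, eq_div_iff
    (pow_ne_zero 2 h)]
  have e : (RatFunc.C ((Q.A : ℝ) : ℂ) * (numX (toReal p M) / denX (toReal p M)) ^ 2 +
      RatFunc.C ((Q.B : ℝ) : ℂ) * (numX (toReal p M) / denX (toReal p M)) +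
      RatFunc.C ((Q.C : ℝ) : ℂ)) * denX (toReal p M) ^ 2 =
      RatFunc.C ((Q.A : ℝ) : ℂ) * numX (toReal p M) ^ 2 +
      RatFunc.C ((Q.B : ℝ) : ℂ) * (numX (toReal p M) * denX (toReal p M)) +
      RatFunc.C ((Q.C : ℝ) : ℂ) * denX (toReal p M) ^ 2 := by
    field_simp
  rw [e, Form.ratFunc, numX, denX]
  simp only [toReal_apply, Form.comp]
  push_cast [coe_two]
  simp only [map_add, map_mul, map_pow, map_ofNat]
  ring

/-- The weight `2 k` action on `Q(z, 1) ^ (-k)` is the action on the form `Q`. -/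
lemma slashZ_form (k : ℕ) (Q : Form p) (M : SL(2, Zlam p)) :
    slashZ k (Q.ratFunc ^ k)⁻¹ M = ((Q.comp M).ratFunc ^ k)⁻¹ := by
  have h := denX_ne_zero (toReal p M)
  rw [slashZ, slash_eq, map_inv₀, map_pow, moebHom_ratFunc, div_pow, inv_div, ← pow_mul]
  field_simp

lemma ratFunc_neg (Q : Form p) : (-Q).ratFunc = -Q.ratFunc := by
  simp only [Form.ratFunc, Form.neg_A, Form.neg_B, Form.neg_C]
  push_cast
  simp only [map_neg]
  ring

/-! ### Regular rational functions and their values -/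

/-- The rational function `f` has no pole at `z`. -/
def RegAt (z : ℂ) (f : RatFunc ℂ) : Prop := f.denom.eval z ≠ 0

/-- The value of a rational function at `z`; it is meaningful if `f` is regular at `z`. -/
noncomputable def valAt (z : ℂ) (f : RatFunc ℂ) : ℂ := f.eval (RingHom.id ℂ) z

lemma regAt_div {z : ℂ} {a b : Polynomial ℂ} (hb : b.eval z ≠ 0) :
    RegAt z (algebraMap _ _ a / algebraMap _ _ b) := by
  have hb0 : b ≠ 0 := by rintro rfl; simp at hb
  obtain ⟨c, hc⟩ := (RatFunc.denom_dvd hb0).2 ⟨a, rfl⟩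
  intro h
  rw [hc, Polynomial.eval_mul, h, zero_mul] at hb
  exact hb rfl

lemma RegAt.add {z : ℂ} {f g : RatFunc ℂ} (hf : RegAt z f) (hg : RegAt z g) : RegAt z (f + g) := by
  obtain ⟨c, hc⟩ := RatFunc.denom_add_dvd f g
  intro h
  have : (f.denom * g.denom).eval z = 0 := by rw [hc, Polynomial.eval_mul, h, zero_mul]
  rw [Polynomial.eval_mul] at this
  exact mul_ne_zero hf hg this

lemma RegAt.mul {z : ℂ} {f g : RatFunc ℂ} (hf : RegAt z f) (hg : RegAt z g) : RegAt z (f * g) := by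
  obtain ⟨c, hc⟩ := RatFunc.denom_mul_dvd f g
  intro h
  have : (f.denom * g.denom).eval z = 0 := by rw [hc, Polynomial.eval_mul, h, zero_mul]
  rw [Polynomial.eval_mul] at this
  exact mul_ne_zero hf hg this

lemma regAt_poly (z : ℂ) (a : Polynomial ℂ) : RegAt z (algebraMap _ _ a) := by
  rw [RegAt, RatFunc.denom_algebraMap]; simp

lemma regAt_C (z c : ℂ) : RegAt z (RatFunc.C c) := by
  rw [RegAt, RatFunc.denom_C]; simp

lemma regAt_X (z : ℂ) : RegAt z RatFunc.X := by
  rw [RegAt, RatFunc.denom_X]; simp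

lemma RegAt.neg {z : ℂ} {f : RatFunc ℂ} (hf : RegAt z f) : RegAt z (-f) := by
  simpa using (regAt_C z (-1)).mul hf

lemma RegAt.sub {z : ℂ} {f g : RatFunc ℂ} (hf : RegAt z f) (hg : RegAt z g) : RegAt z (f - g) := by
  rw [sub_eq_add_neg]; exact hf.add hg.neg

lemma RegAt.pow {z : ℂ} {f : RatFunc ℂ} (hf : RegAt z f) (n : ℕ) : RegAt z (f ^ n) := by
  induction n with
  | zero => simpa using regAt_C z 1
  | succ n ih => rw [pow_succ]; exact ih.mul hf

lemma RegAt.sum {ι : Type*} {z : ℂ} (s : Finset ι) {f : ι → RatFunc ℂ}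
    (h : ∀ i ∈ s, RegAt z (f i)) : RegAt z (∑ i ∈ s, f i) := by
  classical
  induction s using Finset.induction_on with
  | empty => simpa using regAt_C z 0
  | insert a s ha ih =>
    rw [Finset.sum_insert ha]
    exact (h a (by simp)).add (ih fun i hi => h i (by simp [hi]))

lemma valAt_add {z : ℂ} {f g : RatFunc ℂ} (hf : RegAt z f) (hg : RegAt z g) :
    valAt z (f + g) = valAt z f + valAt z g := RatFunc.eval_add _ _ hf hg

lemma valAt_mul {z : ℂ} {f g : RatFunc ℂ} (hf : RegAt z f) (hg : RegAt z g) :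
    valAt z (f * g) = valAt z f * valAt z g := RatFunc.eval_mul _ _ hf hg

@[simp] lemma valAt_C (z c : ℂ) : valAt z (RatFunc.C c) = c := RatFunc.eval_C ..

@[simp] lemma valAt_X (z : ℂ) : valAt z RatFunc.X = z := RatFunc.eval_X ..

lemma valAt_neg {z : ℂ} {f : RatFunc ℂ} (hf : RegAt z f) : valAt z (-f) = -valAt z f := by
  have h := valAt_mul (regAt_C z (-1)) hf
  rw [valAt_C] at h
  simpa using h

lemma valAt_sub {z : ℂ} {f g : RatFunc ℂ} (hf : RegAt z f) (hg : RegAt z g) :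
    valAt z (f - g) = valAt z f - valAt z g := by
  rw [sub_eq_add_neg, valAt_add hf hg.neg, valAt_neg hg, sub_eq_add_neg]

lemma valAt_pow {z : ℂ} {f : RatFunc ℂ} (hf : RegAt z f) (n : ℕ) :
    valAt z (f ^ n) = valAt z f ^ n := by
  induction n with
  | zero => simpa using valAt_C z 1
  | succ n ih => rw [pow_succ, valAt_mul (hf.pow n) hf, ih, pow_succ]

lemma valAt_poly (z : ℂ) (a : Polynomial ℂ) : valAt z (algebraMap _ _ a) = a.eval z :=
  RatFunc.eval_algebraMap ..

lemma RegAt.inv {z : ℂ} {f : RatFunc ℂ} (h0 : valAt z f ≠ 0) : RegAt z f⁻¹ := by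
  have hn : f.num.eval z ≠ 0 := by
    intro h
    apply h0
    rw [valAt, RatFunc.eval, ← Polynomial.eval, h, zero_div]
  rw [← RatFunc.num_div_denom f, inv_div]
  exact regAt_div hn

lemma valAt_inv {z : ℂ} {f : RatFunc ℂ} (hf : RegAt z f) (h0 : valAt z f ≠ 0) :
    valAt z f⁻¹ = (valAt z f)⁻¹ := by
  have hf0 : f ≠ 0 := by
    rintro rfl
    apply h0
    rw [← map_zero RatFunc.C, valAt_C]
  apply eq_inv_of_mul_eq_one_left
  rw [← valAt_mul (RegAt.inv h0) hf, inv_mul_cancel₀ hf0, ← map_one RatFunc.C, valAt_C]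

lemma RegAt.exists_eq_mul {z : ℂ} {f : RatFunc ℂ} (hf : RegAt z f) (h0 : valAt z f = 0) :
    ∃ h, RegAt z h ∧ f = (RatFunc.X - RatFunc.C z) * h := by
  have hn : f.num.eval z = 0 := by
    rw [valAt, RatFunc.eval, div_eq_zero_iff] at h0
    exact h0.resolve_right hf
  obtain ⟨a, ha⟩ := Polynomial.dvd_iff_isRoot.2 hn
  refine ⟨algebraMap _ _ a / algebraMap _ _ f.denom, regAt_div hf, ?_⟩
  conv_lhs => rw [← RatFunc.num_div_denom f, ha, map_mul, map_sub, RatFunc.algebraMap_X,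
    RatFunc.algebraMap_C]
  rw [mul_div_assoc]

lemma X_sub_C_ne_zero (z : ℂ) : (RatFunc.X - RatFunc.C z : RatFunc ℂ) ≠ 0 := by
  intro h
  have := linear_eq_zero (a := 1) (b := -z) (by simpa [sub_eq_add_neg] using h)
  exact one_ne_zero this.1

lemma valAt_X_sub_C (z w : ℂ) : valAt z (RatFunc.X - RatFunc.C w) = z - w := by
  rw [valAt_sub (regAt_X z) (regAt_C z w), valAt_X, valAt_C]

lemma regAt_X_sub_C (z w : ℂ) : RegAt z (RatFunc.X - RatFunc.C w) := (regAt_X z).sub (regAt_C z w)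

/-- A nonzero rational function is `(X - z) ^ n` times a unit at `z`, for an integer `n`. -/
lemma exists_order {f : RatFunc ℂ} (z : ℂ) (hf : f ≠ 0) :
    ∃ (n : ℤ) (u : RatFunc ℂ), RegAt z u ∧ valAt z u ≠ 0 ∧
      f = (RatFunc.X - RatFunc.C z) ^ n * u := by
  obtain ⟨a, ha, ha'⟩ := Polynomial.exists_eq_pow_rootMultiplicity_mul_and_not_dvd f.num
    (RatFunc.num_ne_zero hf) z
  obtain ⟨b, hb, hb'⟩ := Polynomial.exists_eq_pow_rootMultiplicity_mul_and_not_dvd f.denom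
    f.denom_ne_zero z
  rw [Polynomial.dvd_iff_isRoot, Polynomial.IsRoot] at ha' hb'
  have hX := X_sub_C_ne_zero z
  have hb0 : valAt z (algebraMap _ (RatFunc ℂ) b) ≠ 0 := by rwa [valAt_poly]
  refine ⟨(f.num.rootMultiplicity z : ℤ) - (f.denom.rootMultiplicity z : ℤ),
    algebraMap _ _ a / algebraMap _ _ b, regAt_div hb', ?_, ?_⟩
  · rw [div_eq_mul_inv, valAt_mul (regAt_poly z a) (RegAt.inv hb0), valAt_inv (regAt_poly z b) hb0,
      valAt_poly, valAt_poly]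
    exact mul_ne_zero ha' (inv_ne_zero hb')
  · rw [zpow_sub₀ hX, zpow_natCast, zpow_natCast, div_mul_div_comm]
    conv_lhs => rw [← RatFunc.num_div_denom f, ha, hb]
    simp only [map_mul, map_pow, map_sub, RatFunc.algebraMap_X, RatFunc.algebraMap_C]

lemma RegAt.zpow_mul {z : ℂ} {u : RatFunc ℂ} (hu : RegAt z u) {n : ℤ} (hn : 0 ≤ n) :
    RegAt z ((RatFunc.X - RatFunc.C z) ^ n * u) := by
  obtain ⟨m, rfl⟩ := Int.eq_ofNat_of_zero_le hn
  rw [zpow_natCast]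
  exact ((regAt_X_sub_C z z).pow m).mul hu

/-- A function of negative order has a pole. -/
lemma nonneg_of_regAt {z : ℂ} {u : RatFunc ℂ} (h0 : valAt z u ≠ 0) {n : ℤ}
    (h : RegAt z ((RatFunc.X - RatFunc.C z) ^ n * u)) : 0 ≤ n := by
  by_contra hn
  obtain ⟨m, hm⟩ := Int.eq_ofNat_of_zero_le (show 0 ≤ -n by omega)
  have hX := X_sub_C_ne_zero z
  have e : u = (RatFunc.X - RatFunc.C z) ^ m * ((RatFunc.X - RatFunc.C z) ^ n * u) := by
    rw [← mul_assoc, ← zpow_natCast, ← hm, ← zpow_add₀ hX]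
    simp
  apply h0
  rw [e, valAt_mul ((regAt_X_sub_C z z).pow m) h, valAt_pow (regAt_X_sub_C z z), valAt_X_sub_C,
    sub_self, zero_pow (by omega), zero_mul]

/-! ### Poles under the slash operator -/

lemma regAt_denX (M : SL(2, ℝ)) (z : ℂ) : RegAt z (denX M) :=
  ((regAt_C z _).mul (regAt_X z)).add (regAt_C z _)

lemma valAt_denX (M : SL(2, ℝ)) (z : ℂ) :
    valAt z (denX M) = (M 1 0 : ℂ) * z + (M 1 1 : ℂ) := by
  rw [denX, valAt_add ((regAt_C z _).mul (regAt_X z)) (regAt_C z _), valAt_mul (regAt_C z _)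
    (regAt_X z), valAt_C, valAt_C, valAt_X]

lemma substHom_regular {z w : ℂ} {r : RatFunc ℂ} (hr : ∀ c, r ≠ RatFunc.C c) (hz : RegAt z r)
    (hw : valAt z r = w) {f : RatFunc ℂ} (hf : RegAt w f) :
    RegAt z (substHom r hr f) ∧ valAt z (substHom r hr f) = valAt w f := by
  have poly : ∀ a : Polynomial ℂ, RegAt z (a.eval₂ RatFunc.C r) ∧
      valAt z (a.eval₂ RatFunc.C r) = a.eval w := by
    intro a
    induction a using Polynomial.induction_on' with
    | add a b ha hb =>
      rw [Polynomial.eval₂_add, Polynomial.eval_add]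
      exact ⟨ha.1.add hb.1, by rw [valAt_add ha.1 hb.1, ha.2, hb.2]⟩
    | monomial n c =>
      rw [Polynomial.eval₂_monomial, Polynomial.eval_monomial]
      refine ⟨(regAt_C z c).mul (hz.pow n), ?_⟩
      rw [valAt_mul (regAt_C z c) (hz.pow n), valAt_pow hz, valAt_C, hw]
  have hd : valAt z (f.denom.eval₂ RatFunc.C r) ≠ 0 := by rw [(poly _).2]; exact hf
  have e : substHom r hr f = f.num.eval₂ RatFunc.C r * (f.denom.eval₂ RatFunc.C r)⁻¹ := by
    rw [← div_eq_mul_inv]; rfl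
  rw [e]
  refine ⟨(poly _).1.mul (RegAt.inv hd), ?_⟩
  rw [valAt_mul (poly _).1 (RegAt.inv hd), valAt_inv (poly _).1 hd, (poly _).2, (poly _).2,
    ← div_eq_mul_inv]
  rfl

lemma moebHom_regular {M : SL(2, ℝ)} {z : ℂ} (hd : (M 1 0 : ℂ) * z + (M 1 1 : ℂ) ≠ 0)
    {f : RatFunc ℂ} (hf : RegAt (moebius M z) f) :
    RegAt z (moebHom M f) ∧ valAt z (moebHom M f) = valAt (moebius M z) f := by
  have hn : RegAt z (numX M) := ((regAt_C z _).mul (regAt_X z)).add (regAt_C z _)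
  have hd' : valAt z (denX M) ≠ 0 := by rwa [valAt_denX]
  refine substHom_regular _ ?_ ?_ hf
  · rw [div_eq_mul_inv]
    exact hn.mul (RegAt.inv hd')
  · rw [div_eq_mul_inv, valAt_mul hn (RegAt.inv hd'), valAt_inv (regAt_denX M z) hd', valAt_denX,
      numX, valAt_add ((regAt_C z _).mul (regAt_X z)) (regAt_C z _), valAt_mul (regAt_C z _)
      (regAt_X z), valAt_C, valAt_C, valAt_X, moebius, div_eq_mul_inv]

lemma RegAt.slash {M : SL(2, ℝ)} {z : ℂ} (hd : (M 1 0 : ℂ) * z + (M 1 1 : ℂ) ≠ 0)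
    {f : RatFunc ℂ} (hf : RegAt (moebius M z) f) (k : ℕ) : RegAt z (slash k f M) := by
  rw [slash_eq]
  refine RegAt.mul (RegAt.inv ?_) (moebHom_regular hd hf).1
  rw [valAt_pow (regAt_denX M z), valAt_denX]
  exact pow_ne_zero _ hd

lemma moebius_toReal (M : SL(2, Zlam p)) (x : ℝ) : moebius (toReal p M) x = (act M x : ℂ) := by
  simp only [moebius, act, den, toReal_apply]
  push_cast
  rfl

lemma coe_den (M : SL(2, Zlam p)) (x : ℝ) :
    (toReal p M 1 0 : ℂ) * x + (toReal p M 1 1 : ℂ) = (den M x : ℂ) := by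
  simp only [den, toReal_apply]
  push_cast
  rfl

lemma RegAt.slashZ {M : SL(2, Zlam p)} {x : ℝ} (hd : den M x ≠ 0) {f : RatFunc ℂ}
    (hf : RegAt (act M x : ℝ) f) (k : ℕ) : RegAt (x : ℂ) (slashZ k f M) := by
  refine RegAt.slash ?_ ?_ k
  · rw [coe_den]; exact_mod_cast hd
  · rwa [moebius_toReal]

lemma regAt_of_not_mem {q : RatFunc ℂ} {z : ℂ} (h : z ∉ nonzeroPoles q) (hz : z ≠ 0) :
    RegAt z q := fun h' => h ⟨h', hz⟩

lemma not_mem_of_regAt {q : RatFunc ℂ} {z : ℂ} (h : RegAt z q) : z ∉ nonzeroPoles q :=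
  fun h' => h h'.1

lemma finite_nonzeroPoles (q : RatFunc ℂ) : (nonzeroPoles q).Finite := by
  refine (q.denom.rootSet_finite ℂ).subset ?_
  rintro z ⟨h, -⟩
  rw [Polynomial.mem_rootSet]
  exact ⟨q.denom_ne_zero, by simpa using h⟩

/-- If `f - f ∣ M` is regular at a fixed point of `M` that is not parabolic, then the order of a
pole of `f` there is `k`: comparison of leading coefficients shows that `n`-th order poles need
`(c α + d) ^ (2 k) = (c α + d) ^ (2 n)`. -/
lemma order_eq_of_sub_slash_regular {M : SL(2, Zlam p)} {x : ℝ} {k : ℕ} (hd : den M x ≠ 0)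
    (hd1 : |den M x| ≠ 1) (hfix : act M x = x) {f u : RatFunc ℂ} {n : ℤ} (hu : RegAt (x : ℂ) u)
    (hu0 : valAt (x : ℂ) u ≠ 0) (hf : f = (RatFunc.X - RatFunc.C (x : ℂ)) ^ n * u) (hn : n < 0)
    (h : RegAt (x : ℂ) (f - slashZ k f M)) : n = -k := by
  set R := toReal p M
  set δ : ℂ := (den M x : ℂ) with hδ
  have hδ0 : δ ≠ 0 := by rw [hδ]; exact_mod_cast hd
  have hdX := denX_ne_zero R
  have hXc := X_sub_C_ne_zero (x : ℂ)
  have hdreg := regAt_denX R (x : ℂ)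
  have hdval : valAt (x : ℂ) (denX R) = δ := by rw [valAt_denX, coe_den]
  have hmo : moebius R (x : ℂ) = x := by rw [moebius_toReal, hfix]
  -- `M X - α = (X - α) / ((c X + d) (c α + d))`
  have hlin : moebHom R (RatFunc.X - RatFunc.C (x : ℂ)) =
      (RatFunc.X - RatFunc.C (x : ℂ)) * (denX R * RatFunc.C δ)⁻¹ := by
    have h1 : moebHom R RatFunc.X = numX R / denX R := substHom_X ..
    have h2 : moebHom R (RatFunc.C (x : ℂ)) = RatFunc.C (x : ℂ) := substHom_C ..
    have hCδ : RatFunc.C δ ≠ 0 := by simpa using hδ0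
    rw [map_sub, h1, h2, eq_mul_inv_iff_mul_eq₀ (mul_ne_zero hdX hCδ)]
    have e : (numX R / denX R - RatFunc.C (x : ℂ)) * (denX R * RatFunc.C δ) =
        (numX R - RatFunc.C (x : ℂ) * denX R) * RatFunc.C δ := by field_simp
    have hfix' : (R 0 0 : ℂ) * x + (R 0 1 : ℂ) = x * δ := by
      have := act_num M hd
      rw [hfix] at this
      simp only [R, toReal_apply, hδ]
      exact_mod_cast this
    have hδ' : (R 1 0 : ℂ) * x + (R 1 1 : ℂ) = δ := coe_den M x
    have hdet := det_eq_complex R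
    have hinv : ((R 0 0 : ℂ) - x * (R 1 0 : ℂ)) * δ = 1 := by
      linear_combination hdet + (R 1 0 : ℂ) * hfix' - (R 0 0 : ℂ) * hδ'
    have hconst : ((R 0 1 : ℂ) - x * (R 1 1 : ℂ)) * δ = -x := by
      linear_combination (-(x : ℂ)) * hdet + (R 1 1 : ℂ) * hfix' - (R 0 1 : ℂ) * hδ'
    rw [e, numX, denX]
    have e2 : (RatFunc.C (R 0 0 : ℂ) * RatFunc.X + RatFunc.C (R 0 1 : ℂ) -
        RatFunc.C (x : ℂ) * (RatFunc.C (R 1 0 : ℂ) * RatFunc.X + RatFunc.C (R 1 1 : ℂ))) *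
          RatFunc.C δ = RatFunc.C (((R 0 0 : ℂ) - x * (R 1 0 : ℂ)) * δ) * RatFunc.X +
          RatFunc.C (((R 0 1 : ℂ) - x * (R 1 1 : ℂ)) * δ) := by
      simp only [map_sub, map_mul]; ring
    rw [e2, hinv, hconst, map_one, map_neg]
    ring
  obtain ⟨hMu, hMu0⟩ := moebHom_regular (M := R) (z := x) (f := u)
    (by rw [coe_den]; exact hδ0) (by rwa [hmo])
  rw [hmo] at hMu0
  set t : RatFunc ℂ := (denX R ^ (2 * k))⁻¹ * ((denX R * RatFunc.C δ)⁻¹) ^ n * moebHom R u with ht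
  have hslash : f - slashZ k f M = (RatFunc.X - RatFunc.C (x : ℂ)) ^ n * (u - t) := by
    rw [slashZ, slash_eq, hf, map_mul, map_zpow₀, hlin, mul_zpow, ht]
    ring
  obtain ⟨m, hm⟩ := Int.eq_ofNat_of_zero_le (show 0 ≤ -n by omega)
  have ht' : t = (denX R ^ (2 * k))⁻¹ * (denX R * RatFunc.C δ) ^ m * moebHom R u := by
    rw [ht, inv_zpow, ← zpow_neg, hm, zpow_natCast]
  have hpow0 : valAt (x : ℂ) (denX R ^ (2 * k)) ≠ 0 := by
    rw [valAt_pow hdreg, hdval]; exact pow_ne_zero _ hδ0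
  have hreg2 : RegAt (x : ℂ) ((denX R * RatFunc.C δ) ^ m) := (hdreg.mul (regAt_C _ _)).pow m
  have htreg : RegAt (x : ℂ) t := by
    rw [ht']
    exact ((RegAt.inv hpow0).mul hreg2).mul hMu
  have htval : valAt (x : ℂ) t = (δ ^ (2 * k))⁻¹ * δ ^ (2 * m) * valAt (x : ℂ) u := by
    rw [ht', valAt_mul ((RegAt.inv hpow0).mul hreg2) hMu, valAt_mul (RegAt.inv hpow0) hreg2,
      valAt_inv (hdreg.pow _) hpow0, valAt_pow hdreg, valAt_pow (hdreg.mul (regAt_C _ _)),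
      valAt_mul hdreg (regAt_C _ _), valAt_C, hdval, hMu0, ← sq, ← pow_mul]
  have hval : valAt (x : ℂ) (u - t) = 0 := by
    by_contra hne
    rw [hslash] at h
    have := nonneg_of_regAt hne h
    omega
  rw [valAt_sub hu htreg, htval, sub_eq_zero] at hval
  have h1 : (δ ^ (2 * k))⁻¹ * δ ^ (2 * m) = 1 := by
    apply mul_right_cancel₀ hu0
    rw [one_mul]
    exact hval.symm
  rw [inv_mul_eq_one₀ (pow_ne_zero _ hδ0)] at h1
  have h2 : |den M x| ^ (2 * k) = |den M x| ^ (2 * m) := by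
    rw [hδ] at h1
    rw [← abs_pow, ← abs_pow]
    congr 1
    exact_mod_cast h1
  have := pow_right_injective₀ (abs_pos.2 hd) hd1 h2
  omega

/-! ### The rational period functions with a pole at zero only -/

lemma denX_T : denX (toReal p (T p)) = RatFunc.X := by
  obtain ⟨_, t3, t4⟩ := T_apply (p := p)
  simp [denX, toReal_apply, t3, t4]

lemma moebHom_T_X : moebHom (toReal p (T p)) RatFunc.X = -RatFunc.X⁻¹ := by
  obtain ⟨⟨t1, t2⟩, _⟩ := T_apply (p := p)
  have h : moebHom (toReal p (T p)) RatFunc.X =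
    numX (toReal p (T p)) / denX (toReal p (T p)) := substHom_X ..
  rw [h, denX_T]
  simp [numX, toReal_apply, t1, t2, div_eq_mul_inv]

lemma moebHom_C (M : SL(2, ℝ)) (c : ℂ) : moebHom M (RatFunc.C c) = RatFunc.C c := substHom_C ..

lemma denX_S : denX (toReal p (S p)) = 1 := by
  obtain ⟨_, s3, s4⟩ := S_apply (p := p)
  simp [denX, toReal_apply, s3, s4]

lemma moebHom_S_X : moebHom (toReal p (S p)) RatFunc.X = RatFunc.X + RatFunc.C (lam p : ℂ) := by
  obtain ⟨⟨s1, s2⟩, _⟩ := S_apply (p := p)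
  have h : moebHom (toReal p (S p)) RatFunc.X =
    numX (toReal p (S p)) / denX (toReal p (S p)) := substHom_X ..
  rw [h, denX_S]
  simp [numX, toReal_apply, s1, s2, coe_lamZ]

lemma slashZ_T (k : ℕ) (f : RatFunc ℂ) :
    slashZ k f (T p) = (RatFunc.X ^ (2 * k))⁻¹ * moebHom (toReal p (T p)) f := by
  rw [slashZ, slash_eq, denX_T]

/-- `1 - z ^ (-2 k) = 1 - 1 ∣ T` is a rational period function, since the sum in the second
relation telescopes in view of `1 ∣ T = 1 ∣ U`. -/
lemma isRPF_one_sub (hp : 3 ≤ p) (k : ℕ) : IsRPF p k (1 - (RatFunc.X ^ (2 * k))⁻¹) := by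
  have h1 : (1 - (RatFunc.X ^ (2 * k))⁻¹ : RatFunc ℂ) = 1 - slashZ k 1 (T p) := by
    rw [slashZ_T, map_one, mul_one]
  have hsub : ∀ (f f' : RatFunc ℂ) (M : SL(2, Zlam p)),
    slashZ k (f - f') M = slashZ k f M - slashZ k f' M := fun f f' M => slash_sub ..
  rw [h1, isRPF_iff hp]
  constructor
  · rw [hsub, ← slashZ_mul, SignEq.T_mul_T.slashZ, slashZ_one]
    ring
  · have hU : slashZ k 1 (U p) = slashZ k 1 (T p) := by
      have hS : slashZ k 1 (S p) = 1 := by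
        rw [slashZ, slash_eq, denX_S, map_one]; simp
      rw [U, slashZ_mul, hS]
    have h : ∀ n ∈ Finset.range p, slashZ k (1 - slashZ k 1 (T p)) (U p ^ n) =
        slashZ k 1 (U p ^ n) - slashZ k 1 (U p ^ (n + 1)) := by
      intro n _
      rw [hsub, ← hU, ← slashZ_mul, ← pow_succ']
    rw [Finset.sum_congr rfl h, Finset.sum_range_sub', pow_zero, (SignEq.U_pow_p hp).slashZ,
      sub_self]

lemma numX_U_pow (n : ℕ) :
    numX (toReal p (U p ^ n)) = denX (toReal p (U p ^ (n + 1))) := by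
  obtain ⟨⟨h1, h2⟩, _⟩ := U_pow_apply (p := p) n
  obtain ⟨_, h3, h4⟩ := U_pow_apply (p := p) (n + 1)
  simp only [numX, denX, toReal_apply, h1, h2, h3, h4, chebS_add_two]
  congr 2
  push_cast
  ring

/-- In weight `2`, also `1 / z` is a rational period function: with `Dₙ` the denominator of `Uⁿ`,
the terms of the second relation are `1 / (Dₙ Dₙ₊₁) = sₙ₊₁ / Dₙ₊₁ - sₙ / Dₙ`. -/
lemma isRPF_X_inv (hp : 3 ≤ p) : IsRPF p 1 (RatFunc.X⁻¹) := by
  have hX : (RatFunc.X : RatFunc ℂ) ≠ 0 := RatFunc.X_ne_zero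
  rw [isRPF_iff hp]
  constructor
  · rw [slashZ_T, map_inv₀, moebHom_T_X]
    field_simp
  · set D : ℕ → RatFunc ℂ := fun n => denX (toReal p (U p ^ n))
    have hD : ∀ n, D n ≠ 0 := fun n => denX_ne_zero _
    have h : ∀ n ∈ Finset.range p, slashZ 1 (RatFunc.X⁻¹) (U p ^ n) =
        RatFunc.C ((chebS p (n + 1) : ℝ) : ℂ) / D (n + 1) -
          RatFunc.C ((chebS p n : ℝ) : ℂ) / D n := by
      intro n _
      have e : moebHom (toReal p (U p ^ n)) RatFunc.X = D (n + 1) / D n := by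
        simp only [D]; rw [← numX_U_pow]; exact substHom_X ..
      have key : RatFunc.C ((chebS p n : ℝ) : ℂ) * D (n + 1) =
          RatFunc.C ((chebS p (n + 1) : ℝ) : ℂ) * D n - 1 := by
        obtain ⟨_, h3, h4⟩ := U_pow_apply (p := p) n
        obtain ⟨_, h5, h6⟩ := U_pow_apply (p := p) (n + 1)
        have hid := congrArg (fun z : Zlam p => (RatFunc.C (((z : ℝ)) : ℂ) : RatFunc ℂ))
          (chebS_identity (p := p) n)
        simp only [D, denX, toReal_apply, h3, h4, h5, h6, chebS_add_two] at hid ⊢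
        push_cast at hid ⊢
        simp only [map_sub, map_mul, map_pow, map_one] at hid ⊢
        linear_combination -hid
      have h1 := hD n
      have h2 := hD (n + 1)
      rw [slashZ, slash_eq, map_inv₀, e]
      change (D n ^ (2 * 1))⁻¹ * (D (n + 1) / D n)⁻¹ = _
      field_simp
      linear_combination D n ^ 2 * key
    rw [Finset.sum_congr rfl h,
      Finset.sum_range_sub fun n => RatFunc.C ((chebS p n : ℝ) : ℂ) / D n, chebS_p hp]
    simp

lemma isRPF_qZero (hp : 3 ≤ p) (k : ℕ) (a₀ b₁ : ℂ) : IsRPF p k (qZero k a₀ b₁) := by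
  rw [qZero]
  split_ifs with h
  · exact (isRPF_one_sub hp k).C_mul hp a₀
  · have hk : k = 1 := by omega
    subst hk
    exact ((isRPF_one_sub hp 1).C_mul hp a₀).add hp ((isRPF_X_inv hp).C_mul hp b₁)

lemma regAt_X_inv {z : ℂ} (hz : z ≠ 0) : RegAt z (RatFunc.X⁻¹) := RegAt.inv (by simpa using hz)

lemma regAt_qZero (k : ℕ) (a₀ b₁ : ℂ) {z : ℂ} (hz : z ≠ 0) : RegAt z (qZero k a₀ b₁) := by
  have h1 : RegAt z (1 : RatFunc ℂ) := by simpa using regAt_C z 1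
  rw [qZero]
  simp only [← inv_pow]
  split_ifs
  · exact (regAt_C _ _).mul (h1.sub ((regAt_X_inv hz).pow _))
  · exact ((regAt_C _ _).mul (h1.sub ((regAt_X_inv hz).pow _))).add
      ((regAt_C _ _).mul (regAt_X_inv hz))

/-- The behaviour of a polynomial at infinity, transported to zero. -/
lemma exists_moebHom_T_poly {a : Polynomial ℂ} (ha : a ≠ 0) :
    ∃ u, RegAt 0 u ∧ valAt 0 u ≠ 0 ∧ moebHom (toReal p (T p)) (algebraMap _ _ a) =
      RatFunc.X ^ (-(a.natDegree : ℤ)) * u := by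
  have hX : (RatFunc.X : RatFunc ℂ) ≠ 0 := RatFunc.X_ne_zero
  let w : RatFunc ℂ := -RatFunc.X⁻¹
  have hw : w ≠ 0 := neg_ne_zero.2 (inv_ne_zero hX)
  let _ : Invertible w := invertibleOfNonzero hw
  have h := Polynomial.eval₂_reverse_mul_pow (RatFunc.C (K := ℂ)) w a
  have hinv : ⅟w = algebraMap (Polynomial ℂ) (RatFunc ℂ) (-Polynomial.X) := by
    rw [invOf_eq_inv, map_neg, RatFunc.algebraMap_X]
    exact inv_neg.trans (congrArg Neg.neg (inv_inv _))
  have e1 : moebHom (toReal p (T p)) (algebraMap _ _ a) = a.eval₂ RatFunc.C w := by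
    have e2 : moebHom (toReal p (T p)) RatFunc.X = numX (toReal p (T p)) / denX (toReal p (T p)) :=
      substHom_X ..
    rw [moebHom, substHom_algebraMap, ← e2, moebHom_T_X]
  have e3 : a.reverse.eval₂ RatFunc.C (⅟w) =
      algebraMap (Polynomial ℂ) (RatFunc ℂ) (a.reverse.comp (-Polynomial.X)) := by
    rw [hinv, Polynomial.comp, Polynomial.hom_eval₂]
    rfl
  refine ⟨algebraMap _ _ (Polynomial.C ((-1) ^ a.natDegree) * a.reverse.comp (-Polynomial.X)),
    regAt_poly _ _, ?_, ?_⟩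
  · rw [valAt_poly, Polynomial.eval_mul, Polynomial.eval_comp, Polynomial.eval_C]
    simp only [Polynomial.eval_neg, Polynomial.eval_X, neg_zero]
    rw [← Polynomial.coeff_zero_eq_eval_zero, Polynomial.coeff_zero_reverse]
    exact mul_ne_zero (pow_ne_zero _ (by norm_num)) (by simpa using ha)
  · rw [e1, ← h, e3, map_mul, RatFunc.algebraMap_C, map_pow, map_neg, map_one, zpow_neg,
      zpow_natCast]
    have : w ^ a.natDegree = (-1) ^ a.natDegree * (RatFunc.X ^ a.natDegree)⁻¹ := by
      rw [← inv_pow, ← mul_pow]; simp [w]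
    rw [this]
    ring

lemma X_sub_C_zero : (RatFunc.X - RatFunc.C (0 : ℂ) : RatFunc ℂ) = RatFunc.X := by simp

/-- The leading coefficients: if the degree `n` of `a` is not `m`, then `a / X ^ m` and its translate
differ, for `c ≠ 0`, by a function of degree exactly one less. -/
lemma coeff_translate_sub {a : Polynomial ℂ} {m : ℕ} (hn : a.natDegree ≠ m) (c : ℂ) :
    (a.comp (Polynomial.X + Polynomial.C c) * Polynomial.X ^ m -
      a * (Polynomial.X + Polynomial.C c) ^ m).coeff (a.natDegree + m - 1) =
      ((a.natDegree : ℂ) - m) * c * a.leadingCoeff := by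
  obtain ⟨n, hnd⟩ : ∃ n, n = a.natDegree := ⟨_, rfl⟩
  rw [← hnd] at hn ⊢
  -- the contribution of the term of degree `i` of `a`
  have mono : ∀ i ≤ n, ((Polynomial.X + Polynomial.C c) ^ i * Polynomial.X ^ m -
      Polynomial.X ^ i * (Polynomial.X + Polynomial.C c) ^ m).coeff (n + m - 1) =
      if i = n then ((n : ℂ) - m) * c else 0 := by
    intro i hi
    rw [Polynomial.coeff_sub, Polynomial.coeff_mul_X_pow', mul_comm (Polynomial.X ^ i),
      Polynomial.coeff_mul_X_pow', Polynomial.coeff_X_add_C_pow, Polynomial.coeff_X_add_C_pow]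
    rcases hi.eq_or_lt with rfl | hlt
    · have h1 : (if m ≤ i + m - 1 then c ^ (i - (i + m - 1 - m)) * (i.choose (i + m - 1 - m) : ℂ)
          else 0) = i * c := by
        rcases Nat.eq_zero_or_pos i with h0 | h0
        · rw [if_neg (by omega), h0]; simp
        · obtain ⟨j, rfl⟩ := Nat.exists_eq_add_of_le' h0
          rw [if_pos (by omega), show j + 1 + m - 1 - m = j by omega]
          simp [mul_comm]
      have h2 : (if i ≤ i + m - 1 then c ^ (m - (i + m - 1 - i)) * (m.choose (i + m - 1 - i) : ℂ)
          else 0) = m * c := by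
        rcases Nat.eq_zero_or_pos m with h0 | h0
        · rw [if_neg (by omega), h0]; simp
        · obtain ⟨j, rfl⟩ := Nat.exists_eq_add_of_le' h0
          rw [if_pos (by omega), show i + (j + 1) - 1 - i = j by omega]
          simp [mul_comm]
      rw [h1, h2, if_pos rfl]
      ring
    · rw [if_pos (by omega), if_pos (by omega), if_neg hlt.ne]
      rcases Nat.lt_or_ge (i + 1) n with h | h
      · rw [Nat.choose_eq_zero_of_lt (by omega), Nat.choose_eq_zero_of_lt (by omega)]
        simp
      · rw [show n + m - 1 - m = i by omega, show n + m - 1 - i = m by omega]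
        simp
  have e : a.comp (Polynomial.X + Polynomial.C c) * Polynomial.X ^ m -
      a * (Polynomial.X + Polynomial.C c) ^ m =
      ∑ i ∈ Finset.range (n + 1), Polynomial.C (a.coeff i) *
        ((Polynomial.X + Polynomial.C c) ^ i * Polynomial.X ^ m -
          Polynomial.X ^ i * (Polynomial.X + Polynomial.C c) ^ m) := by
    have h1 : a.comp (Polynomial.X + Polynomial.C c) = ∑ i ∈ Finset.range (n + 1),
        Polynomial.C (a.coeff i) * (Polynomial.X + Polynomial.C c) ^ i := by
      rw [Polynomial.comp, Polynomial.eval₂_eq_sum_range, hnd]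
    simp only [mul_sub, Finset.sum_sub_distrib, ← mul_assoc, ← Finset.sum_mul]
    rw [h1, hnd, ← a.as_sum_range_C_mul_X_pow]
  rw [e, Polynomial.finsetSum_coeff, Finset.sum_eq_single n]
  · rw [Polynomial.coeff_C_mul, mono n le_rfl, if_pos rfl, Polynomial.leadingCoeff, hnd, mul_comm]
  · intro i hi hne
    rw [Finset.mem_range] at hi
    rw [Polynomial.coeff_C_mul, mono i (by omega), if_neg hne, mul_zero]
  · intro h
    simp at h

lemma denom_eq_X_pow {q : RatFunc ℂ} (hreg : ∀ z : ℂ, z ≠ 0 → RegAt z q) :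
    ∃ m, q.denom = Polynomial.X ^ m := by
  have hroots : ∀ z ∈ q.denom.roots, z = 0 := by
    intro z hz
    by_contra h
    exact hreg z h (Polynomial.isRoot_of_mem_roots hz)
  refine ⟨Multiset.card q.denom.roots, ?_⟩
  rw [(IsAlgClosed.splits q.denom).eq_prod_roots_of_monic q.monic_denom,
    Multiset.eq_replicate_of_mem hroots]
  simp

/-- A function that is regular everywhere is a polynomial. -/
lemma exists_eq_algebraMap {q : RatFunc ℂ} (hreg : ∀ z : ℂ, RegAt z q) :
    ∃ a : Polynomial ℂ, q = algebraMap _ _ a := by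
  obtain ⟨m, hm⟩ := denom_eq_X_pow fun z _ => hreg z
  have h0 : m = 0 := by
    by_contra h
    apply hreg 0
    rw [hm]; simp [h]
  refine ⟨q.num, ?_⟩
  conv_lhs => rw [← RatFunc.num_div_denom q, hm, h0]
  simp

/-- The first step towards the classification: the regularity at zero of `q + q ∣ U`, a consequence
of the second relation, bounds the degree at infinity of the nonconstant part of `q`. -/
lemma natDegree_le_of_isRPF (hp : 3 ≤ p) {k m : ℕ} {q : RatFunc ℂ} (hq : IsRPF p k q)
    (hreg : ∀ z : ℂ, z ≠ 0 → RegAt z q) {a : Polynomial ℂ} {c : ℂ} (ha0 : a ≠ 0)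
    (ham : a.natDegree ≠ m)
    (hqa : q = RatFunc.C c + algebraMap _ _ a / RatFunc.X ^ m) :
    a.natDegree + 2 * k ≤ m + 1 := by
  have hX : (RatFunc.X : RatFunc ℂ) ≠ 0 := RatFunc.X_ne_zero
  rw [isRPF_iff hp] at hq
  obtain ⟨hqT, hqU⟩ := hq
  have hsum : RegAt 0 (q + slashZ k q (U p)) := by
    obtain ⟨r, rfl⟩ : ∃ r, p = r + 2 := ⟨p - 2, by omega⟩
    rw [Finset.sum_range_succ', Finset.sum_range_succ', pow_zero, slashZ_one, zero_add,
      pow_one] at hqU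
    have e : q + slashZ k q (U (r + 2)) =
        -∑ n ∈ Finset.range r, slashZ k q (U (r + 2) ^ (n + 1 + 1)) := by
      linear_combination hqU
    rw [e]
    refine (RegAt.sum _ fun n hn => ?_).neg
    rw [Finset.mem_range] at hn
    have h1 := one_le_chebS hp (n := n + 1) (by omega) (by omega)
    have h2 := one_le_chebS hp (n := n + 2) (by omega) (by omega)
    have hd1 : den (U (r + 2) ^ (n + 1 + 1)) 0 ≠ 0 := by
      rw [den_U_pow_succ]; simp only [mul_zero, zero_sub]; linarith
    have hd2 : den (U (r + 2) ^ (n + 1 + 1 + 1)) 0 ≠ 0 := by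
      rw [den_U_pow_succ]; simp only [mul_zero, zero_sub]; linarith
    have := RegAt.slashZ (x := 0) hd1 (f := q) (hreg _ ?_) k
    · simpa using this
    · rw [act_U_pow]
      exact_mod_cast div_ne_zero hd2 hd1
  -- `q + q ∣ U` is the image under `T` of the difference of `q` and its translate
  set h := slashZ k q (S p) - q with hh
  have hhT : slashZ k h (T p) = q + slashZ k q (U p) := by
    have : slashZ k h (T p) = slashZ k (slashZ k q (S p)) (T p) - slashZ k q (T p) :=
      slash_sub ..
    rw [this, ← slashZ_mul, ← U, hqT]
    ring
  rw [← hhT, slashZ_T] at hsum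
  obtain ⟨l, hlp⟩ : ∃ l : ℂ, l = (lam p : ℂ) := ⟨_, rfl⟩
  have hSX := moebHom_S_X (p := p)
  rw [← hlp] at hSX
  set P : Polynomial ℂ := a.comp (Polynomial.X + Polynomial.C l) * Polynomial.X ^ m -
    a * (Polynomial.X + Polynomial.C l) ^ m with hP
  set B : Polynomial ℂ := Polynomial.X ^ m * (Polynomial.X + Polynomial.C l) ^ m with hB
  have hB0 : B ≠ 0 := mul_ne_zero (pow_ne_zero _ Polynomial.X_ne_zero)
    (pow_ne_zero _ (Polynomial.X_add_C_ne_zero l))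
  have hBdeg : B.natDegree = 2 * m := by
    rw [hB, Polynomial.natDegree_mul (pow_ne_zero _ Polynomial.X_ne_zero)
      (pow_ne_zero _ (Polynomial.X_add_C_ne_zero l))]
    simp [two_mul]
  have hhP : h = algebraMap _ _ P / algebraMap _ _ B := by
    have hS : slashZ k q (S p) = moebHom (toReal p (S p)) q := by
      rw [slashZ, slash_eq, denX_S]; simp
    have ha : moebHom (toReal p (S p)) (algebraMap _ _ a) =
        algebraMap _ _ (a.comp (Polynomial.X + Polynomial.C l)) := by
      have e2 : moebHom (toReal p (S p)) RatFunc.X =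
        numX (toReal p (S p)) / denX (toReal p (S p)) := substHom_X ..
      rw [moebHom, substHom_algebraMap, ← e2, hSX, Polynomial.comp, Polynomial.hom_eval₂,
        map_add, RatFunc.algebraMap_X, RatFunc.algebraMap_C]
      rfl
    have hXl : (RatFunc.X + RatFunc.C l : RatFunc ℂ) ≠ 0 := by
      simpa [sub_eq_add_neg] using X_sub_C_ne_zero (-l)
    rw [hh, hS, hqa, map_add, map_div₀, map_pow, hSX, moebHom_C, ha, hP, hB]
    simp only [map_sub, map_mul, map_pow, map_add, RatFunc.algebraMap_X, RatFunc.algebraMap_C]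
    field_simp
    ring
  have hcoeff := coeff_translate_sub ham l
  rw [← hP] at hcoeff
  have hl : l ≠ 0 := by
    have h2 := one_le_chebS hp (n := 2) (by omega) (by omega)
    rw [show (2 : ℕ) = 0 + 2 from rfl, chebS_add_two] at h2
    simp only [zero_add, chebS_one, mul_one, chebS_zero, sub_zero, coe_lamZ] at h2
    have : lam p ≠ 0 := by linarith
    rw [hlp]
    exact_mod_cast this
  have hc0 : P.coeff (a.natDegree + m - 1) ≠ 0 := by
    rw [hcoeff]
    refine mul_ne_zero (mul_ne_zero (sub_ne_zero.2 ?_) hl) (by simpa using ha0)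
    exact_mod_cast ham
  have hPdeg := Polynomial.le_natDegree_of_ne_zero hc0
  have hP0 : P ≠ 0 := by rintro h; simp [h] at hc0
  obtain ⟨u, hu, hu0, hPu⟩ := exists_moebHom_T_poly (p := p) hP0
  obtain ⟨v, hv, hv0, hBv⟩ := exists_moebHom_T_poly (p := p) hB0
  have e : (RatFunc.X ^ (2 * k))⁻¹ * moebHom (toReal p (T p)) h =
      (RatFunc.X - RatFunc.C 0) ^ ((B.natDegree : ℤ) - P.natDegree - (2 * k : ℕ)) *
        (u * v⁻¹) := by
    rw [hhP, map_div₀, hPu, hBv, X_sub_C_zero, zpow_sub₀ hX, zpow_sub₀ hX, zpow_neg, zpow_neg,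
      zpow_natCast, zpow_natCast, zpow_natCast]
    field_simp
  rw [e] at hsum
  have hval : valAt 0 (u * v⁻¹) ≠ 0 := by
    rw [valAt_mul hu (RegAt.inv hv0), valAt_inv hv hv0]
    exact mul_ne_zero hu0 (inv_ne_zero hv0)
  have := nonneg_of_regAt hval hsum
  rw [hBdeg] at this
  omega

/-- The rational period functions without nonzero poles. Subtracting a multiple of `1 - z ^ (-2 k)`
removes the constant term of the Laurent polynomial `q`; the rest `r` is so small at infinity that, by
the first relation, `z r` is regular at zero and hence a polynomial, of degree at most `2 - 2 k`. -/
lemma eq_qZero_of_no_poles (hp : 3 ≤ p) {k : ℕ} (hk : 1 ≤ k) {q : RatFunc ℂ} (hq : IsRPF p k q)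
    (hreg : ∀ z : ℂ, z ≠ 0 → RegAt z q) : ∃ a₀ b₁, q = qZero k a₀ b₁ := by
  have hX : (RatFunc.X : RatFunc ℂ) ≠ 0 := RatFunc.X_ne_zero
  obtain ⟨m, hm⟩ := denom_eq_X_pow hreg
  -- split off the constant term `c` of the Laurent polynomial `q`
  set c := q.num.coeff m with hc
  set a := q.num - Polynomial.C c * Polynomial.X ^ m with ha
  have hqa : q = RatFunc.C c + algebraMap _ _ a / RatFunc.X ^ m := by
    conv_lhs => rw [← RatFunc.num_div_denom q, hm]
    rw [ha]
    simp only [map_sub, map_mul, map_pow, RatFunc.algebraMap_X, RatFunc.algebraMap_C]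
    field_simp
    ring
  have ham : a ≠ 0 → a.natDegree ≠ m := by
    intro h0 h
    have : a.coeff m = 0 := by simp [ha, hc]
    rw [← h] at this
    exact h0 (Polynomial.leadingCoeff_eq_zero.1 this)
  have hdeg : a ≠ 0 → a.natDegree + 2 * k ≤ m + 1 := fun h0 =>
    natDegree_le_of_isRPF hp hq hreg h0 (ham h0) hqa
  -- the remaining part `r` satisfies the first relation and vanishes at infinity
  set r := q - RatFunc.C c * (1 - (RatFunc.X ^ (2 * k))⁻¹) with hr
  have hrT : slashZ k r (T p) = -r := by
    have h1 := ((isRPF_iff hp k q).1 hq).1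
    have h2 := ((isRPF_iff hp k _).1 ((isRPF_one_sub hp k).C_mul hp c)).1
    have : slashZ k r (T p) = slashZ k q (T p) -
      slashZ k (RatFunc.C c * (1 - (RatFunc.X ^ (2 * k))⁻¹)) (T p) := slash_sub ..
    rw [this, h1, h2, hr]
    ring
  have hra : r = algebraMap _ _ a / RatFunc.X ^ m + RatFunc.C c * (RatFunc.X ^ (2 * k))⁻¹ := by
    rw [hr, hqa]; ring
  have hrreg : ∀ z : ℂ, RegAt z (RatFunc.X * r) := by
    intro z
    by_cases hz : z = 0
    · subst hz
      have e : RatFunc.X * r = -(RatFunc.X * ((RatFunc.X ^ (2 * k))⁻¹ *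
          moebHom (toReal p (T p)) (algebraMap _ _ a / RatFunc.X ^ m)) +
            RatFunc.C c * RatFunc.X) := by
        have h1 : r = -slashZ k r (T p) := by rw [hrT, neg_neg]
        have h2 : moebHom (toReal p (T p)) (RatFunc.C c * (RatFunc.X ^ (2 * k))⁻¹) =
            RatFunc.C c * RatFunc.X ^ (2 * k) := by
          rw [map_mul, map_inv₀, map_pow, moebHom_C, moebHom_T_X, (even_two_mul k).neg_pow,
            inv_pow, inv_inv]
        rw [h1, slashZ_T, hra, map_add, h2]
        field_simp
      rw [e]
      refine (RegAt.add ?_ ((regAt_C _ _).mul (regAt_X _))).neg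
      by_cases h0 : a = 0
      · rw [h0]; simpa using regAt_C 0 0
      · obtain ⟨u, hu, hu0, hau⟩ := exists_moebHom_T_poly (p := p) h0
        have e2 : RatFunc.X * ((RatFunc.X ^ (2 * k))⁻¹ *
            moebHom (toReal p (T p)) (algebraMap _ _ a / RatFunc.X ^ m)) =
            (RatFunc.X - RatFunc.C 0) ^ ((m : ℤ) + 1 - a.natDegree - (2 * k : ℕ)) *
              (RatFunc.C ((-1) ^ m) * u) := by
          rw [map_div₀, hau, map_pow, moebHom_T_X, X_sub_C_zero, zpow_sub₀ hX, zpow_sub₀ hX,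
            zpow_add₀ hX, zpow_neg, zpow_natCast, zpow_natCast, zpow_natCast, zpow_one,
            neg_pow, inv_pow, map_pow, map_neg, map_one]
          have hs : ((-1 : RatFunc ℂ) ^ m) * (-1) ^ m = 1 := by
            rw [← mul_pow]; simp
          field_simp
          rw [sq]
          linear_combination -u * hs
        rw [e2]
        refine RegAt.zpow_mul ((regAt_C _ _).mul hu) ?_
        have := hdeg h0
        omega
    · refine (regAt_X z).mul ((hreg z hz).sub ((regAt_C _ _).mul ?_))
      have h1 : RegAt z (1 : RatFunc ℂ) := by simpa using regAt_C z 1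
      rw [← inv_pow]
      exact h1.sub ((regAt_X_inv hz).pow _)
  obtain ⟨b, hb⟩ := exists_eq_algebraMap hrreg
  have hpoly : b * Polynomial.X ^ (m + 2 * k) =
      a * Polynomial.X ^ (2 * k + 1) + Polynomial.C c * Polynomial.X ^ (m + 1) := by
    apply RatFunc.algebraMap_injective ℂ
    simp only [map_add, map_mul, map_pow, RatFunc.algebraMap_X, RatFunc.algebraMap_C]
    rw [← hb, hra]
    field_simp
    ring
  have hbdeg : b ≠ 0 → b.natDegree + 2 * k ≤ 2 := by
    intro hb0
    have h1 : (b * Polynomial.X ^ (m + 2 * k)).natDegree = b.natDegree + (m + 2 * k) := by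
      rw [Polynomial.natDegree_mul hb0 (pow_ne_zero _ Polynomial.X_ne_zero)]; simp
    have h2 : (a * Polynomial.X ^ (2 * k + 1)).natDegree ≤ m + 2 := by
      by_cases h0 : a = 0
      · simp [h0]
      · rw [Polynomial.natDegree_mul h0 (pow_ne_zero _ Polynomial.X_ne_zero)]
        have := hdeg h0
        simp only [Polynomial.natDegree_pow, Polynomial.natDegree_X]
        omega
    have h3 : (Polynomial.C c * Polynomial.X ^ (m + 1)).natDegree ≤ m + 2 :=
      (Polynomial.natDegree_C_mul_X_pow_le c (m + 1)).trans (by omega)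
    have h4 := Polynomial.natDegree_add_le_of_degree_le h2 h3
    rw [← hpoly, h1] at h4
    omega
  rcases Nat.lt_or_ge 1 k with hk1 | hk1
  · have hb0 : b = 0 := by
      by_contra h
      have := hbdeg h
      omega
    refine ⟨c, 0, ?_⟩
    rw [hb0, map_zero] at hb
    have hr0 : r = 0 := (mul_eq_zero.1 hb).resolve_left hX
    rw [qZero, if_pos (by omega)]
    rw [hr, sub_eq_zero] at hr0
    exact hr0
  · have hk' : k = 1 := by omega
    subst hk'
    have hbC : b = Polynomial.C (b.coeff 0) := by
      apply Polynomial.eq_C_of_natDegree_eq_zero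
      by_cases h0 : b = 0
      · simp [h0]
      · have := hbdeg h0
        omega
    refine ⟨c, b.coeff 0, ?_⟩
    rw [qZero, if_neg (by simp)]
    rw [hbC, RatFunc.algebraMap_C, hr] at hb
    rw [mul_one] at hb
    field_simp at hb ⊢
    linear_combination hb

section

variable {g : Ideal (Zlam p) → Zlam p} (hp : 3 ≤ p) (hg : IsNormalization p g)
include hp hg

/-! ### The rational period function of a class -/

lemma PointEquiv.heckeConj {x y : ℝ} (hx : IsHyperbolicPoint p x)
    (hsym : PointEquiv p x (heckeConj p g x)) (h : PointEquiv p x y) :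
    PointEquiv p x (heckeConj p g y) := by
  obtain ⟨V, hV, rfl⟩ := h
  rw [heckeConj_act hp hg hx hV]
  exact hsym.act (hx.ordinary hp) hV

/-- If `x` is equivalent to its conjugate, then `y ↦ T y'` permutes the simple points equivalent
to `x`. -/
lemma act_T_heckeConj_mem_cycleOf {x y : ℝ} (hx : IsHyperbolicPoint p x)
    (hsym : PointEquiv p x (heckeConj p g x)) (hy : y ∈ cycleOf p g (formClass p g x)) :
    act (T p) (heckeConj p g y) ∈ cycleOf p g (formClass p g x) := by
  rw [mem_cycleOf_formClass hp hg hx] at hy ⊢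
  obtain ⟨⟨h1, h2, h3⟩, h4⟩ := hy
  have h1' := h1.heckeConj hp hg
  refine ⟨⟨h1'.act hp T_mem, act_T_pos h3, ?_⟩,
    (PointEquiv.heckeConj hp hg hx hsym h4).act (hx.ordinary hp) T_mem⟩
  rw [heckeConj_act hp hg h1' T_mem, heckeConj_heckeConj hp hg h1]
  exact act_T_neg h2

/-- Under `T`, the forms of a cycle are permuted up to sign. -/
lemma formOf_comp_T {y : ℝ} (hy : IsHyperbolicPoint p y) :
    (formOf p g y).comp (T p) = -formOf p g (act (T p) (heckeConj p g y)) := by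
  rw [← formOf_act_inv hp hg hy T_mem, T_inv, act_neg, ← heckeConj_act hp hg hy T_mem,
    formOf_heckeConj hp hg (hy.act hp T_mem), Form.neg_neg']

/-- For odd `k`, the sum of `Q ^ (-k)` over the simple forms of a class with `-𝒜 = 𝒜` is a rational
period function. In the second relation, a form `N = Q ∘ Uⁿ` with roots `y`, `y'` occurs exactly
once, with `n` determined by `Uⁿ y' < 0`, and `-N` occurs exactly once as well, with the exponent
determined by `y` in place of `y'`. -/
lemma isRPF_sum_cycle {k : ℕ} (hk : Odd k) {x : ℝ} (hx : IsHyperbolicPoint p x)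
    (hsym : PointEquiv p x (heckeConj p g x)) :
    IsRPF p k (∑ᶠ y ∈ cycleOf p g (formClass p g x), ((formOf p g y).ratFunc ^ k)⁻¹) := by
  have hfin := finite_cycleOf_formClass hp hg hx
  have hneg : ∀ Q : Form p, ((-Q).ratFunc ^ k)⁻¹ = -(Q.ratFunc ^ k)⁻¹ := by
    intro Q
    rw [ratFunc_neg, hk.neg_pow, inv_neg]
  rw [finsum_mem_eq_finite_toFinset_sum _ hfin, isRPF_iff hp]
  set Z := hfin.toFinset with hZ
  have hmem : ∀ y, y ∈ Z ↔ IsSimplePoint p g y ∧ PointEquiv p x y := by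
    intro y
    rw [hZ, Set.Finite.mem_toFinset, mem_cycleOf_formClass hp hg hx]
  have hsum : ∀ M : SL(2, Zlam p), slashZ k (∑ y ∈ Z, ((formOf p g y).ratFunc ^ k)⁻¹) M =
      ∑ y ∈ Z, (((formOf p g y).comp M).ratFunc ^ k)⁻¹ := by
    intro M
    rw [slashZ, slash_sum]
    exact Finset.sum_congr rfl fun y _ => slashZ_form k _ M
  constructor
  · have hσ : ∀ y ∈ Z, act (T p) (heckeConj p g y) ∈ Z := by
      intro y hy
      rw [hZ, Set.Finite.mem_toFinset] at hy ⊢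
      exact act_T_heckeConj_mem_cycleOf hp hg hx hsym hy
    have hσσ : ∀ y ∈ Z, act (T p) (heckeConj p g (act (T p) (heckeConj p g y))) = y := by
      intro y hy
      have h1 := ((hmem y).1 hy).1.1
      rw [heckeConj_act hp hg (h1.heckeConj hp hg) T_mem, heckeConj_heckeConj hp hg h1,
        act_T_act_T (h1.ordinary hp)]
    rw [hsum, ← Finset.sum_neg_distrib]
    refine Finset.sum_bij' (fun y _ => act (T p) (heckeConj p g y))
      (fun y _ => act (T p) (heckeConj p g y)) hσ hσ hσσ hσσ ?_
    intro y hy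
    rw [formOf_comp_T hp hg ((hmem y).1 hy).1.1, hneg]
  · simp only [hsum]
    rw [← Finset.sum_product']
    -- the point whose form is the given translate
    let pt : ℕ × ℝ → ℝ := fun a => act (U p ^ a.1)⁻¹ a.2
    let inv : ℕ × ℝ → ℕ × ℝ := fun a =>
      (turn p (pt a), act (U p ^ turn p (pt a)) (heckeConj p g (pt a)))
    have facts : ∀ a ∈ Finset.range p ×ˢ Z, IsHyperbolicPoint p (pt a) ∧
        act (U p ^ a.1) (pt a) = a.2 ∧ turn p (heckeConj p g (pt a)) = a.1 ∧
        turn p (pt a) ≠ a.1 ∧ PointEquiv p x (pt a) := by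
      rintro ⟨n, y⟩ ha
      simp only [Finset.mem_product, Finset.mem_range] at ha
      obtain ⟨hn, hy⟩ := ha
      obtain ⟨⟨h1, h2, h3⟩, h4⟩ := (hmem y).1 hy
      have h5 : IsHyperbolicPoint p (pt (n, y)) := h1.act hp (inv_mem (U_pow_mem n))
      have h6 : act (U p ^ n) (pt (n, y)) = y := (h1.ordinary hp).act_act_inv (U_pow_mem n)
      have h7 : act (U p ^ n) (heckeConj p g (pt (n, y))) = heckeConj p g y := by
        rw [← heckeConj_act hp hg h5 (U_pow_mem n), h6]
      have h8 := turn_eq_mod hp ((h5.heckeConj hp hg).ordinary hp) (n := n) (h7 ▸ h3)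
      rw [Nat.mod_eq_of_lt hn] at h8
      refine ⟨h5, h6, h8.symm, ?_, h4.act (hx.ordinary hp) (inv_mem (U_pow_mem n))⟩
      intro h9
      have := act_turn_neg hp (h5.ordinary hp)
      rw [h9] at this
      simp only [h6] at this
      linarith
    have hpt : ∀ a ∈ Finset.range p ×ˢ Z, pt (inv a) = heckeConj p g (pt a) := by
      intro a ha
      obtain ⟨h1, -⟩ := facts a ha
      exact ((h1.heckeConj hp hg).ordinary hp).act_inv_act (U_pow_mem _)
    have hform : ∀ a ∈ Finset.range p ×ˢ Z,
        (formOf p g a.2).comp (U p ^ a.1) = formOf p g (pt a) := by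
      rintro ⟨n, y⟩ ha
      simp only [Finset.mem_product] at ha
      exact (formOf_act_inv hp hg ((hmem y).1 ha.2).1.1 (U_pow_mem n)).symm
    have hinv : ∀ a ∈ Finset.range p ×ˢ Z, inv a ∈ Finset.range p ×ˢ Z := by
      intro a ha
      obtain ⟨h1, h2, h3, h4, h5⟩ := facts a ha
      have h1' := h1.heckeConj hp hg
      simp only [inv, Finset.mem_product, Finset.mem_range]
      have ht := turn_lt hp (h1.ordinary hp)
      refine ⟨ht, (hmem _).2 ⟨⟨h1'.act hp (U_pow_mem _), ?_, ?_⟩,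
        (PointEquiv.heckeConj hp hg hx hsym h5).act (hx.ordinary hp) (U_pow_mem _)⟩⟩
      · by_contra hle
        have hlt := lt_of_le_of_ne (not_lt.1 hle) ((h1'.ordinary hp).act (U_pow_mem _)).ne_zero
        have h6 := turn_eq_mod hp (h1'.ordinary hp) hlt
        rw [Nat.mod_eq_of_lt ht, h3] at h6
        exact h4 h6
      · rw [heckeConj_act hp hg h1' (U_pow_mem _), heckeConj_heckeConj hp hg h1]
        exact act_turn_neg hp (h1.ordinary hp)
    refine Finset.sum_involution (fun a _ => inv a) ?_ ?_ hinv ?_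
    · intro a ha
      rw [hform a ha, hform _ (hinv a ha), hpt a ha, formOf_heckeConj hp hg (facts a ha).1, hneg,
        add_neg_cancel]
    · intro a ha _ h
      exact (facts a ha).2.2.2.1 (congrArg Prod.fst h)
    · intro a ha
      obtain ⟨h1, h2, h3, h4, h5⟩ := facts a ha
      have e1 : (inv (inv a)).1 = a.1 := by
        simp only [inv]
        change turn p (pt (inv a)) = _
        rw [hpt a ha, h3]
      refine Prod.ext e1 ?_
      change act (U p ^ (inv (inv a)).1) (heckeConj p g (pt (inv a))) = a.2
      rw [e1, hpt a ha, heckeConj_heckeConj hp hg h1, h2]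

/-! ### Poles of the functions `Q ^ (-k)` -/

lemma ratFunc_formOf {x : ℝ} (hx : IsHyperbolicPoint p x) :
    (formOf p g x).ratFunc = RatFunc.C (((formOf p g x).A : ℝ) : ℂ) *
      ((RatFunc.X - RatFunc.C (x : ℂ)) * (RatFunc.X - RatFunc.C ((heckeConj p g x : ℝ) : ℂ))) := by
  have h1 := formOf_slope hp hg hx
  have h2 := heckeConj_slope hp hg hx
  have h3 := formOf_val hp hg hx
  set Q := formOf p g x
  set y := heckeConj p g x
  rw [Form.slope] at h1 h2
  rw [Form.val] at h3
  have hsum : (Q.B : ℝ) = -((Q.A : ℝ) * (x + y)) := by linarith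
  have hprod : (Q.C : ℝ) = (Q.A : ℝ) * (x * y) := by
    linear_combination h3 - x * hsum
  rw [Form.ratFunc, hsum, hprod]
  push_cast
  simp only [map_neg, map_mul, map_add]
  ring

lemma regAt_form_inv {x : ℝ} (hx : IsHyperbolicPoint p x) {z : ℂ} (h1 : z ≠ x)
    (h2 : z ≠ (heckeConj p g x : ℝ)) (k : ℕ) : RegAt z ((formOf p g x).ratFunc ^ k)⁻¹ := by
  apply RegAt.inv
  have hA := formOf_A_ne hp hg hx
  rw [ratFunc_formOf hp hg hx]
  have r1 := regAt_X_sub_C z (x : ℂ)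
  have r2 := regAt_X_sub_C z ((heckeConj p g x : ℝ) : ℂ)
  rw [valAt_pow ((regAt_C _ _).mul (r1.mul r2)), valAt_mul (regAt_C _ _) (r1.mul r2),
    valAt_mul r1 r2, valAt_C, valAt_X_sub_C, valAt_X_sub_C]
  exact pow_ne_zero _ (mul_ne_zero (by exact_mod_cast hA)
    (mul_ne_zero (sub_ne_zero.2 h1) (sub_ne_zero.2 h2)))

lemma regAt_sum_cycle {x : ℝ} (hx : IsHyperbolicPoint p x) {z : ℂ} (k : ℕ)
    (hz : ∀ y ∈ cycleOf p g (formClass p g x), z ≠ (y : ℂ) ∧ z ≠ (heckeConj p g y : ℝ)) :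
    RegAt z (∑ᶠ y ∈ cycleOf p g (formClass p g x), ((formOf p g y).ratFunc ^ k)⁻¹) := by
  have hfin := finite_cycleOf_formClass hp hg hx
  rw [finsum_mem_eq_finite_toFinset_sum _ hfin]
  refine RegAt.sum _ fun y hy => ?_
  rw [Set.Finite.mem_toFinset] at hy
  exact regAt_form_inv hp hg hy.1 (hz y hy).1 (hz y hy).2 k

end

/-! ### Systems of poles -/

/-- The real form of the closure conditions on a system of poles. -/
structure IsRealSystem (p : ℕ) (R : Set ℝ) : Prop where
  finite : R.Finite
  ordinary : ∀ x ∈ R, Ordinary p x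
  act_T : ∀ x ∈ R, act (T p) x ∈ R
  act_U : ∀ x ∈ R, ∃ j, 1 ≤ j ∧ j < p ∧ act (U p ^ j) x ∈ R

lemma act_U_pow_pos (hp : 3 ≤ p) {x : ℝ} (hx : Ordinary p x) {j : ℕ} (hj : j < p)
    (h : j ≠ turn p x) : 0 < act (U p ^ j) x := by
  by_contra hle
  have hlt := lt_of_le_of_ne (not_lt.1 hle) (hx.act (U_pow_mem _)).ne_zero
  have := turn_eq_mod hp hx hlt
  rw [Nat.mod_eq_of_lt hj] at this
  exact h this

/-- The negative point of a `U`-orbit depends on the orbit only. -/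
lemma act_turn_act_U_pow (hp : 3 ≤ p) {x : ℝ} (hx : Ordinary p x) (j : ℕ) :
    (turn p (act (U p ^ j) x) + j) % p = turn p x ∧
    act (U p ^ turn p (act (U p ^ j) x)) (act (U p ^ j) x) = act (U p ^ turn p x) x := by
  have h := act_turn_neg hp (hx.act (U_pow_mem j))
  rw [← act_mul _ _ (hx _ (U_pow_mem j)), ← pow_add] at h ⊢
  have h1 := turn_eq_mod hp hx h
  exact ⟨h1, by rw [(SignEq.U_pow_mod hp _).act, h1]⟩

/-- The counting argument: `T` exchanges the positive and the negative points of a system, and each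
negative point forces a positive one in its `U`-orbit. As each orbit has only one negative point,
each positive point of the system is forced by exactly one negative point. -/
lemma IsRealSystem.count (hp : 3 ≤ p) {R : Set ℝ} (hR : IsRealSystem p R) :
    (∀ x ∈ R, 0 < x → act (U p ^ turn p x) x ∈ R) ∧
      ∀ x ∈ R, 0 < x → ∀ y ∈ R, 0 < y →
        act (U p ^ turn p x) x = act (U p ^ turn p y) y → x = y := by
  classical
  set P := hR.finite.toFinset.filter (0 < ·) with hP
  set N := hR.finite.toFinset.filter (· < 0) with hN
  have memP : ∀ x, x ∈ P ↔ x ∈ R ∧ 0 < x := by intro x; simp [hP]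
  have memN : ∀ x, x ∈ N ↔ x ∈ R ∧ x < 0 := by intro x; simp [hN]
  set ν : ℝ → ℝ := fun x => act (U p ^ turn p x) x with hν
  have hsub : N ⊆ P.image ν := by
    intro x hx
    obtain ⟨hxR, hx0⟩ := (memN x).1 hx
    have ho := hR.ordinary x hxR
    obtain ⟨j, h1, h2, h3⟩ := hR.act_U x hxR
    have ht := turn_of_neg hp ho hx0
    refine Finset.mem_image.2 ⟨_, (memP _).2 ⟨h3, act_U_pow_pos hp ho h2 (by omega)⟩, ?_⟩
    have := (act_turn_act_U_pow hp ho j).2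
    rw [ht, pow_zero, act_one] at this
    exact this
  have hcard : P.card ≤ N.card := by
    refine Finset.card_le_card_of_injOn (act (T p)) ?_ ?_
    · intro x hx
      obtain ⟨hxR, hx0⟩ := (memP x).1 hx
      exact (memN _).2 ⟨hR.act_T x hxR, act_T_neg hx0⟩
    · intro x hx y hy h
      have hxo := hR.ordinary x ((memP x).1 hx).1
      have hyo := hR.ordinary y ((memP y).1 hy).1
      rw [← act_T_act_T hxo, h, act_T_act_T hyo]
  have himg : N = P.image ν :=
    Finset.eq_of_subset_of_card_le hsub (Finset.card_image_le.trans hcard)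
  have hinj : Set.InjOn ν P := by
    rw [← Finset.card_image_iff]
    refine le_antisymm Finset.card_image_le ?_
    rw [← himg]
    exact hcard
  constructor
  · intro x hx h0
    have : ν x ∈ N := by
      rw [himg]
      exact Finset.mem_image_of_mem _ ((memP x).2 ⟨hx, h0⟩)
    exact ((memN _).1 this).1
  · intro x hx hx0 y hy hy0 h
    exact hinj ((memP x).2 ⟨hx, hx0⟩) ((memP y).2 ⟨hy, hy0⟩) h

lemma IsRealSystem.iterate_mem (hp : 3 ≤ p) {R : Set ℝ} (hR : IsRealSystem p R) {x : ℝ}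
    (hx : x ∈ R) (h0 : 0 < x) (n : ℕ) : (cfMap p)^[n] x ∈ R ∧ 0 < (cfMap p)^[n] x := by
  induction n generalizing x with
  | zero => exact ⟨hx, h0⟩
  | succ n ih =>
    have ho := hR.ordinary x hx
    refine ih ?_ (cfMap_pos hp ho)
    rw [cfMap_eq ho]
    exact hR.act_T _ ((hR.count hp).1 x hx h0)

/-- The positive points of a system have purely periodic continued fractions. -/
lemma IsRealSystem.periodic (hp : 3 ≤ p) {R : Set ℝ} (hR : IsRealSystem p R) {x : ℝ}
    (hx : x ∈ R) (h0 : 0 < x) : ∃ r, 0 < r ∧ (cfMap p)^[r] x = x := by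
  have hinj : ∀ x ∈ R, 0 < x → ∀ y ∈ R, 0 < y → cfMap p x = cfMap p y → x = y := by
    intro x hx hx0 y hy hy0 h
    have hxo := hR.ordinary x hx
    have hyo := hR.ordinary y hy
    rw [cfMap_eq hxo, cfMap_eq hyo] at h
    refine (hR.count hp).2 x hx hx0 y hy hy0 ?_
    rw [← act_T_act_T (hxo.act (U_pow_mem _)), h, act_T_act_T (hyo.act (U_pow_mem _))]
  have hinj' : ∀ n, ∀ x ∈ R, 0 < x → ∀ y ∈ R, 0 < y → (cfMap p)^[n] x = (cfMap p)^[n] y →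
      x = y := by
    intro n
    induction n with
    | zero => intro x _ _ y _ _ h; exact h
    | succ n ih =>
      intro x hx hx0 y hy hy0 h
      have h1 := hR.iterate_mem hp hx hx0 1
      have h2 := hR.iterate_mem hp hy hy0 1
      exact hinj x hx hx0 y hy hy0 (ih _ h1.1 h1.2 _ h2.1 h2.2 h)
  obtain ⟨m, -, n, -, hmn, h⟩ := Set.infinite_univ.exists_lt_map_eq_of_mapsTo
    (f := fun n => (cfMap p)^[n] x) (fun n _ => (hR.iterate_mem hp hx h0 n).1) hR.finite
  refine ⟨n - m, by omega, ?_⟩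
  have h3 := hR.iterate_mem hp hx h0 (n - m)
  refine (hinj' m x hx h0 _ h3.1 h3.2 ?_).symm
  rw [← Function.iterate_add_apply, Nat.add_sub_cancel' hmn.le]
  exact h

section

variable {g : Ideal (Zlam p) → Zlam p} (hp : 3 ≤ p) (hg : IsNormalization p g)

/-- All nonzero poles of `q` are hyperbolic points that are equivalent to their Hecke conjugates. For
rational period functions this means that the irreducible systems of poles are Hecke-symmetric. -/
def PolesSelfConjugate (p : ℕ) (g : Ideal (Zlam p) → Zlam p) (q : RatFunc ℂ) : Prop :=
  ∀ z ∈ nonzeroPoles q, ∃ x : ℝ, z = (x : ℂ) ∧ IsHyperbolicPoint p x ∧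
    PointEquiv p x (heckeConj p g x)

include hp

/-- The two relations force poles: the set of all nonzero poles satisfies the closure conditions. -/
lemma IsRPF.isPoleSystem {k : ℕ} {q : RatFunc ℂ} (hq : IsRPF p k q)
    (hH : PolesSelfConjugate p g q) : IsPoleSystem p q (nonzeroPoles q) := by
  rw [isRPF_iff hp] at hq
  refine ⟨subset_rfl, ?_, ?_⟩
  · intro z hz
    obtain ⟨x, rfl, hx, -⟩ := hH z hz
    have ho := hx.ordinary hp
    rw [moebius_toReal]
    by_contra hn
    have hreg := regAt_of_not_mem hn (by exact_mod_cast (ho.act T_mem).ne_zero)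
    have h2 := RegAt.slashZ (ho _ T_mem) hreg k
    rw [hq.1] at h2
    have h3 := h2.neg
    rw [neg_neg] at h3
    exact not_mem_of_regAt h3 hz
  · intro z hz
    obtain ⟨x, rfl, hx, -⟩ := hH z hz
    have ho := hx.ordinary hp
    by_contra! hn
    have h2 : RegAt (x : ℂ) (∑ n ∈ Finset.Icc 1 (p - 1), slashZ k q (U p ^ n)) := by
      refine RegAt.sum _ fun n hnm => RegAt.slashZ (ho _ (U_pow_mem n)) ?_ k
      have h3 := hn n hnm
      rw [moebius_toReal] at h3
      exact regAt_of_not_mem h3 (by exact_mod_cast (ho.act (U_pow_mem n)).ne_zero)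
    have e : q = -∑ n ∈ Finset.Icc 1 (p - 1), slashZ k q (U p ^ n) := by
      have h4 := ((isRPF_iff hp k q).2 hq).2
      exact eq_neg_of_add_eq_zero_left h4
    rw [e] at hz
    exact not_mem_of_regAt h2.neg hz

lemma IsPoleSystem.isRealSystem {q : RatFunc ℂ} (hH : PolesSelfConjugate p g q) {R : Set ℂ}
    (hR : IsPoleSystem p q R) : IsRealSystem p {x : ℝ | (x : ℂ) ∈ R} where
  finite := ((finite_nonzeroPoles q).subset hR.1).preimage Complex.ofReal_injective.injOn
  ordinary x hx := by
    obtain ⟨y, hy, h, -⟩ := hH _ (hR.1 hx)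
    rw [Complex.ofReal_inj.1 hy]
    exact h.ordinary hp
  act_T x hx := by
    have := hR.2.1 _ hx
    rwa [moebius_toReal] at this
  act_U x hx := by
    obtain ⟨j, hj, h⟩ := hR.2.2 _ hx
    rw [Finset.mem_Icc] at hj
    rw [moebius_toReal] at h
    exact ⟨j, hj.1, by omega, h⟩

include hg

/-- The irreducible system of a pole consists of the cycle of a positive pole and its image
under `T`. -/
lemma IsRPF.irreduciblePoleSet_eq {k : ℕ} {q : RatFunc ℂ} (hq : IsRPF p k q)
    (hH : PolesSelfConjugate p g q) {z : ℂ} (hz : z ∈ nonzeroPoles q) :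
    ∃ w : ℝ, IsSimplePoint p g w ∧ PointEquiv p w (heckeConj p g w) ∧
      irreduciblePoleSet p q z =
        {v : ℂ | ∃ n, v = (((cfMap p)^[n] w : ℝ) : ℂ) ∨
          v = ((act (T p) ((cfMap p)^[n] w) : ℝ) : ℂ)} := by
  have hsys := hq.isPoleSystem hp hH
  have hreal := hsys.isRealSystem hp hH
  obtain ⟨x, rfl, hx, hxs⟩ := hH z hz
  have ho := hx.ordinary hp
  -- replace a negative pole by its image under `T`
  obtain ⟨w, hw, hwmem, hw0, hwx⟩ : ∃ w : ℝ, (w = x ∨ w = act (T p) x) ∧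
      (w : ℂ) ∈ nonzeroPoles q ∧ 0 < w ∧ (x = w ∨ x = act (T p) w) := by
    rcases lt_or_gt_of_ne ho.ne_zero with h | h
    · exact ⟨act (T p) x, Or.inr rfl, hreal.act_T x hz, act_T_pos h, Or.inr (act_T_act_T ho).symm⟩
    · exact ⟨x, Or.inl rfl, hz, h, Or.inl rfl⟩
  obtain ⟨y, hy, hyp, hys⟩ := hH _ hwmem
  rw [← Complex.ofReal_inj.1 hy] at hyp hys
  obtain ⟨r, hr, hper⟩ := hreal.periodic hp hwmem hw0
  have hws := isSimplePoint_of_periodic hp hg hyp hr hper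
  refine ⟨w, hws, hys, ?_⟩
  have hsub : ∀ R : Set ℂ, IsPoleSystem p q R → (x : ℂ) ∈ R →
      {v : ℂ | ∃ n, v = (((cfMap p)^[n] w : ℝ) : ℂ) ∨
          v = ((act (T p) ((cfMap p)^[n] w) : ℝ) : ℂ)} ⊆ R := by
    rintro R hR hxR v ⟨n, hv⟩
    have hRr := hR.isRealSystem hp hH
    have hwR : (w : ℂ) ∈ R := by
      rcases hw with rfl | rfl
      · exact hxR
      · exact hRr.act_T x hxR
    have h1 := (hRr.iterate_mem hp hwR hw0 n).1
    rcases hv with rfl | rfl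
    · exact h1
    · exact hRr.act_T _ h1
  apply Set.Subset.antisymm
  · refine Set.sInter_subset_of_mem ⟨⟨hsub _ hsys hz, ?_, ?_⟩, ?_⟩
    · rintro v ⟨n, rfl | rfl⟩
      · rw [moebius_toReal]
        exact ⟨n, Or.inr rfl⟩
      · rw [moebius_toReal, act_T_act_T ((hyp.ordinary hp).iterate n)]
        exact ⟨n, Or.inl rfl⟩
    · rintro v ⟨n, rfl | rfl⟩
      · have hs := hws.iterate hp hg n
        have hso := hs.1.ordinary hp
        refine ⟨turn p ((cfMap p)^[n] w), Finset.mem_Icc.2 ⟨turn_pos hp hso hs.2.1,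
          by have := turn_lt hp hso; omega⟩, n + 1, Or.inr ?_⟩
        rw [moebius_toReal, Function.iterate_succ_apply', cfMap_eq hso,
          act_T_act_T (hso.act (U_pow_mem _))]
      · -- the preceding point of the cycle
        obtain ⟨s, rfl⟩ := Nat.exists_eq_succ_of_ne_zero hr.ne'
        set u := (cfMap p)^[n + s] w with hu
        have hs : IsSimplePoint p g u := hws.iterate hp hg _
        have hso := hs.1.ordinary hp
        have hun : (cfMap p)^[n] w = cfMap p u := by
          rw [hu, ← Function.iterate_succ_apply' (cfMap p), show (n + s).succ = n + s.succ from rfl,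
            Function.iterate_add_apply, hper]
        have h1 := turn_pos hp hso hs.2.1
        have h2 := turn_lt hp hso
        refine ⟨p - turn p u, Finset.mem_Icc.2 ⟨by omega, by omega⟩, n + s, Or.inl ?_⟩
        rw [moebius_toReal, hun, cfMap_eq hso, act_T_act_T (hso.act (U_pow_mem _)),
          ← (SignEq.U_pow_inv hp h2.le).act, hso.act_inv_act (U_pow_mem _)]
    · rcases hwx with rfl | rfl
      · exact ⟨0, Or.inl rfl⟩
      · exact ⟨0, Or.inr rfl⟩
  · exact Set.subset_sInter fun R hR => hsub R hR.1 hR.2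

/-- The conjugates of a cycle of self-conjugate points are the images of the cycle under `T`. -/
lemma IsRPF.hasSymmetricPoleSystems {k : ℕ} {q : RatFunc ℂ} (hq : IsRPF p k q)
    (hH : PolesSelfConjugate p g q) : HasSymmetricPoleSystems p g q := by
  intro z hz
  obtain ⟨w, hw, hws, h⟩ := hq.irreduciblePoleSet_eq hp hg hH hz
  rw [h]
  set R : Set ℂ := {v : ℂ | ∃ n, v = (((cfMap p)^[n] w : ℝ) : ℂ) ∨
          v = ((act (T p) ((cfMap p)^[n] w) : ℝ) : ℂ)}
  have hwo := hw.1.ordinary hp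
  have hyp : ∀ v ∈ R, ∃ x : ℝ, IsHyperbolicPoint p x ∧ v = (x : ℂ) := by
    rintro v ⟨n, rfl | rfl⟩
    · exact ⟨_, (hw.iterate hp hg n).1, rfl⟩
    · exact ⟨_, (hw.iterate hp hg n).1.act hp T_mem, rfl⟩
  have key : ∀ n, ∃ m, act (T p) (heckeConj p g ((cfMap p)^[n] w)) = (cfMap p)^[m] w := by
    intro n
    have h1 := act_T_heckeConj_mem_cycleOf hp hg hw.1 hws
      ((mem_cycleOf_formClass hp hg hw.1).2 ⟨hw.iterate hp hg n, PointEquiv.iterate hwo n⟩)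
    rw [mem_cycleOf_formClass hp hg hw.1] at h1
    exact hw.exists_iterate_eq hp hg h1.1 h1.2
  have hconj : ∀ x : ℝ, (x : ℂ) ∈ R → ((heckeConj p g x : ℝ) : ℂ) ∈ R := by
    rintro x ⟨n, hx | hx⟩
    · rw [Complex.ofReal_inj.1 hx]
      obtain ⟨m, hm⟩ := key n
      refine ⟨m, Or.inr ?_⟩
      rw [← hm, act_T_act_T (((hw.iterate hp hg n).1.heckeConj hp hg).ordinary hp)]
    · rw [Complex.ofReal_inj.1 hx]
      obtain ⟨m, hm⟩ := key n
      refine ⟨m, Or.inl ?_⟩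
      rw [heckeConj_act hp hg (hw.iterate hp hg n).1 T_mem, hm]
  refine ⟨hyp, ?_⟩
  ext v
  constructor
  · intro hv
    obtain ⟨x, hx, rfl⟩ := hyp v hv
    exact ⟨heckeConj p g x, hconj x hv, by rw [heckeConj_heckeConj hp hg hx]⟩
  · rintro ⟨x, hx, rfl⟩
    exact hconj x hx

omit hg in
/-- Conversely, Hecke-symmetric systems consist of self-conjugate points: the poles equivalent to a
given one form a system, so they contain its irreducible system, and in it the conjugate. -/
lemma HasSymmetricPoleSystems.polesSelfConjugate {q : RatFunc ℂ}
    (hS : HasSymmetricPoleSystems p g q) :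
    PolesSelfConjugate p g q := by
  intro z hz
  obtain ⟨h1, h2⟩ := hS z hz
  have hzmem : z ∈ irreduciblePoleSet p q z := Set.mem_sInter.2 fun R hR => hR.2
  obtain ⟨x, hx, rfl⟩ := h1 z hzmem
  refine ⟨x, rfl, hx, ?_⟩
  have ho := hx.ordinary hp
  -- there is a system containing `x`, as the whole plane does not consist of real numbers
  obtain ⟨R, hR, hxR⟩ : ∃ R, IsPoleSystem p q R ∧ (x : ℂ) ∈ R := by
    by_contra! hne
    have : Complex.I ∈ irreduciblePoleSet p q x :=
      Set.mem_sInter.2 fun R hR => absurd hR.2 (hne R hR.1)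
    obtain ⟨y, -, hy⟩ := h1 _ this
    have := congrArg Complex.im hy
    simp at this
  have hmem : ((heckeConj p g x : ℝ) : ℂ) ∈ irreduciblePoleSet p q x := by
    rw [h2]
    exact ⟨x, hzmem, rfl⟩
  have hsub : irreduciblePoleSet p q x ⊆
      {v | v ∈ R ∧ ∃ y : ℝ, v = (y : ℂ) ∧ PointEquiv p x y} := by
    refine Set.sInter_subset_of_mem ⟨⟨fun v hv => hR.1 hv.1, ?_, ?_⟩, hxR, x, rfl,
      PointEquiv.refl x⟩
    · rintro v ⟨hv, y, rfl, hy⟩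
      exact ⟨hR.2.1 _ hv, _, moebius_toReal _ _, hy.act ho T_mem⟩
    · rintro v ⟨hv, y, rfl, hy⟩
      obtain ⟨j, hj, h⟩ := hR.2.2 _ hv
      exact ⟨j, hj, h, _, moebius_toReal _ _, hy.act ho (U_pow_mem j)⟩
  obtain ⟨-, y, hy, hxy⟩ := hsub hmem
  rwa [Complex.ofReal_inj.1 hy]

end

/-! ### Orders of poles -/

section

variable {g : Ideal (Zlam p) → Zlam p} (hp : 3 ≤ p) (hg : IsNormalization p g)

include hp in
/-- At a positive pole `w`, the only other pole in the `U`-orbit is the negative one, so the two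
singular terms of the second relation cancel each other; by the first relation the second of them is
`-q ∣ T Uᵗ` with `t = turn w`. -/
lemma IsRPF.regAt_sub_slashZ_cfStep {k : ℕ} {q : RatFunc ℂ} (hq : IsRPF p k q)
    (hR : IsRealSystem p {x : ℝ | (x : ℂ) ∈ nonzeroPoles q}) {w : ℝ}
    (hw : (w : ℂ) ∈ nonzeroPoles q) (h0 : 0 < w) :
    RegAt (w : ℂ) (q - slashZ k q (cfStep p w)) := by
  rw [isRPF_iff hp] at hq
  have ho := hR.ordinary w hw
  have ht := turn_lt hp ho
  have ht0 := turn_pos hp ho h0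
  have hreg : ∀ j ∈ ((Finset.range p).erase (turn p w)).erase 0,
      RegAt (w : ℂ) (slashZ k q (U p ^ j)) := by
    intro j hj
    simp only [Finset.mem_erase, Finset.mem_range] at hj
    obtain ⟨hj0, hjt, hjp⟩ := hj
    refine RegAt.slashZ (ho _ (U_pow_mem j)) (regAt_of_not_mem ?_
      (by exact_mod_cast (ho.act (U_pow_mem j)).ne_zero)) k
    intro hmem
    obtain ⟨h1, h2⟩ := act_turn_act_U_pow hp ho j
    have h3 := (hR.count hp).2 _ hmem (act_U_pow_pos hp ho hjp hjt) w hw h0 h2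
    rw [h3] at h1
    -- `(turn w + j) % p = turn w` is impossible for `0 < j < p`
    rcases lt_or_ge (turn p w + j) p with h | h
    · rw [Nat.mod_eq_of_lt h] at h1; omega
    · rw [Nat.mod_eq_sub_mod h, Nat.mod_eq_of_lt (by omega)] at h1; omega
  have hsum : q + slashZ k q (U p ^ turn p w) =
      -∑ j ∈ ((Finset.range p).erase (turn p w)).erase 0, slashZ k q (U p ^ j) := by
    have h1 := hq.2
    rw [← Finset.add_sum_erase _ _ (Finset.mem_range.2 ht), ← Finset.add_sum_erase _ _
      (show 0 ∈ (Finset.range p).erase (turn p w) by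
        simp only [Finset.mem_erase, Finset.mem_range]; omega), pow_zero, slashZ_one] at h1
    linear_combination h1
  have e : q - slashZ k q (cfStep p w) = q + slashZ k q (U p ^ turn p w) := by
    rw [cfStep, slashZ_mul, hq.1, slashZ, ← zero_sub q, slash_sub, ← slashZ, ← slashZ]
    simp [slashZ, slash_eq]
  rw [e, hsum]
  exact (RegAt.sum _ hreg).neg

include hp in
lemma IsRPF.regAt_sub_slashZ_cfWord {k : ℕ} {q : RatFunc ℂ} (hq : IsRPF p k q)
    (hR : IsRealSystem p {x : ℝ | (x : ℂ) ∈ nonzeroPoles q}) {w : ℝ}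
    (hw : (w : ℂ) ∈ nonzeroPoles q) (h0 : 0 < w) (n : ℕ) :
    RegAt (w : ℂ) (q - slashZ k q (cfWord p n w)) := by
  induction n generalizing w with
  | zero =>
    rw [cfWord, slashZ_one, sub_self]
    simpa using regAt_C (w : ℂ) 0
  | succ n ih =>
    have ho := hR.ordinary w hw
    have h1 := hR.iterate_mem hp hw h0 1
    have h2 := RegAt.slashZ (ho _ (cfStep_mem w)) (ih h1.1 h1.2) k
    have h3 := (hq.regAt_sub_slashZ_cfStep hp hR hw h0).add h2
    have e : slashZ k (q - slashZ k q (cfWord p n (cfMap p w))) (cfStep p w) =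
        slashZ k q (cfStep p w) - slashZ k q (cfWord p (n + 1) w) := by
      rw [slashZ, slash_sub, ← slashZ, ← slashZ, ← slashZ_mul]; rfl
    rw [show act (cfStep p w) w = cfMap p w from rfl, e, sub_add_sub_cancel] at h3
    exact h3

include hp in
/-- At a positive pole `w`, a rational period function is invariant modulo regular functions under
the stabilizer of `w`. -/
lemma IsRPF.regAt_sub_slashZ_of_fixes {k : ℕ} {q : RatFunc ℂ} (hq : IsRPF p k q)
    (hR : IsRealSystem p {x : ℝ | (x : ℂ) ∈ nonzeroPoles q}) {w : ℝ}
    (hw : (w : ℂ) ∈ nonzeroPoles q) (h0 : 0 < w) {M : SL(2, Zlam p)} (hM : M ∈ heckeGroup p)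
    (hfix : act M w = w) : RegAt (w : ℂ) (q - slashZ k q M) := by
  have ho := hR.ordinary w hw
  obtain ⟨m, n, h⟩ := exists_cfWord_eq hp hM ho
  rw [hfix] at h
  have h1 := hq.regAt_sub_slashZ_cfWord hp hR hw h0 m
  have h2 := RegAt.slashZ (ho _ hM) (hfix.symm ▸ hq.regAt_sub_slashZ_cfWord hp hR hw h0 n) k
  have e : slashZ k (q - slashZ k q (cfWord p n w)) M =
      slashZ k q M - slashZ k q (cfWord p m w) := by
    rw [h.slashZ, slashZ_mul, slashZ, slash_sub]; rfl
  rw [hfix, e] at h2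
  have := h1.sub h2
  rwa [sub_sub_sub_cancel_right] at this

include hg in
/-- Functions whose poles at `w` are invariant under a hyperbolic stabilizer are, modulo regular
functions, multiples of `Q_w ^ (-k)`: any pole of such a function has order `k`, and so subtracting
the multiple that lowers the order leaves a regular function. -/
lemma exists_regAt_sub (hp : 3 ≤ p) {k : ℕ} {q : RatFunc ℂ} {w : ℝ} (hw : IsHyperbolicPoint p w)
    (hq : ∀ M ∈ heckeGroup p, act M w = w → RegAt (w : ℂ) (q - slashZ k q M)) :
    ∃ c : ℂ, RegAt (w : ℂ) (q - RatFunc.C c * ((formOf p g w).ratFunc ^ k)⁻¹) := by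
  by_cases hr : RegAt (w : ℂ) q
  · exact ⟨0, by simpa using hr⟩
  have ho := hw.ordinary hp
  obtain ⟨M, hM, htr, hfix⟩ := id hw
  have hd := ho M hM
  have hd1 := abs_den_ne_one ho hM htr hfix
  rw [fixes_iff hd] at hfix
  have hq0 : q ≠ 0 := by
    rintro rfl
    exact hr (by simpa using regAt_C (w : ℂ) 0)
  set F : RatFunc ℂ := ((formOf p g w).ratFunc ^ k)⁻¹ with hF
  have hFM : slashZ k F M = F := by
    have hinv : act M⁻¹ w = w := by
      conv_lhs => rw [← hfix]
      exact ho.act_inv_act hM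
    have h := formOf_act_inv hp hg hw hM
    rw [hinv] at h
    rw [hF, slashZ_form, ← h]
  have hX := X_sub_C_ne_zero (w : ℂ)
  -- the order of `F` at `w` is `-k`
  obtain ⟨v, hv, hv0, hFv⟩ : ∃ v, RegAt (w : ℂ) v ∧ valAt (w : ℂ) v ≠ 0 ∧
      F = (RatFunc.X - RatFunc.C (w : ℂ)) ^ (-(k : ℤ)) * v := by
    set s : RatFunc ℂ := RatFunc.C (((formOf p g w).A : ℝ) : ℂ) *
      (RatFunc.X - RatFunc.C ((heckeConj p g w : ℝ) : ℂ)) with hs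
    have hsreg : RegAt (w : ℂ) s := (regAt_C _ _).mul (regAt_X_sub_C _ _)
    have hsval : valAt (w : ℂ) s ≠ 0 := by
      rw [hs, valAt_mul (regAt_C _ _) (regAt_X_sub_C _ _), valAt_C, valAt_X_sub_C]
      refine mul_ne_zero (by exact_mod_cast formOf_A_ne hp hg hw) (sub_ne_zero.2 ?_)
      exact_mod_cast (heckeConj_ne hp hg hw).symm
    have hsk : valAt (w : ℂ) (s ^ k) ≠ 0 := by
      rw [valAt_pow hsreg]; exact pow_ne_zero _ hsval
    refine ⟨(s ^ k)⁻¹, RegAt.inv hsk, ?_, ?_⟩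
    · rw [valAt_inv (hsreg.pow k) hsk]
      exact inv_ne_zero hsk
    · rw [hF, ratFunc_formOf hp hg hw, zpow_neg, zpow_natCast, ← mul_inv, hs, ← mul_pow]
      congr 2
      ring
  obtain ⟨n, u, hu, hu0, hqu⟩ := exists_order (w : ℂ) hq0
  have hn : n < 0 := by
    by_contra hn
    exact hr (hqu ▸ hu.zpow_mul (not_lt.1 hn))
  have hnk := order_eq_of_sub_slash_regular hd hd1 hfix hu hu0 hqu hn (hq M hM hfix)
  subst hnk
  refine ⟨valAt (w : ℂ) u / valAt (w : ℂ) v, ?_⟩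
  set c := valAt (w : ℂ) u / valAt (w : ℂ) v with hc
  set f := q - RatFunc.C c * F with hf
  by_contra hfr
  have hf0 : f ≠ 0 := by
    intro h
    exact hfr (by rw [h]; simpa using regAt_C (w : ℂ) 0)
  have hcv : RegAt (w : ℂ) (RatFunc.C c * v) := (regAt_C _ c).mul hv
  -- `f` has order greater than `-k`
  obtain ⟨t, ht, e⟩ := (hu.sub hcv).exists_eq_mul (by
    rw [valAt_sub hu hcv, valAt_mul (regAt_C _ c) hv, valAt_C, hc, div_mul_cancel₀ _ hv0, sub_self])
  have hft : f = (RatFunc.X - RatFunc.C (w : ℂ)) ^ (-(k : ℤ) + 1) * t := by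
    rw [zpow_add_one₀ hX, mul_assoc, ← e, hf, hqu, hFv]
    ring
  obtain ⟨n, u', hu', hu0', hfu⟩ := exists_order (w : ℂ) hf0
  have hn' : n < 0 := by
    by_contra hn
    exact hfr (hfu ▸ hu'.zpow_mul (not_lt.1 hn))
  have hfM : RegAt (w : ℂ) (f - slashZ k f M) := by
    have e : f - slashZ k f M = q - slashZ k q M := by
      rw [hf, slashZ, slash_sub, slash_C_mul, ← slashZ, ← slashZ, hFM]
      ring
    rw [e]
    exact hq M hM hfix
  have hnk := order_eq_of_sub_slash_regular hd hd1 hfix hu' hu0' hfu hn' hfM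
  have : u' = (RatFunc.X - RatFunc.C (w : ℂ)) ^ (1 : ℤ) * t := by
    have h := hfu.symm.trans hft
    rw [hnk, zpow_add₀ hX, mul_assoc] at h
    exact mul_left_cancel₀ (zpow_ne_zero _ hX) h
  apply hu0'
  rw [this, zpow_one, valAt_mul (regAt_X_sub_C _ _) ht, valAt_X_sub_C, sub_self, zero_mul]

end

/-! ### Removing the poles -/

section

variable {g : Ideal (Zlam p) → Zlam p} (hp : 3 ≤ p) (hg : IsNormalization p g)
include hp hg

/-- The poles of the function of a class are in the cycle and its image under conjugation. -/
lemma eq_or_of_not_regAt_sum_cycle {x : ℝ} (hx : IsHyperbolicPoint p x) {k : ℕ} {z : ℂ}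
    (hz : ¬ RegAt z (∑ᶠ y ∈ cycleOf p g (formClass p g x), ((formOf p g y).ratFunc ^ k)⁻¹)) :
    ∃ y : ℝ, IsSimplePoint p g y ∧ PointEquiv p x y ∧
      (z = (y : ℂ) ∨ z = ((heckeConj p g y : ℝ) : ℂ)) := by
  by_contra! h
  refine hz (regAt_sum_cycle hp hg hx k fun y hy => ?_)
  rw [mem_cycleOf_formClass hp hg hx] at hy
  exact h y hy.1 hy.2

/-- If a rational period function has nonzero poles, then one of its poles can be removed by
subtracting a multiple of the function of a class. -/
lemma IsRPF.exists_sub_poles_ssubset {k : ℕ} {q : RatFunc ℂ} (hq : IsRPF p k q)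
    (hH : PolesSelfConjugate p g q) (hne : (nonzeroPoles q).Nonempty) :
    ∃ (x : ℝ) (c : ℂ), IsHyperbolicPoint p x ∧ PointEquiv p x (heckeConj p g x) ∧
      nonzeroPoles (q - RatFunc.C c *
        ∑ᶠ y ∈ cycleOf p g (formClass p g x), ((formOf p g y).ratFunc ^ k)⁻¹) ⊂ nonzeroPoles q := by
  have hR := (hq.isPoleSystem hp hH).isRealSystem hp hH
  obtain ⟨w, hw, hw0⟩ : ∃ w : ℝ, (w : ℂ) ∈ nonzeroPoles q ∧ 0 < w := by
    obtain ⟨z, hz⟩ := hne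
    obtain ⟨x, rfl, hx, -⟩ := hH z hz
    rcases lt_or_gt_of_ne (hx.ordinary hp).ne_zero with h | h
    · exact ⟨_, hR.act_T x hz, act_T_pos h⟩
    · exact ⟨x, hz, h⟩
  obtain ⟨w', hw', hwh, hws⟩ := hH _ hw
  rw [← Complex.ofReal_inj.1 hw'] at hwh hws
  obtain ⟨r, hr, hper⟩ := hR.periodic hp hw hw0
  have hsimple := isSimplePoint_of_periodic hp hg hwh hr hper
  obtain ⟨c, hc⟩ := exists_regAt_sub hg hp hwh
    fun M hM => hq.regAt_sub_slashZ_of_fixes hp hR hw hw0 hM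
  refine ⟨w, c, hwh, hws, ?_⟩
  have hcyc : ∀ y, IsSimplePoint p g y → PointEquiv p w y → (y : ℂ) ∈ nonzeroPoles q := by
    intro y hy hwy
    obtain ⟨n, rfl⟩ := hsimple.exists_iterate_eq hp hg hy hwy
    exact (hR.iterate_mem hp hw hw0 n).1
  rw [Set.ssubset_iff_of_subset]
  · refine ⟨w, hw, not_mem_of_regAt ?_⟩
    have hfin := finite_cycleOf_formClass hp hg hwh
    have hmem : w ∈ hfin.toFinset := by
      rw [Set.Finite.mem_toFinset, mem_cycleOf_formClass hp hg hwh]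
      exact ⟨hsimple, PointEquiv.refl w⟩
    rw [finsum_mem_eq_finite_toFinset_sum _ hfin, ← Finset.add_sum_erase _ _ hmem, mul_add,
      ← sub_sub]
    refine hc.sub ((regAt_C _ c).mul (RegAt.sum _ fun y hy => ?_))
    rw [Finset.mem_erase, Set.Finite.mem_toFinset, mem_cycleOf_formClass hp hg hwh] at hy
    refine regAt_form_inv hp hg hy.2.1.1 ?_ ?_ k
    · exact_mod_cast hy.1.symm
    · exact_mod_cast (hy.2.1.2.2.trans hw0).ne'
  · intro z hz
    by_contra hn
    have hr : RegAt z q := regAt_of_not_mem hn hz.2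
    have hF : ¬ RegAt z (∑ᶠ y ∈ cycleOf p g (formClass p g w),
        ((formOf p g y).ratFunc ^ k)⁻¹) := fun h =>
      not_mem_of_regAt (hr.sub ((regAt_C _ c).mul h)) hz
    obtain ⟨y, hy, hwy, rfl | rfl⟩ := eq_or_of_not_regAt_sum_cycle hp hg hwh hF
    · exact hn (hcyc y hy hwy)
    · have h1 := act_T_heckeConj_mem_cycleOf hp hg hwh hws
        ((mem_cycleOf_formClass hp hg hwh).2 ⟨hy, hwy⟩)
      rw [mem_cycleOf_formClass hp hg hwh] at h1
      have h2 := hR.act_T _ (hcyc _ h1.1 h1.2)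
      rw [act_T_act_T ((hy.1.heckeConj hp hg).ordinary hp)] at h2
      exact hn h2

/-- Rational period functions of odd half weight with self-conjugate poles are combinations of the
functions of classes and of a function without nonzero poles. -/
lemma IsRPF.exists_eq_sum {k : ℕ} (hk : Odd k) {q : RatFunc ℂ} (hq : IsRPF p k q)
    (hH : PolesSelfConjugate p g q) :
    ∃ (L : ℕ) (x : Fin L → ℝ) (d : Fin L → ℂ) (a₀ b₁ : ℂ),
      (∀ l, IsHyperbolicPoint p (x l) ∧ PointEquiv p (x l) (heckeConj p g (x l))) ∧
      q = (∑ l, RatFunc.C (d l) *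
        ∑ᶠ y ∈ cycleOf p g (formClass p g (x l)), ((formOf p g y).ratFunc ^ k)⁻¹) +
        qZero k a₀ b₁ := by
  induction hm : (nonzeroPoles q).ncard using Nat.strong_induction_on generalizing q with
  | _ m ih =>
    rcases (nonzeroPoles q).eq_empty_or_nonempty with he | hne
    · obtain ⟨a₀, b₁, h⟩ := eq_qZero_of_no_poles hp hk.pos hq
        fun z hz => regAt_of_not_mem (by rw [he]; exact id) hz
      exact ⟨0, Fin.elim0, Fin.elim0, a₀, b₁, fun l => l.elim0, by simpa using h⟩
    · obtain ⟨x, c, hx, hxs, hss⟩ := hq.exists_sub_poles_ssubset hp hg hH hne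
      have h1 := isRPF_sum_cycle hp hg hk hx hxs
      set F := ∑ᶠ y ∈ cycleOf p g (formClass p g x), ((formOf p g y).ratFunc ^ k)⁻¹ with hF
      have h2 : IsRPF p k (q - RatFunc.C c * F) := by
        have := hq.add hp (h1.C_mul hp (-c))
        rwa [map_neg, neg_mul, ← sub_eq_add_neg] at this
      obtain ⟨L, x', d, a₀, b₁, h3, h4⟩ := ih _
        (hm ▸ Set.ncard_lt_ncard hss (finite_nonzeroPoles q)) h2 (fun z hz => hH z (hss.1 hz)) rfl
      refine ⟨L + 1, Fin.cons x x', Fin.cons c d, a₀, b₁, Fin.cases ⟨hx, hxs⟩ h3, ?_⟩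
      rw [Fin.sum_univ_succ]
      simp only [Fin.cons_zero, Fin.cons_succ]
      rw [← hF]
      linear_combination h4

lemma polesSelfConjugate_sum {k : ℕ} {L : ℕ} {x : Fin L → ℝ} {d : Fin L → ℂ} {c₀ a₀ b₁ : ℂ}
    (hx : ∀ l, IsHyperbolicPoint p (x l)) (hxs : ∀ l, PointEquiv p (x l) (heckeConj p g (x l))) :
    PolesSelfConjugate p g ((∑ l, RatFunc.C (d l) *
        ∑ᶠ y ∈ cycleOf p g (formClass p g (x l)), ((formOf p g y).ratFunc ^ k)⁻¹) +
        RatFunc.C c₀ * qZero k a₀ b₁) := by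
  intro z hz
  obtain ⟨l, hl⟩ : ∃ l, ¬ RegAt z (∑ᶠ y ∈ cycleOf p g (formClass p g (x l)),
      ((formOf p g y).ratFunc ^ k)⁻¹) := by
    by_contra! h
    exact not_mem_of_regAt ((RegAt.sum _ fun l _ => (regAt_C _ (d l)).mul (h l)).add
      ((regAt_C _ c₀).mul (regAt_qZero k a₀ b₁ hz.2))) hz
  obtain ⟨y, hy, hxy, h⟩ := eq_or_of_not_regAt_sum_cycle hp hg (hx l) hl
  have ho := (hx l).ordinary hp
  have hyo := hy.1.ordinary hp
  have h1 : PointEquiv p y (heckeConj p g y) := by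
    exact (hxy.symm ho).trans hyo (PointEquiv.heckeConj hp hg (hx l) (hxs l) hxy)
  rcases h with rfl | rfl
  · exact ⟨y, rfl, hy.1, h1⟩
  · refine ⟨_, rfl, hy.1.heckeConj hp hg, ?_⟩
    rw [heckeConj_heckeConj hp hg hy.1]
    exact h1.symm hyo

end

end HeckeRPF

theorem mainTheorem3 (p : ℕ) (hp : 3 ≤ p)
    (g : Ideal (HeckeRPF.Zlam p) → HeckeRPF.Zlam p) (hg : HeckeRPF.IsNormalization p g)
    (k : ℕ) (hk : Odd k) :
    (∀ 𝒜 : Set (HeckeRPF.Form p), HeckeRPF.IsHyperbolicClass p g 𝒜 →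
      HeckeRPF.negClass 𝒜 = 𝒜 → (HeckeRPF.cycleOf p g 𝒜).Finite) ∧
    ∀ q : RatFunc ℂ,
      (HeckeRPF.IsRPF p k q ∧ HeckeRPF.HasSymmetricPoleSystems p g q) ↔
        ∃ (L : ℕ) (𝒜 : Fin L → Set (HeckeRPF.Form p)) (d : Fin L → ℂ) (c₀ a₀ b₁ : ℂ),
          (∀ l, HeckeRPF.IsHyperbolicClass p g (𝒜 l) ∧ HeckeRPF.negClass (𝒜 l) = 𝒜 l) ∧
          q = (∑ l, RatFunc.C (d l) *
                ∑ᶠ α ∈ HeckeRPF.cycleOf p g (𝒜 l),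
                  ((HeckeRPF.formOf p g α).ratFunc ^ k)⁻¹) +
              RatFunc.C c₀ * HeckeRPF.qZero k a₀ b₁ := by
  refine ⟨?_, fun q => ⟨?_, ?_⟩⟩
  · rintro 𝒜 ⟨x, hx, rfl⟩ -
    exact HeckeRPF.finite_cycleOf_formClass hp hg hx
  · rintro ⟨hq, hS⟩
    obtain ⟨L, x, d, a₀, b₁, hx, h⟩ := hq.exists_eq_sum hp hg hk (hS.polesSelfConjugate hp)
    refine ⟨L, fun l => HeckeRPF.formClass p g (x l), d, 1, a₀, b₁, fun l => ⟨⟨x l, (hx l).1, rfl⟩,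
      (HeckeRPF.negClass_formClass hp hg (hx l).1).2 (hx l).2⟩, ?_⟩
    rw [map_one, one_mul]
    exact h
  · rintro ⟨L, 𝒜, d, c₀, a₀, b₁, h𝒜, rfl⟩
    choose x hx h using fun l => (h𝒜 l).1
    obtain rfl : 𝒜 = fun l => HeckeRPF.formClass p g (x l) := funext h
    have hxs := fun l => (HeckeRPF.negClass_formClass hp hg (hx l)).1 (h𝒜 l).2
    have hq := (HeckeRPF.IsRPF.sum hp Finset.univ fun l _ =>
      (HeckeRPF.isRPF_sum_cycle hp hg hk (hx l) (hxs l)).C_mul hp (d l)).add hp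
      ((HeckeRPF.isRPF_qZero hp k a₀ b₁).C_mul hp c₀)
    exact ⟨hq, hq.hasSymmetricPoleSystems hp hg (HeckeRPF.polesSelfConjugate_sum hp hg hx hxs)⟩
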